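/- Let $d\ge 5$. Let $\{p_k\}_{k\ge 0}$ be an offspring law with $p_1<1$, $\sum_k kp_k=1$ and $\sigma^2=\sum_k (k-1)^2p_k\in(0,\infty)$. Let $\mu$ be a probability law on $\mathbb{Z}^d$ with zero mean, not supported on a strict subgroup of $\mathbb{Z}^d$, with finite second moments and positive definite covariance matrix $\Gamma$, and suppose that there is a constant $C>0$ with $\mu(\{x:\|x\|>r\})<C\,r^{-d}$ for all $r\ge 1$, where $\|\cdot\|$ is the Euclidean norm. Put $$\mathcal{J}(x)=\sqrt{x\cdot\Gamma^{-1}x/d},\qquad \mathbf{c}_d=\frac{\Gamma(d/2)}{d^{d/2-1}(d-2)\pi^{d/2}\sqrt{\det\Gamma}},$$ where $\Gamma(d/2)$ in the numerator is a value of the Gamma function. Let $K\subset\mathbb{Z}^d$ be finite and non-empty. Under $\mathbf{P}_x$, let $\{(u,S_u)\}_{u\in\mathbb{T}}$ be the branching random walk started from one individual at $x$, in which every individual independently has $k$ children with probability $p_k$ and every child jumps independently from the position of its parent according to $\mu$. Let $Z_{\mathbb{T}}(K)=\sum_{u\in\mathbb{T}}\mathbf{1}\{S_u\in K\}$, and let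 $L_K$ be the number of $u\in\mathbb{T}$ with $S_u\in K$ none of whose strict ancestors is in $K$. These variables are almost surely finite. **Backward spine.** For $y\in K$, under $\bar{\mathbf{P}}_y$, let $(S_n)_{n\ge 0}$ be a random walk started at $y$ whose increments are distributed as $-X$ with $X\sim\mu$; let $(A_k,A_k')_{k\ge1}$ be i.i.d. with $\bar{\mathbf{P}}_y(A_k=i,A_k'=j)=p_{i+j+1}$ (numbers of left and right siblings), and $B_k=A_k+A_k'$; let $X_{k,j}$ be i.i.d. of law $\mu$; given these, from each of the points $S_k+X_{k,j}$, $k\ge1$, $1\le j\le B_k$ (the first $A_k$ of which are the left siblings), start an independent branching random walk as above, with pioneer number $L_K^{k,j}$ and occupation time $Z_K^{k,j}$ of $K$; and let $Z_K(y)$ be independent of all this and distributed as $Z_{\mathbb{T}}(K)$ under $\mathbf{P}_y$. Here $(S_n)$, $(A_k,A_k')$ and $(X_{k,j})$ are independent. Put $$\Sigma_\infty=\sum_{k\ge1}\sum_{j=1}^{B_k}L_K^{k,j},\qquad \widetilde\Sigma_\infty=\sum_{k\ge1}\sum_{j=1}^{B_k}Z_K^{k,j},\qquad T_K^+=\inf\{n\ge1:S_n\in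 K\}.$$ Define the branching capacity $\mathbf{BCap}(K)=\sum_{y\in K}\widetilde{\mathbf{Es}}_K(y)$, where $\widetilde{\mathbf{Es}}_K(y)$ is the $\bar{\mathbf{P}}_y$-probability that $T_K^+=\infty$ and none of the branching random walks started from the left siblings visits $K$. **Theorem.** 1. For every $y\in K$, $\Sigma_\infty$ and $\widetilde\Sigma_\infty$ are finite $\bar{\mathbf{P}}_y$-almost surely. 2. $\displaystyle\lim_{\|x\|\to\infty}\mathcal{J}(x)^{d-2}\,\mathbf{P}_x(Z_{\mathbb{T}}(K)\ge1)=\mathbf{c}_d\,\mathbf{BCap}(K)$, where $$0<\mathbf{BCap}(K)=\sum_{y\in K}\bar{\mathbf{E}}_y\left[\frac{\mathbf{1}\{T_K^+=\infty\}}{1+\Sigma_\infty}\right]<\infty.$$ 3. As $\|x\|\to\infty$, under $\mathbf{P}_x(\,\cdot\mid Z_{\mathbb{T}}(K)\ge1)$, the pair $(L_K,Z_{\mathbb{T}}(K))$ converges jointly in law to a random vector $(Y_{d,K},Z_{d,K})$, whose law is the probability measure given by $$\mathbf{E}[f(Y_{d,K},Z_{d,K})]=\left(\sum_{y\in K}\bar{\mathbf{E}}_y\left[\frac{\mathbf{1}\{T_K^+=\infty\}}{1+\Sigma_\infty}\right]\right)^{-1}\sum_{y\in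 K}\bar{\mathbf{E}}_y\left[\frac{f\big(1+\Sigma_\infty,\;Z_K(y)+\widetilde\Sigma_\infty\big)}{1+\Sigma_\infty}\,\mathbf{1}\{T_K^+=\infty\}\right]$$ for all bounded continuous $f:\mathbb{R}^2\to\mathbb{R}$. 4. The vector $(Y_{d,K},Z_{d,K})$ is non-degenerate: its law is not carried by a point or by a line of $\mathbb{R}^2$. -/

import Mathlib

open Filter Topology MeasureTheory ProbabilityTheory
open scoped ENNReal

noncomputable section

namespace CBRW

/-! ### The lattice, the offspring law and the jump law -/

/-- The lattice `ℤ^d`. -/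
abbrev Site (d : ℕ) : Type := Fin d → ℤ

/-- The Euclidean norm of a lattice point. -/
def euclNorm {d : ℕ} (x : Site d) : ℝ := Real.sqrt (∑ i, (x i : ℝ) ^ 2)

/-- The filter `‖x‖ → ∞` on `ℤ^d`. -/
def atInfinity (d : ℕ) : Filter (Site d) := comap euclNorm atTop

/-- The mean `∑ k p_k` of an offspring law. -/
def offspringMean (p : PMF ℕ) : ℝ≥0∞ := ∑' k : ℕ, (k : ℝ≥0∞) * p k

/-- `σ² = ∑ (k - 1)² p_k`, the variance of an offspring law of mean one. -/
def offspringVariance (p : PMF ℕ) : ℝ≥0∞ :=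
  ∑' k : ℕ, ENNReal.ofReal (((k : ℝ) - 1) ^ 2) * p k

/-- The covariance matrix of a centred jump law. -/
def covMatrix {d : ℕ} (μ : PMF (Site d)) : Matrix (Fin d) (Fin d) ℝ :=
  Matrix.of fun i j => ∑' x : Site d, (μ x).toReal * ((x i : ℝ) * (x j : ℝ))

/-- The standing assumptions on the jump law: zero mean, not supported on a strict subgroup,
finite second moments, positive definite covariance matrix. -/
structure IsJumpLaw {d : ℕ} (μ : PMF (Site d)) : Prop where
  mean_zero : ∀ i, HasSum (fun x : Site d => (μ x).toReal * (x i : ℝ)) 0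
  not_strict_subgroup : ∀ H : AddSubgroup (Site d), μ.support ⊆ (H : Set (Site d)) → H = ⊤
  second_moment : ∀ i, Summable fun x : Site d => (μ x).toReal * (x i : ℝ) ^ 2
  cov_posDef : (covMatrix μ).PosDef

/-- The weak `L^d` condition on the jump law. -/
def WeakLd {d : ℕ} (μ : PMF (Site d)) : Prop :=
  ∃ C : ℝ, 0 < C ∧ ∀ r : ℝ, 1 ≤ r →
    (μ.toMeasure {x : Site d | r < euclNorm x}).toReal < C * (r ^ d)⁻¹

/-- The norm `𝒥(x) = √(x · Γ⁻¹ x / d)`, with `Γ` the covariance matrix. -/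
def jnorm {d : ℕ} (μ : PMF (Site d)) (x : Site d) : ℝ :=
  Real.sqrt ((fun i => (x i : ℝ)) ⬝ᵥ ((covMatrix μ)⁻¹.mulVec fun i => (x i : ℝ)) / d)

/-- The constant `c_d = Γ(d/2) / (d^(d/2-1) (d-2) π^(d/2) √(det Γ))`. -/
def greenConst {d : ℕ} (μ : PMF (Site d)) : ℝ :=
  Real.Gamma ((d : ℝ) / 2) /
    ((d : ℝ) ^ ((d : ℝ) / 2 - 1) * ((d : ℝ) - 2) * Real.pi ^ ((d : ℝ) / 2) *
      Real.sqrt (covMatrix μ).det)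

/-! ### The branching random walk -/

/-- A realisation of the branching random walk. Individuals are labelled by finite words, the
root by the empty word, and `j :: u` is the `j`-th child of `u`, with `j = 0, 1, …`. Every label
`u` carries the number of children of `u` and the jump made by `u` at its birth (the jump of
the root is not used). -/
abbrev Env (d : ℕ) : Type := List ℕ → ℕ × Site d

/-- The law of the branching random walk: all offspring numbers and jumps are independent. -/
def envLaw {d : ℕ} (p : PMF ℕ) (μ : PMF (Site d)) : Measure (Env d) :=
  Measure.infinitePi fun _ : List ℕ => p.toMeasure.prod μ.toMeasure

instance {d : ℕ} (p : PMF ℕ) (μ : PMF (Site d)) : IsProbabilityMeasure (envLaw p μ) := by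
  unfold envLaw; infer_instance

/-- `u` belongs to the genealogical tree. -/
def InTree {d : ℕ} (ω : Env d) : List ℕ → Prop
  | [] => True
  | j :: u => InTree ω u ∧ j < (ω u).1

/-- The position `S_u` of `u`, when the root is at `x`. -/
def pos {d : ℕ} (x : Site d) (ω : Env d) : List ℕ → Site d
  | [] => x
  | j :: u => pos x ω u + (ω (j :: u)).2

/-- The visits to `K`: the individuals `u` of the tree with `S_u ∈ K`, for the root at `x`. -/
def visits {d : ℕ} (K : Finset (Site d)) (x : Site d) (ω : Env d) : Set (List ℕ) :=
  {u | InTree ω u ∧ pos x ω u ∈ K}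

/-- The pioneers `ℒ_K`: the individuals of the tree that are in `K` and have no strict ancestor
in `K`. The ancestors of `u` are the suffixes of the word `u`. -/
def pioneers {d : ℕ} (K : Finset (Site d)) (x : Site d) (ω : Env d) : Set (List ℕ) :=
  {u | InTree ω u ∧ pos x ω u ∈ K ∧ ∀ v : List ℕ, v <:+ u → v ≠ u → pos x ω v ∉ K}

/-- The occupation time `Z_𝕋(K)` under `P_x`. -/
def occ {d : ℕ} (K : Finset (Site d)) (x : Site d) (ω : Env d) : ℝ≥0∞ :=
  ∑' u : List ℕ, (visits K x ω).indicator 1 u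

/-- The number of pioneers `L_K` under `P_x`. -/
def numPioneers {d : ℕ} (K : Finset (Site d)) (x : Site d) (ω : Env d) : ℝ≥0∞ :=
  ∑' u : List ℕ, (pioneers K x ω).indicator 1 u

/-! ### The backward spine -/

/-- The numbers of siblings to the left and to the right of a spine vertex:
`P(L = i, R = j) = p_{i+j+1}`. This is a probability law as `p` has mean one. -/
def siblingLaw (p : PMF ℕ) (hp : offspringMean p = 1) : PMF (ℕ × ℕ) :=
  ⟨fun q => p (q.1 + q.2 + 1), by
    have h : ∑' q : ℕ × ℕ, p (q.1 + q.2 + 1) = 1 := by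
      rw [offspringMean, tsum_eq_zero_add' ENNReal.summable] at hp
      simp only [Nat.cast_zero, zero_mul, zero_add] at hp
      rw [← Finset.HasAntidiagonal.sigmaAntidiagonalEquivProd.tsum_eq, ENNReal.tsum_sigma', ← hp]
      refine tsum_congr fun n => ?_
      rw [tsum_fintype]
      have h2 : ∀ b : Finset.HasAntidiagonal.antidiagonal n,
          p ((Finset.HasAntidiagonal.sigmaAntidiagonalEquivProd ⟨n, b⟩).1 +
            (Finset.HasAntidiagonal.sigmaAntidiagonalEquivProd ⟨n, b⟩).2 + 1) = p (n + 1) := by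
        rintro ⟨b, hb⟩
        change p (b.1 + b.2 + 1) = p (n + 1)
        rw [Finset.HasAntidiagonal.mem_antidiagonal.1 hb]
      rw [Finset.sum_congr rfl fun b _ => h2 b]
      simp
    exact h ▸ ENNReal.summable.hasSum⟩

/-- The data of one step of the backward spine: the increment of the spine, the numbers of left
and of right siblings, and for the `j`-th sibling its jump and its own branching random walk. -/
abbrev Step (d : ℕ) : Type := Site d × (ℕ × ℕ) × (ℕ → Site d × Env d)

/-- A realisation of the backward spine (entry `k` of the sequence describes step `k + 1`),
together with the branching random walk that starts at the end point of the spine. -/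
abbrev Spine (d : ℕ) : Type := (ℕ → Step d) × Env d

/-- The law of one step: the spine increment is distributed as `-X` with `X` of law `μ`, the
siblings jump according to `μ`, and everything is independent. -/
def stepLaw {d : ℕ} (p : PMF ℕ) (hp : offspringMean p = 1) (μ : PMF (Site d)) :
    Measure (Step d) :=
  (μ.map fun x => -x).toMeasure.prod ((siblingLaw p hp).toMeasure.prod
    (Measure.infinitePi fun _ : ℕ => μ.toMeasure.prod (envLaw p μ)))

instance {d : ℕ} (p : PMF ℕ) (hp : offspringMean p = 1) (μ : PMF (Site d)) :
    IsProbabilityMeasure (stepLaw p hp μ) := by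
  unfold stepLaw; infer_instance

/-- The law of the backward spine: independent steps, and an independent branching random walk. -/
def spineLaw {d : ℕ} (p : PMF ℕ) (hp : offspringMean p = 1) (μ : PMF (Site d)) :
    Measure (Spine d) :=
  (Measure.infinitePi fun _ : ℕ => stepLaw p hp μ).prod (envLaw p μ)

instance {d : ℕ} (p : PMF ℕ) (hp : offspringMean p = 1) (μ : PMF (Site d)) :
    IsProbabilityMeasure (spineLaw p hp μ) := by
  unfold spineLaw; infer_instance

/-- The position `S_n` of the spine started from `y`. -/
def spinePos {d : ℕ} (y : Site d) (b : Spine d) (n : ℕ) : Site d :=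
  y + ∑ i ∈ Finset.range n, (b.1 i).1

/-- The number of left siblings at step `k + 1`. -/
def leftSib {d : ℕ} (b : Spine d) (k : ℕ) : ℕ := (b.1 k).2.1.1

/-- The number `B_{k+1}` of all siblings at step `k + 1`. Among `j = 0, …, B_{k+1} - 1` the
first `leftSib b k` are the left siblings. -/
def numSib {d : ℕ} (b : Spine d) (k : ℕ) : ℕ := (b.1 k).2.1.1 + (b.1 k).2.1.2

/-- The position `S_{k+1} + X_{k+1,j}` of the `j`-th sibling at step `k + 1`. -/
def sibPos {d : ℕ} (y : Site d) (b : Spine d) (k j : ℕ) : Site d :=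
  spinePos y b (k + 1) + ((b.1 k).2.2 j).1

/-- The branching random walk issued from the `j`-th sibling at step `k + 1`. -/
def sibEnv {d : ℕ} (b : Spine d) (k j : ℕ) : Env d := ((b.1 k).2.2 j).2

/-- The event `T_K^+ = ∞`: the spine never visits `K` after time `0`. -/
def neverReturns {d : ℕ} (K : Finset (Site d)) (y : Site d) : Set (Spine d) :=
  {b | ∀ n : ℕ, 1 ≤ n → spinePos y b n ∉ K}

/-- `Σ_∞`, the number of pioneers in all the branching random walks issued from siblings. -/
def sibPioneers {d : ℕ} (K : Finset (Site d)) (y : Site d) (b : Spine d) : ℝ≥0∞ :=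
  ∑' k : ℕ, ∑ j ∈ Finset.range (numSib b k), numPioneers K (sibPos y b k j) (sibEnv b k j)

/-- The occupation time of `K` by all the branching random walks issued from siblings. -/
def sibOcc {d : ℕ} (K : Finset (Site d)) (y : Site d) (b : Spine d) : ℝ≥0∞ :=
  ∑' k : ℕ, ∑ j ∈ Finset.range (numSib b k), occ K (sibPos y b k j) (sibEnv b k j)

/-- The weight `1{T_K^+ = ∞} / (1 + Σ_∞)`. -/
def spineWeight {d : ℕ} (K : Finset (Site d)) (y : Site d) (b : Spine d) : ℝ≥0∞ :=
  (neverReturns K y).indicator (fun b => (1 + sibPioneers K y b)⁻¹) b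

/-- The normalising constant `∑_{y ∈ K} E_y[1{T_K^+ = ∞} / (1 + Σ_∞)]`. -/
def spineMass {d : ℕ} (p : PMF ℕ) (hp : offspringMean p = 1) (μ : PMF (Site d))
    (K : Finset (Site d)) : ℝ≥0∞ :=
  ∑ y ∈ K, ∫⁻ b, spineWeight K y b ∂(spineLaw p hp μ)

/-- The vector `(1 + Σ_∞, Z_K(y) + Σ̃_∞)`. -/
def spinePair {d : ℕ} (K : Finset (Site d)) (y : Site d) (b : Spine d) : ℝ × ℝ :=
  ((1 + sibPioneers K y b).toReal, (occ K y b.2 + sibOcc K y b).toReal)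

/-- The limit law, that is the law `ν` with
`∫ f dν = spineMass⁻¹ * ∑_{y ∈ K} E_y[f(1 + Σ_∞, Z_K(y) + Σ̃_∞) 1{T_K^+ = ∞} / (1 + Σ_∞)]`. -/
def limitLaw {d : ℕ} (p : PMF ℕ) (hp : offspringMean p = 1) (μ : PMF (Site d))
    (K : Finset (Site d)) : Measure (ℝ × ℝ) :=
  (spineMass p hp μ K)⁻¹ •
    ∑ y ∈ K, ((spineLaw p hp μ).withDensity (spineWeight K y)).map (spinePair K y)

/-- The escape probability from `y`: neither the spine after time `0` nor any of the branching
random walks issued from left siblings (the past of the root in the infinite branching random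
walk) visits `K`. -/
def escapeProb {d : ℕ} (p : PMF ℕ) (hp : offspringMean p = 1) (μ : PMF (Site d))
    (K : Finset (Site d)) (y : Site d) : ℝ :=
  (spineLaw p hp μ).real {b | b ∈ neverReturns K y ∧
    ∀ k : ℕ, ∀ j < leftSib b k, occ K (sibPos y b k j) (sibEnv b k j) = 0}

/-- The branching capacity of `K`. -/
def branchingCap {d : ℕ} (p : PMF ℕ) (hp : offspringMean p = 1) (μ : PMF (Site d))
    (K : Finset (Site d)) : ℝ :=
  ∑ y ∈ K, escapeProb p hp μ K y

end CBRW

end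

/-!
# The branching capacity of a critical branching random walk in dimension at least five

Write `g` for the Green function of the walk with jump law `μ`. The proof has four ingredients.

**The Green function.** `𝒥(x)^{d-2} g(x) → c_d` (`IsJumpLaw.tendsto_green`). The walk is put in
continuous time, so that `g` is the time integral of a semigroup `heat`. Times of order `|x|²` and
larger are handled by a local central limit theorem, obtained by Fourier inversion on the cube
`[-π, π]^d`. At smaller times, a path reaches `x` either with jumps of size at most `|x| / (2d)`,
which is unlikely by an exponential moment bound, or with a jump of size of order `|x|`, which is
unlikely by the assumption on the tail of `μ` and as `g` is square summable, since `d ≥ 5`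
(`IsJumpLaw.tsum_green_sq_lt_top`).

**The spine.** Seen from a pioneer, the ancestral line is a walk with reversed jumps, and the
numbers of siblings along it have the size-biased law `p_{i+j+1}`. The formula `many_to_one`
expresses by it the mean of a function of `(L_K, Z_𝕋(K))` times the number of pioneers, each of them
weighted by the product over the left siblings of its ancestors of `κ` of their numbers of pioneers.
If `κ = 1`, all pioneers are counted; if `κ` is the indicator of `0`, only the leftmost is counted,
so that the total weight is the indicator of the event `Z_𝕋(K) ≥ 1`.

**The limit.** By the first moments, the backward spine and the trees attached to it visit `K`
finitely often: the mean number of visits is bounded by `∑ z, g (y - z) * g (y' - z)`, which is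
finite. Hence the functions of the first `n` steps of the spine given by `many_to_one` are eventually
constant, and the sum over `n` of their means on the event that the spine is at `x` at time `n` is
equivalent to `g(x)` times the mean of the limit (`IsJumpLaw.tendsto_jweight_mul_tsum`). The leftmost
pioneer gives `P_x(Z_𝕋(K) ≥ 1) ∼ g(x) BCap(K)` (`IsJumpLaw.tendsto_jweight_mul_hit`). All the
pioneers, with the weight `1 / L_K`, give the limit of the law of the counts
(`IsJumpLaw.tendsto_jweight_mul_setLIntegral`) and the same probability with `spineMass` in place of
`BCap(K)`. By uniqueness of limits, `BCap(K) = spineMass`.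

**Positivity and non-degeneracy.** The spine cannot return to `K` forever, so that it escapes from
some point of `K`, and `spineMass ≠ 0`. The law of the limit is not carried by a line
`a Y + b Z = c`. If `b ≠ 0`, the term `Z_K(y)` is independent of the rest and not constant: it is `1`
with positive probability, and its mean is at least `g(0) > 1`. If `b = 0`, then `Σ_∞` would be
constant when the spine escapes. Replacing the tree of the first sibling at a given step by an
independent one shows that this sibling, if it exists, would be in `K`. As siblings exist at
infinitely many steps, `K` would be visited infinitely often.
-/


open Filter Topology MeasureTheory ProbabilityTheory
open scoped ENNReal

noncomputable section

namespace CBRW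

variable {d : ℕ}

/-! ### Convolutions on the lattice, Green functions and the Poissonised semigroup -/

/-- Convolution of nonnegative functions on the lattice. -/
def latticeConv (f g : Site d → ℝ≥0∞) (x : Site d) : ℝ≥0∞ := ∑' z, f z * g (x - z)

/-- The `n`-fold convolution power `f^{*n}`. -/
def convPow (f : Site d → ℝ≥0∞) : ℕ → Site d → ℝ≥0∞
  | 0 => Pi.single 0 1
  | n + 1 => latticeConv f (convPow f n)

/-- The Green function `∑ₙ f^{*n}`. -/
def green (f : Site d → ℝ≥0∞) (x : Site d) : ℝ≥0∞ := ∑' n, convPow f n x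

/-- The transition function `e^{-t} ∑ₙ (tⁿ / n!) f^{*n}` of the continuous-time walk with jump
law `f`. -/
def heat (f : Site d → ℝ≥0∞) (t : ℝ) (x : Site d) : ℝ≥0∞ :=
  ∑' n : ℕ, ENNReal.ofReal (Real.exp (-t) * (t ^ n / n.factorial)) * convPow f n x

lemma latticeConv_comm (f g : Site d → ℝ≥0∞) : latticeConv f g = latticeConv g f := by
  funext x
  rw [latticeConv, ← (Equiv.subLeft x).tsum_eq]
  exact tsum_congr fun z => by simp [mul_comm]

lemma latticeConv_mono {f f' g g' : Site d → ℝ≥0∞} (hf : f ≤ f') (hg : g ≤ g') :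
    latticeConv f g ≤ latticeConv f' g' := fun x =>
  ENNReal.tsum_le_tsum fun z => mul_le_mul' (hf z) (hg (x - z))

lemma tsum_latticeConv_mul (f g e : Site d → ℝ≥0∞) (he : ∀ x y, e (x + y) = e x * e y) :
    ∑' x, latticeConv f g x * e x = (∑' x, f x * e x) * ∑' x, g x * e x := by
  simp_rw [latticeConv, ← ENNReal.tsum_mul_right]
  rw [ENNReal.tsum_comm]
  refine tsum_congr fun z => ?_
  rw [← ENNReal.tsum_mul_left, ← (Equiv.addLeft z).tsum_eq]
  refine tsum_congr fun y => ?_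
  simp only [Equiv.coe_addLeft, add_sub_cancel_left, he]
  ring

lemma latticeConv_assoc (f g h : Site d → ℝ≥0∞) :
    latticeConv (latticeConv f g) h = latticeConv f (latticeConv g h) := by
  funext x
  simp_rw [latticeConv, ← ENNReal.tsum_mul_left, ← ENNReal.tsum_mul_right]
  rw [ENNReal.tsum_comm]
  refine tsum_congr fun z => ?_
  rw [← (Equiv.addLeft z).tsum_eq]
  refine tsum_congr fun y => ?_
  simp only [Equiv.coe_addLeft, add_sub_cancel_left, mul_assoc]
  congr 3
  abel

lemma latticeConv_tsum_right {ι : Type*} (f : Site d → ℝ≥0∞) (g : ι → Site d → ℝ≥0∞) (x : Site d) :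
    latticeConv f (fun y => ∑' i, g i y) x = ∑' i, latticeConv f (g i) x := by
  simp_rw [latticeConv, ← ENNReal.tsum_mul_left]
  exact ENNReal.tsum_comm

lemma latticeConv_tsum_left {ι : Type*} (f : Site d → ℝ≥0∞) (g : ι → Site d → ℝ≥0∞) (x : Site d) :
    latticeConv (fun y => ∑' i, g i y) f x = ∑' i, latticeConv (g i) f x := by
  simp_rw [latticeConv, ← ENNReal.tsum_mul_right]
  exact ENNReal.tsum_comm

lemma latticeConv_mul_right (c : ℝ≥0∞) (f g : Site d → ℝ≥0∞) (x : Site d) :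
    latticeConv f (fun y => c * g y) x = c * latticeConv f g x := by
  simp_rw [latticeConv, ← ENNReal.tsum_mul_left]
  exact tsum_congr fun z => by ring

lemma latticeConv_mul_left (c : ℝ≥0∞) (f g : Site d → ℝ≥0∞) (x : Site d) :
    latticeConv (fun y => c * g y) f x = c * latticeConv g f x := by
  simp_rw [latticeConv, ← ENNReal.tsum_mul_left]
  exact tsum_congr fun z => by ring

lemma latticeConv_add_right (f g h : Site d → ℝ≥0∞) :
    latticeConv f (g + h) = latticeConv f g + latticeConv f h := by
  funext x
  simp [latticeConv, mul_add, ENNReal.tsum_add]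

lemma latticeConv_add_left (f g h : Site d → ℝ≥0∞) :
    latticeConv (f + g) h = latticeConv f h + latticeConv g h := by
  funext x
  simp [latticeConv, add_mul, ENNReal.tsum_add]

lemma latticeConv_sum_right {ι : Type*} (S : Finset ι) (f : Site d → ℝ≥0∞)
    (g : ι → Site d → ℝ≥0∞) :
    latticeConv f (∑ i ∈ S, g i) = ∑ i ∈ S, latticeConv f (g i) := by
  classical
  induction S using Finset.induction_on with
  | empty => funext x; simp [latticeConv]
  | insert q S hq ih =>
    rw [Finset.sum_insert hq, Finset.sum_insert hq, latticeConv_add_right, ih]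

lemma single_latticeConv (g : Site d → ℝ≥0∞) : latticeConv (Pi.single 0 1) g = g := by
  funext x
  rw [latticeConv, tsum_eq_single 0 fun z hz => by simp [Pi.single_eq_of_ne hz]]
  simp

lemma latticeConv_le_mul {f g : Site d → ℝ≥0∞} {M : ℝ≥0∞} (hg : ∀ x, g x ≤ M) (x : Site d) :
    latticeConv f g x ≤ (∑' z, f z) * M := by
  rw [← ENNReal.tsum_mul_right]
  exact ENNReal.tsum_le_tsum fun z => by gcongr; exact hg _

/-- Convolving two nonnegative functions: Cauchy–Schwarz in the form `2ab ≤ a² + b²`. -/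
lemma latticeConv_self_le (g : Site d → ℝ≥0∞) (x : Site d) :
    latticeConv g g x ≤ ∑' z, g z ^ 2 := by
  have h (a b : ℝ≥0∞) : 2 * (a * b) ≤ a ^ 2 + b ^ 2 := by
    rcases eq_or_ne a ∞ with rfl | ha
    · simp
    rcases eq_or_ne b ∞ with rfl | hb
    · simp
    lift a to NNReal using ha
    lift b to NNReal using hb
    norm_cast
    rw [← mul_assoc]
    exact two_mul_le_add_sq a b
  have h2 : 2 * latticeConv g g x ≤ 2 * ∑' z, g z ^ 2 := by
    rw [latticeConv, ← ENNReal.tsum_mul_left]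
    calc ∑' z, 2 * (g z * g (x - z)) ≤ ∑' z, (g z ^ 2 + g (x - z) ^ 2) :=
          ENNReal.tsum_le_tsum fun z => h _ _
      _ = 2 * ∑' z, g z ^ 2 := by
          rw [ENNReal.tsum_add, two_mul]
          congr 1
          exact (Equiv.subLeft x).tsum_eq fun z => g z ^ 2
  exact (ENNReal.mul_le_mul_iff_right (by simp) (by simp)).1 h2

lemma convPow_one (f : Site d → ℝ≥0∞) : convPow f 1 = f := by
  rw [convPow, convPow, latticeConv_comm, single_latticeConv]

lemma convPow_add (f : Site d → ℝ≥0∞) (m n : ℕ) :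
    convPow f (m + n) = latticeConv (convPow f m) (convPow f n) := by
  induction m with
  | zero => rw [zero_add, convPow, single_latticeConv]
  | succ m ih => rw [Nat.add_right_comm, convPow, ih, convPow, latticeConv_assoc]

lemma convPow_mono {f g : Site d → ℝ≥0∞} (h : f ≤ g) (n : ℕ) : convPow f n ≤ convPow g n := by
  induction n with
  | zero => exact le_rfl
  | succ n ih => exact latticeConv_mono h ih

/-- Multiplicative weights turn convolution powers into powers. -/
lemma tsum_convPow_mul (f e : Site d → ℝ≥0∞) (he : ∀ x y, e (x + y) = e x * e y) (he0 : e 0 = 1)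
    (n : ℕ) : ∑' x, convPow f n x * e x = (∑' x, f x * e x) ^ n := by
  induction n with
  | zero =>
    rw [tsum_eq_single 0 fun z hz => by simp [convPow, Pi.single_eq_of_ne hz]]
    simp [convPow, he0]
  | succ n ih => rw [convPow, tsum_latticeConv_mul f _ e he, ih, pow_succ']

lemma tsum_convPow {f : Site d → ℝ≥0∞} (hf : ∑' x, f x = 1) (n : ℕ) :
    ∑' x, convPow f n x = 1 := by
  simpa [hf] using tsum_convPow_mul f (fun _ => 1) (by simp) rfl n

lemma green_eq_add (f : Site d → ℝ≥0∞) : green f = Pi.single 0 1 + latticeConv f (green f) := by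
  funext x
  rw [green, tsum_eq_zero_add' ENNReal.summable]
  congr 1
  exact (latticeConv_tsum_right f (convPow f) x).symm

lemma convPow_le_green (f : Site d → ℝ≥0∞) (n : ℕ) : convPow f n ≤ green f := fun x =>
  ENNReal.le_tsum (f := fun n => convPow f n x) n

/-- If `f = s + b`, then expanding `f^{*n}` at the first factor `b` bounds it by `s^{*n}` plus the
terms in which some factor is `b`. -/
lemma convPow_succ_le_of_eq_add {f s b : Site d → ℝ≥0∞} (h : f = s + b) (n : ℕ) :
    convPow f (n + 1) ≤ convPow s (n + 1) + ∑ q ∈ Finset.HasAntidiagonal.antidiagonal n,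
      latticeConv (convPow f q.1) (latticeConv b (convPow f q.2)) := by
  have hs : s ≤ f := h ▸ le_self_add
  have step (m : ℕ) : convPow f (m + 1) = latticeConv s (convPow f m) +
      latticeConv b (convPow f m) := by
    conv_lhs => rw [convPow, h, latticeConv_add_left, ← h]
  induction n with
  | zero =>
    rw [step]
    simp [convPow, single_latticeConv]
  | succ n ih =>
    rw [step, Finset.Nat.antidiagonal_succ, Finset.sum_cons, Finset.sum_map]
    calc _ ≤ latticeConv s (convPow s (n + 1) + ∑ q ∈ Finset.HasAntidiagonal.antidiagonal n,
          latticeConv (convPow f q.1) (latticeConv b (convPow f q.2)))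
          + latticeConv b (convPow f (n + 1)) := by
          gcongr
          exact latticeConv_mono le_rfl ih
      _ ≤ _ := by
          rw [latticeConv_add_right, add_assoc, add_comm (latticeConv s _) (latticeConv b _)]
          refine add_le_add le_rfl (add_le_add ?_ ?_)
          · simp [convPow, single_latticeConv]
          · refine (latticeConv_mono hs le_rfl).trans (le_of_eq ?_)
            rw [latticeConv_sum_right]
            refine Finset.sum_congr rfl fun q _ => ?_
            simp [convPow, latticeConv_assoc]

/-- The remainder `e` collects the terms with a factor `b`; summed over `n` it becomes a convolution
of Green functions with one factor `b` in between. -/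
lemma convPow_le_of_eq_add {f s b : Site d → ℝ≥0∞} (h : f = s + b) :
    ∃ e : ℕ → Site d → ℝ≥0∞, (∀ n, convPow f n ≤ convPow s n + e n) ∧
      ∀ x, ∑' n, e n x = latticeConv (green f) (latticeConv b (green f)) x := by
  refine ⟨fun n => n.casesOn 0 fun n => ∑ q ∈ Finset.HasAntidiagonal.antidiagonal n,
      latticeConv (convPow f q.1) (latticeConv b (convPow f q.2)), fun n => ?_, fun x => ?_⟩
  · cases n with
    | zero => simp [convPow]
    | succ n => exact convPow_succ_le_of_eq_add h n
  · rw [tsum_eq_zero_add' ENNReal.summable]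
    simp only [Finset.sum_apply]
    have h1 : latticeConv (green f) (latticeConv b (green f)) x = ∑' q : ℕ × ℕ,
        latticeConv (convPow f q.1) (latticeConv b (convPow f q.2)) x := by
      rw [ENNReal.tsum_prod']
      change latticeConv (fun y => ∑' i, convPow f i y) _ x = _
      rw [latticeConv_tsum_left]
      refine tsum_congr fun i => ?_
      dsimp only
      rw [← latticeConv_tsum_right]
      congr 1
      funext y
      exact latticeConv_tsum_right b (convPow f) y
    rw [h1, ← Finset.HasAntidiagonal.sigmaAntidiagonalEquivProd.tsum_eq, ENNReal.tsum_sigma']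
    refine (zero_add _).trans (tsum_congr fun n => ?_)
    rw [tsum_fintype, Finset.univ_eq_attach,
      ← Finset.sum_attach (Finset.HasAntidiagonal.antidiagonal n)]
    rfl

/-- The Poisson weights have total integral `1` over time, which is why the integral of `heat` over
time is `green`. -/
lemma lintegral_exp_neg_mul_pow (n : ℕ) :
    ∫⁻ t in Set.Ioi (0 : ℝ), ENNReal.ofReal (Real.exp (-t) * (t ^ n / n.factorial)) = 1 := by
  have hi := (Real.GammaIntegral_convergent (s := n + 1) (by positivity)).div_const
    (n.factorial : ℝ)
  have h1 : ∀ t : ℝ, Real.exp (-t) * t ^ ((n : ℝ) + 1 - 1) / n.factorial =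
      Real.exp (-t) * (t ^ n / n.factorial) := fun t => by
    rw [add_sub_cancel_right, Real.rpow_natCast, mul_div_assoc]
  simp_rw [h1] at hi
  rw [← ofReal_integral_eq_lintegral_ofReal hi ?_]
  · simp_rw [← h1]
    rw [integral_div, ← Real.Gamma_eq_integral (by positivity), Real.Gamma_nat_eq_factorial,
      div_self (by positivity), ENNReal.ofReal_one]
  · filter_upwards [ae_restrict_mem measurableSet_Ioi] with t ht
    have : 0 < t := ht
    positivity

lemma measurable_heat (f : Site d → ℝ≥0∞) (x : Site d) : Measurable fun t => heat f t x := by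
  unfold heat
  fun_prop

lemma lintegral_heat (f : Site d → ℝ≥0∞) (x : Site d) :
    ∫⁻ t in Set.Ioi (0 : ℝ), heat f t x = green f x := by
  unfold heat green
  rw [lintegral_tsum fun n => by fun_prop]
  refine tsum_congr fun n => ?_
  rw [lintegral_mul_const _ (by fun_prop), lintegral_exp_neg_mul_pow, one_mul]

lemma heat_mono {f g : Site d → ℝ≥0∞} (h : f ≤ g) (t : ℝ) (x : Site d) :
    heat f t x ≤ heat g t x :=
  ENNReal.tsum_le_tsum fun n => by gcongr; exact convPow_mono h n x

/-- The semigroup property (Chapman–Kolmogorov). -/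
lemma heat_add (f : Site d → ℝ≥0∞) {s t : ℝ} (hs : 0 ≤ s) (ht : 0 ≤ t) :
    heat f (s + t) = latticeConv (heat f s) (heat f t) := by
  funext x
  have h1 : latticeConv (heat f s) (heat f t) x = ∑' q : ℕ × ℕ,
      ENNReal.ofReal (Real.exp (-s) * (s ^ q.1 / q.1.factorial)) *
        (ENNReal.ofReal (Real.exp (-t) * (t ^ q.2 / q.2.factorial)) * convPow f (q.1 + q.2) x) := by
    rw [ENNReal.tsum_prod']
    change latticeConv (fun y => ∑' i : ℕ, _ * convPow f i y) _ x = _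
    rw [latticeConv_tsum_left]
    refine tsum_congr fun i => ?_
    dsimp only
    rw [latticeConv_mul_left, ENNReal.tsum_mul_left]
    congr 1
    change latticeConv _ (fun y => ∑' j : ℕ, _ * convPow f j y) x = _
    rw [latticeConv_tsum_right]
    refine tsum_congr fun j => ?_
    rw [latticeConv_mul_right, convPow_add]
  -- group the pairs of numbers of jumps by their sum, and apply the binomial formula
  rw [h1, ← Finset.HasAntidiagonal.sigmaAntidiagonalEquivProd.tsum_eq, ENNReal.tsum_sigma', heat]
  refine tsum_congr fun n => ?_
  rw [tsum_fintype, Finset.univ_eq_attach]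
  simp_rw [Finset.HasAntidiagonal.sigmaAntidiagonalEquivProd_apply]
  rw [Finset.sum_attach (Finset.HasAntidiagonal.antidiagonal n) fun q : ℕ × ℕ =>
    ENNReal.ofReal (Real.exp (-s) * (s ^ q.1 / q.1.factorial)) *
        (ENNReal.ofReal (Real.exp (-t) * (t ^ q.2 / q.2.factorial)) * convPow f (q.1 + q.2) x)]
  have h2 : ∀ q ∈ Finset.HasAntidiagonal.antidiagonal n,
      ENNReal.ofReal (Real.exp (-s) * (s ^ q.1 / q.1.factorial)) *
        (ENNReal.ofReal (Real.exp (-t) * (t ^ q.2 / q.2.factorial)) * convPow f (q.1 + q.2) x) =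
      ENNReal.ofReal (Real.exp (-(s + t)) * (s ^ q.1 / q.1.factorial * (t ^ q.2 / q.2.factorial))) *
        convPow f n x := by
    intro q hq
    rw [Finset.HasAntidiagonal.mem_antidiagonal.1 hq, ← mul_assoc, ← ENNReal.ofReal_mul (by positivity), neg_add,
      Real.exp_add]
    congr 2
    ring
  rw [Finset.sum_congr rfl h2, ← Finset.sum_mul, ← ENNReal.ofReal_sum_of_nonneg
    fun q _ => by positivity, ← Finset.mul_sum]
  congr 3
  rw [(Commute.all s t).add_pow', Finset.sum_div]
  refine Finset.sum_congr rfl fun q hq => ?_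
  rw [← Finset.HasAntidiagonal.mem_antidiagonal.1 hq, ← Nat.add_choose_mul_factorial_mul_factorial q.1 q.2]
  have := (Nat.choose_pos (Nat.le_add_right q.1 q.2)).ne'
  rw [nsmul_eq_mul, Nat.choose_symm_add] at *
  push_cast
  field_simp

lemma tsum_heat_mul (f e : Site d → ℝ≥0∞) (he : ∀ x y, e (x + y) = e x * e y) (he0 : e 0 = 1)
    (t : ℝ) : ∑' x, heat f t x * e x =
      ∑' n : ℕ, ENNReal.ofReal (Real.exp (-t) * (t ^ n / n.factorial)) * (∑' x, f x * e x) ^ n := by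
  simp_rw [heat, ← ENNReal.tsum_mul_right]
  rw [ENNReal.tsum_comm]
  refine tsum_congr fun n => ?_
  simp_rw [mul_assoc]
  rw [ENNReal.tsum_mul_left, tsum_convPow_mul f e he he0]

/-- The exponential moments of the continuous-time walk. -/
lemma tsum_heat_mul_ofReal (f e : Site d → ℝ≥0∞) (he : ∀ x y, e (x + y) = e x * e y)
    (he0 : e 0 = 1) {t : ℝ} (ht : 0 ≤ t) {a : ℝ} (ha : 0 ≤ a)
    (h : ∑' x, f x * e x = ENNReal.ofReal a) :
    ∑' x, heat f t x * e x = ENNReal.ofReal (Real.exp (t * (a - 1))) := by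
  rw [tsum_heat_mul f e he he0, h]
  have h1 : HasSum (fun n : ℕ => Real.exp (-t) * (t ^ n / n.factorial) * a ^ n)
      (Real.exp (t * (a - 1))) := by
    have := (NormedSpace.expSeries_div_hasSum_exp (𝔸 := ℝ) (t * a)).mul_left (Real.exp (-t))
    rw [← Real.exp_eq_exp_ℝ, ← Real.exp_add] at this
    convert! this using 2
    · rw [mul_pow]; ring
    · ring
  rw [← h1.tsum_eq, ENNReal.ofReal_tsum_of_nonneg (fun n => by positivity) h1.summable]
  refine tsum_congr fun n => ?_
  rw [← ENNReal.ofReal_pow ha, ← ENNReal.ofReal_mul (by positivity)]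

lemma tsum_heat {f : Site d → ℝ≥0∞} (hf : ∑' x, f x = 1) {t : ℝ} (ht : 0 ≤ t) :
    ∑' x, heat f t x = 1 := by
  simpa using tsum_heat_mul_ofReal f (fun _ => 1) (by simp) rfl ht zero_le_one (by simpa using hf)

/-! ### The characteristic function of the jump law -/

/-- The Euclidean pairing of a frequency with a lattice point. -/
def pairing (θ : Fin d → ℝ) (x : Site d) : ℝ := ∑ i, θ i * (x i : ℝ)

/-- The squared Euclidean norm of a frequency. -/
def normSq (θ : Fin d → ℝ) : ℝ := ∑ i, θ i ^ 2

/-- The characteristic function `∑ μ(x) e^{i θ·x}`. -/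
def latticeCharFun (μ : PMF (Site d)) (θ : Fin d → ℝ) : ℂ :=
  ∑' x, ((μ x).toReal : ℂ) * Complex.exp (pairing θ x * Complex.I)

/-- The fundamental domain `[-π, π]^d` of frequencies. -/
def cube (d : ℕ) : Set (Fin d → ℝ) := Set.univ.pi fun _ => Set.Icc (-Real.pi) Real.pi

@[fun_prop]
lemma continuous_pairing (x : Site d) : Continuous fun θ : Fin d → ℝ => pairing θ x := by
  unfold pairing; fun_prop

@[fun_prop]
lemma continuous_normSq : Continuous (normSq : (Fin d → ℝ) → ℝ) := by
  unfold normSq; fun_prop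

lemma normSq_nonneg (θ : Fin d → ℝ) : 0 ≤ normSq θ := Finset.sum_nonneg fun _ _ => sq_nonneg _

lemma normSq_smul (s : ℝ) (θ : Fin d → ℝ) : normSq (s • θ) = s ^ 2 * normSq θ := by
  simp [normSq, mul_pow, Finset.mul_sum]

lemma normSq_eq_zero {θ : Fin d → ℝ} : normSq θ = 0 ↔ θ = 0 := by
  rw [normSq, Finset.sum_eq_zero_iff_of_nonneg fun _ _ => sq_nonneg _]
  simp [funext_iff]

lemma pairing_smul (s : ℝ) (θ : Fin d → ℝ) (x : Site d) : pairing (s • θ) x = s * pairing θ x := by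
  simp [pairing, Finset.mul_sum, mul_assoc]

lemma pairing_add (θ : Fin d → ℝ) (x y : Site d) :
    pairing θ (x + y) = pairing θ x + pairing θ y := by
  simp [pairing, mul_add, Finset.sum_add_distrib]

lemma pairing_sub (θ : Fin d → ℝ) (x y : Site d) :
    pairing θ (x - y) = pairing θ x - pairing θ y := by
  simp [pairing, mul_sub, Finset.sum_sub_distrib]

lemma euclNorm_sq (x : Site d) : euclNorm x ^ 2 = ∑ i, (x i : ℝ) ^ 2 :=
  Real.sq_sqrt (Finset.sum_nonneg fun _ _ => sq_nonneg _)

lemma euclNorm_nonneg (x : Site d) : 0 ≤ euclNorm x := Real.sqrt_nonneg _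

lemma pairing_sq_le (θ : Fin d → ℝ) (x : Site d) :
    pairing θ x ^ 2 ≤ normSq θ * euclNorm x ^ 2 := by
  rw [euclNorm_sq]
  exact Finset.sum_mul_sq_le_sq_mul_sq _ _ _

lemma abs_pairing_le (θ : Fin d → ℝ) (x : Site d) :
    |pairing θ x| ≤ Real.sqrt (normSq θ) * euclNorm x := by
  rw [← Real.sqrt_sq (euclNorm_nonneg x), ← Real.sqrt_mul (normSq_nonneg θ)]
  exact Real.abs_le_sqrt (pairing_sq_le θ x)

lemma isCompact_cube : IsCompact (cube d) := isCompact_univ_pi fun _ => isCompact_Icc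

lemma measurableSet_cube : MeasurableSet (cube d) := isCompact_cube.measurableSet

lemma hasSum_toReal (μ : PMF (Site d)) : HasSum (fun x => (μ x).toReal) 1 := by
  have := (ENNReal.summable_toReal μ.tsum_coe_ne_top).hasSum
  rwa [← ENNReal.tsum_toReal_eq μ.apply_ne_top, μ.tsum_coe, ENNReal.toReal_one] at this

lemma norm_term_eq (μ : PMF (Site d)) (θ : Fin d → ℝ) (x : Site d) :
    ‖((μ x).toReal : ℂ) * Complex.exp (pairing θ x * Complex.I)‖ = (μ x).toReal := by
  rw [norm_mul, Complex.norm_exp_ofReal_mul_I, mul_one, Complex.norm_real, Real.norm_eq_abs,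
    abs_of_nonneg ENNReal.toReal_nonneg]

lemma summable_charFun_term (μ : PMF (Site d)) (θ : Fin d → ℝ) :
    Summable fun x => ((μ x).toReal : ℂ) * Complex.exp (pairing θ x * Complex.I) :=
  .of_norm (by simpa only [norm_term_eq] using (hasSum_toReal μ).summable)

@[fun_prop]
lemma continuous_latticeCharFun (μ : PMF (Site d)) : Continuous (latticeCharFun μ) :=
  continuous_tsum (fun x => by fun_prop) (hasSum_toReal μ).summable
    fun x θ => (norm_term_eq μ θ x).le

lemma norm_latticeCharFun_le (μ : PMF (Site d)) (θ : Fin d → ℝ) : ‖latticeCharFun μ θ‖ ≤ 1 :=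
  tsum_of_norm_bounded (hasSum_toReal μ) fun x => (norm_term_eq μ θ x).le

lemma hasSum_one_sub_re (μ : PMF (Site d)) (θ : Fin d → ℝ) :
    HasSum (fun x => (μ x).toReal * (1 - Real.cos (pairing θ x)))
      (1 - (latticeCharFun μ θ).re) := by
  have := (hasSum_toReal μ).sub (Complex.hasSum_re (summable_charFun_term μ θ).hasSum)
  convert! this using 2 with x
  rw [Complex.re_ofReal_mul, Complex.exp_ofReal_mul_I_re]
  ring

lemma integral_cube_exp (x : Site d) :
    ∫ θ in cube d, Complex.exp (-(pairing θ x * Complex.I)) =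
      if x = 0 then ((2 * Real.pi) ^ d : ℂ) else 0 := by
  have h1 : ∀ θ : Fin d → ℝ, Complex.exp (-(pairing θ x * Complex.I)) =
      ∏ i, Complex.exp (-((x i : ℂ) * Complex.I) * θ i) := fun θ => by
    rw [← Complex.exp_sum, pairing]
    congr 1
    push_cast
    rw [Finset.sum_mul, ← Finset.sum_neg_distrib]
    exact Finset.sum_congr rfl fun i _ => by ring
  have h2 : ∀ n : ℤ, ∫ s in Set.Icc (-Real.pi) Real.pi, Complex.exp (-((n : ℂ) * Complex.I) * s) =
      if n = 0 then (2 * Real.pi : ℂ) else 0 := fun n => by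
    rw [integral_Icc_eq_integral_Ioc,
      ← intervalIntegral.integral_of_le (by linarith [Real.pi_pos])]
    split_ifs with hn
    · simp [hn, two_mul]
    · have hc : -((n : ℂ) * Complex.I) ≠ 0 := by simp [hn]
      rw [integral_exp_mul_complex hc, div_eq_zero_iff, sub_eq_zero]
      left
      rw [Complex.exp_eq_exp_iff_exists_int]
      exact ⟨-n, by push_cast; ring⟩
  simp_rw [h1]
  rw [cube, volume_pi, Measure.restrict_pi_pi,
    integral_fintype_prod_eq_prod (fun i (s : ℝ) => Complex.exp (-((x i : ℂ) * Complex.I) * s))]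
  simp_rw [h2]
  split_ifs with hx
  · simp [hx]
  · obtain ⟨i, hi⟩ := Function.ne_iff.1 hx
    exact Finset.prod_eq_zero (Finset.mem_univ i) (if_neg hi)

lemma convPow_le_one (μ : PMF (Site d)) (n : ℕ) (x : Site d) : convPow μ n x ≤ 1 :=
  (ENNReal.le_tsum x).trans (tsum_convPow μ.tsum_coe n).le

lemma norm_exp_neg_pairing (θ : Fin d → ℝ) (x : Site d) :
    ‖Complex.exp (-(pairing θ x * Complex.I))‖ = 1 := by
  rw [← neg_mul, ← Complex.ofReal_neg, Complex.norm_exp_ofReal_mul_I]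

lemma tsum_integral_cube {ι : Type*} [Countable ι] {F : ι → (Fin d → ℝ) → ℂ} {b : ι → ℝ}
    (hF : ∀ i, Continuous (F i)) (hb : Summable b) (h : ∀ i θ, ‖F i θ‖ ≤ b i) :
    ∑' i, ∫ θ in cube d, F i θ = ∫ θ in cube d, ∑' i, F i θ := by
  have : IsFiniteMeasure (volume.restrict (cube d)) :=
    ⟨by simpa using isCompact_cube.measure_lt_top⟩
  exact (hasSum_integral_of_dominated_convergence (fun i _ => b i)
    (fun i => (hF i).aestronglyMeasurable) (fun i => ae_of_all _ (h i)) (ae_of_all _ fun _ => hb)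
    (integrable_const _) (ae_of_all _ fun θ => (Summable.of_norm_bounded hb (h · θ)).hasSum)).tsum_eq

/-- Fourier inversion for the transition probabilities of the walk. -/
lemma convPow_eq_integral (μ : PMF (Site d)) (n : ℕ) (x : Site d) :
    ((2 * Real.pi) ^ d * (convPow μ n x).toReal : ℂ) =
      ∫ θ in cube d, Complex.exp (-(pairing θ x * Complex.I)) * latticeCharFun μ θ ^ n := by
  induction n generalizing x with
  | zero =>
    simp only [pow_zero, mul_one, integral_cube_exp, convPow, Pi.single_apply]
    split_ifs <;> simp
  | succ n ih =>
    have h1 : (convPow μ (n + 1) x).toReal =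
        ∑' z, (μ z).toReal * (convPow μ n (x - z)).toReal := by
      rw [convPow, latticeConv, ENNReal.tsum_toReal_eq fun z => ENNReal.mul_ne_top
        (μ.apply_ne_top z) ((convPow_le_one μ n _).trans_lt ENNReal.one_lt_top).ne]
      exact tsum_congr fun z => ENNReal.toReal_mul
    have hb (z : Site d) (θ : Fin d → ℝ) : ‖((μ z).toReal : ℂ) *
        (Complex.exp (-(pairing θ (x - z) * Complex.I)) * latticeCharFun μ θ ^ n)‖
          ≤ (μ z).toReal := by
      rw [norm_mul, norm_mul, norm_exp_neg_pairing, norm_pow, one_mul, Complex.norm_real,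
        Real.norm_eq_abs, abs_of_nonneg ENNReal.toReal_nonneg]
      exact mul_le_of_le_one_right ENNReal.toReal_nonneg
        (pow_le_one₀ (norm_nonneg _) (norm_latticeCharFun_le μ θ))
    rw [h1, Complex.ofReal_tsum, ← tsum_mul_left]
    have h2 : ∀ z, ((2 * Real.pi) ^ d * ((μ z).toReal * (convPow μ n (x - z)).toReal : ℝ) : ℂ) =
        ∫ θ in cube d, ((μ z).toReal : ℂ) *
          (Complex.exp (-(pairing θ (x - z) * Complex.I)) * latticeCharFun μ θ ^ n) := fun z => by
      rw [integral_const_mul, ← ih]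
      push_cast
      ring
    simp_rw [h2]
    -- exchange the sum over the first jump and the integral
    rw [tsum_integral_cube (fun z => by fun_prop) (hasSum_toReal μ).summable hb]
    refine integral_congr_ae (ae_of_all _ fun θ => ?_)
    dsimp only
    rw [pow_succ, ← mul_assoc]
    conv_rhs =>
      enter [2]
      rw [latticeCharFun]
    rw [← tsum_mul_left]
    refine tsum_congr fun z => ?_
    have h3 : Complex.exp (-(pairing θ (x - z) * Complex.I)) =
        Complex.exp (-(pairing θ x * Complex.I)) * Complex.exp (pairing θ z * Complex.I) := by
      rw [← Complex.exp_add, pairing_sub]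
      congr 1
      push_cast
      ring
    rw [h3]
    ring

lemma heat_le_one (μ : PMF (Site d)) {t : ℝ} (ht : 0 ≤ t) (x : Site d) : heat μ t x ≤ 1 :=
  (ENNReal.le_tsum x).trans (tsum_heat μ.tsum_coe ht).le

/-- Fourier inversion for the continuous-time walk. -/
lemma heat_eq_integral (μ : PMF (Site d)) {t : ℝ} (ht : 0 ≤ t) (x : Site d) :
    ((2 * Real.pi) ^ d * (heat μ t x).toReal : ℂ) =
      ∫ θ in cube d, Complex.exp (-(pairing θ x * Complex.I)) *
        Complex.exp (-(t * (1 - latticeCharFun μ θ))) := by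
  have h1 : (heat μ t x).toReal =
      ∑' n : ℕ, Real.exp (-t) * (t ^ n / n.factorial) * (convPow μ n x).toReal := by
    rw [heat, ENNReal.tsum_toReal_eq fun n => ENNReal.mul_ne_top ENNReal.ofReal_ne_top
        ((convPow_le_one μ n _).trans_lt ENNReal.one_lt_top).ne]
    refine tsum_congr fun n => ?_
    rw [ENNReal.toReal_mul, ENNReal.toReal_ofReal (by positivity)]
  have h2 : ∀ n : ℕ, ((2 * Real.pi) ^ d *
      (Real.exp (-t) * (t ^ n / n.factorial) * (convPow μ n x).toReal : ℝ) : ℂ) =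
      ∫ θ in cube d, ((Real.exp (-t) * (t ^ n / n.factorial) : ℝ) : ℂ) *
        (Complex.exp (-(pairing θ x * Complex.I)) * latticeCharFun μ θ ^ n) := fun n => by
    rw [integral_const_mul, ← convPow_eq_integral]
    push_cast
    ring
  rw [h1, Complex.ofReal_tsum, ← tsum_mul_left]
  simp_rw [h2]
  rw [tsum_integral_cube (b := fun n : ℕ => Real.exp (-t) * (t ^ n / n.factorial))
    (fun n => by fun_prop) ((Real.summable_pow_div_factorial t).mul_left _) fun n θ => ?_]
  · refine integral_congr_ae (ae_of_all _ fun θ => ?_)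
    dsimp only
    have h3 := (NormedSpace.expSeries_div_hasSum_exp (𝔸 := ℂ)
      (t * latticeCharFun μ θ)).mul_left (Complex.exp (-(pairing θ x * Complex.I)) *
        Complex.exp (-t))
    rw [← Complex.exp_eq_exp_ℂ, mul_assoc _ _ (Complex.exp (t * latticeCharFun μ θ))] at h3
    rw [show -((t : ℂ) * (1 - latticeCharFun μ θ)) = -t + t * latticeCharFun μ θ by ring,
      Complex.exp_add, ← h3.tsum_eq]
    refine tsum_congr fun n => ?_
    push_cast
    rw [mul_pow]
    ring
  · rw [norm_mul, norm_mul, norm_exp_neg_pairing, norm_pow, one_mul, Complex.norm_real,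
      Real.norm_eq_abs, abs_of_nonneg (by positivity)]
    exact mul_le_of_le_one_right (by positivity)
      (pow_le_one₀ (norm_nonneg _) (norm_latticeCharFun_le μ θ))

/-! ### The quadratic form of the jump law -/

/-- The quadratic form `θ · Γ θ` of the covariance matrix. -/
def covForm (μ : PMF (Site d)) (θ : Fin d → ℝ) : ℝ := θ ⬝ᵥ (covMatrix μ).mulVec θ

lemma IsJumpLaw.summable_mul {μ : PMF (Site d)} (hμ : IsJumpLaw μ) (i j : Fin d) :
    Summable fun x => (μ x).toReal * ((x i : ℝ) * (x j : ℝ)) := by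
  refine Summable.of_norm_bounded ((hμ.second_moment i).add (hμ.second_moment j)) fun x => ?_
  rw [norm_mul, Real.norm_eq_abs, Real.norm_eq_abs, abs_of_nonneg ENNReal.toReal_nonneg, ← mul_add]
  gcongr
  rw [abs_mul]
  nlinarith [sq_nonneg (|(x i : ℝ)| - |(x j : ℝ)|), sq_abs (x i : ℝ), sq_abs (x j : ℝ),
    sq_nonneg (x i : ℝ), sq_nonneg (x j : ℝ)]

lemma IsJumpLaw.hasSum_covForm {μ : PMF (Site d)} (hμ : IsJumpLaw μ) (θ : Fin d → ℝ) :
    HasSum (fun x => (μ x).toReal * pairing θ x ^ 2) (covForm μ θ) := by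
  have h : HasSum (fun x => ∑ i, ∑ j, θ i * θ j * ((μ x).toReal * ((x i : ℝ) * (x j : ℝ))))
      (∑ i, ∑ j, θ i * θ j * covMatrix μ i j) :=
    hasSum_sum fun i _ => hasSum_sum fun j _ => (hμ.summable_mul i j).hasSum.mul_left _
  have h2 : covForm μ θ = ∑ i, ∑ j, θ i * θ j * covMatrix μ i j := by
    simp only [covForm, dotProduct, Matrix.mulVec, Finset.mul_sum]
    exact Finset.sum_congr rfl fun i _ => Finset.sum_congr rfl fun j _ => by ring
  rw [h2]
  convert! h using 2 with x
  · rw [pairing, sq, Finset.sum_mul_sum, Finset.mul_sum]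
    refine Finset.sum_congr rfl fun i _ => ?_
    rw [Finset.mul_sum]
    exact Finset.sum_congr rfl fun j _ => by ring

lemma IsJumpLaw.summable_euclNorm {μ : PMF (Site d)} (hμ : IsJumpLaw μ) :
    Summable fun x => (μ x).toReal * euclNorm x ^ 2 := by
  simp_rw [euclNorm_sq, Finset.mul_sum]
  exact summable_sum fun i _ => hμ.second_moment i

@[fun_prop]
lemma continuous_covForm (μ : PMF (Site d)) : Continuous (covForm μ) := by
  unfold covForm dotProduct Matrix.mulVec dotProduct; fun_prop

lemma covForm_smul (μ : PMF (Site d)) (s : ℝ) (θ : Fin d → ℝ) :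
    covForm μ (s • θ) = s ^ 2 * covForm μ θ := by
  simp [covForm, Matrix.mulVec_smul, sq, mul_assoc]

lemma isCompact_normSq_eq_one : IsCompact {θ : Fin d → ℝ | normSq θ = 1} := by
  refine (isCompact_univ_pi fun _ : Fin d => isCompact_Icc (a := (-1 : ℝ)) (b := 1)).of_isClosed_subset
    (isClosed_eq continuous_normSq continuous_const) fun θ hθ i _ => ?_
  have h : θ i ^ 2 ≤ 1 := by
    rw [← (show normSq θ = 1 from hθ)]
    exact Finset.single_le_sum (f := fun i => θ i ^ 2) (fun _ _ => sq_nonneg _) (Finset.mem_univ i)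
  exact abs_le.1 ((sq_le_one_iff_abs_le_one _).1 h)

/-- A positive definite form dominates a multiple of the Euclidean one. -/
lemma exists_dotProduct_mulVec_ge {A : Matrix (Fin d) (Fin d) ℝ} (hA : A.PosDef) :
    ∃ c : ℝ, 0 < c ∧ ∀ θ, c * normSq θ ≤ θ ⬝ᵥ A.mulVec θ := by
  have hunit : ∀ θ : Fin d → ℝ, normSq θ ≠ 0 →
      (Real.sqrt (normSq θ))⁻¹ • θ ∈ {θ : Fin d → ℝ | normSq θ = 1} := fun θ h0 => by
    change normSq _ = 1
    rw [normSq_smul, inv_pow, Real.sq_sqrt (normSq_nonneg θ), inv_mul_cancel₀ h0]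
  have hzero : ∀ θ : Fin d → ℝ, normSq θ = 0 → θ ⬝ᵥ A.mulVec θ = 0 := fun θ h0 => by
    rw [normSq_eq_zero] at h0
    simp [h0]
  rcases ({θ : Fin d → ℝ | normSq θ = 1}).eq_empty_or_nonempty with he | hne
  · refine ⟨1, one_pos, fun θ => ?_⟩
    by_cases h0 : normSq θ = 0
    · rw [hzero θ h0, h0, mul_zero]
    · have := hunit θ h0
      simp [he] at this
  · have hcont : Continuous fun θ : Fin d → ℝ => θ ⬝ᵥ A.mulVec θ := by
      unfold dotProduct Matrix.mulVec dotProduct; fun_prop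
    obtain ⟨θ₀, h1, h2⟩ := isCompact_normSq_eq_one.exists_isMinOn hne hcont.continuousOn
    have h10 : θ₀ ≠ 0 := by
      rintro rfl
      simp [normSq] at h1
    refine ⟨θ₀ ⬝ᵥ A.mulVec θ₀, by simpa using hA.dotProduct_mulVec_pos h10, fun θ => ?_⟩
    by_cases h0 : normSq θ = 0
    · rw [hzero θ h0, h0, mul_zero]
    · have h4 : θ₀ ⬝ᵥ A.mulVec θ₀ ≤ _ := h2 (hunit θ h0)
      simp only [Matrix.mulVec_smul, smul_dotProduct, dotProduct_smul, smul_eq_mul] at h4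
      rw [← mul_assoc, ← sq, inv_pow, Real.sq_sqrt (normSq_nonneg θ), inv_mul_eq_div,
        le_div_iff₀ (lt_of_le_of_ne (normSq_nonneg θ) (Ne.symm h0))] at h4
      exact h4

lemma IsJumpLaw.exists_covForm_ge {μ : PMF (Site d)} (hμ : IsJumpLaw μ) :
    ∃ c : ℝ, 0 < c ∧ ∀ θ, c * normSq θ ≤ covForm μ θ :=
  exists_dotProduct_mulVec_ge hμ.cov_posDef

/-- The characteristic function takes the value one on the fundamental domain only at the origin,
as the jump law is not carried by a strict subgroup. -/
lemma IsJumpLaw.one_sub_re_pos {μ : PMF (Site d)} (hμ : IsJumpLaw μ) {θ : Fin d → ℝ}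
    (hθ : θ ∈ cube d) (h0 : θ ≠ 0) : 0 < 1 - (latticeCharFun μ θ).re := by
  have hs := hasSum_one_sub_re μ θ
  have hnn : ∀ x, 0 ≤ (μ x).toReal * (1 - Real.cos (pairing θ x)) := fun x =>
    mul_nonneg ENNReal.toReal_nonneg (sub_nonneg.2 (Real.cos_le_one _))
  refine lt_of_le_of_ne (hs.nonneg hnn) fun h => h0 ?_
  rw [← h, hasSum_zero_iff_of_nonneg hnn] at hs
  -- if `Re φ θ = 1`, every jump lies in the subgroup `H` of the points whose angle is a multiple of
  -- `2π`
  let H : AddSubgroup (Site d) :=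
    { carrier := {x | ∃ k : ℤ, (k : ℝ) * (2 * Real.pi) = pairing θ x}
      add_mem' := by
        rintro x y ⟨k, hk⟩ ⟨l, hl⟩
        exact ⟨k + l, by rw [pairing_add, ← hk, ← hl]; push_cast; ring⟩
      zero_mem' := ⟨0, by simp [pairing]⟩
      neg_mem' := by
        rintro x ⟨k, hk⟩
        exact ⟨-k, by rw [← zero_sub x, pairing_sub, ← hk]; simp [pairing]⟩ }
  have hH : H = ⊤ := hμ.not_strict_subgroup H fun x hx => by
    have h1 := congrFun hs x
    simp only [Pi.zero_apply, mul_eq_zero, ENNReal.toReal_eq_zero_iff, μ.apply_ne_top, or_false] at h1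
    rcases h1 with h1 | h1
    · exact absurd h1 ((μ.mem_support_iff x).1 hx)
    · exact (Real.cos_eq_one_iff _).1 (sub_eq_zero.1 h1).symm
  funext i
  obtain ⟨k, hk⟩ : Pi.single i (1 : ℤ) ∈ H := hH ▸ AddSubgroup.mem_top _
  have h2 : pairing θ (Pi.single i (1 : ℤ)) = θ i := by
    rw [pairing, Finset.sum_eq_single i]
    · simp
    · intro j _ hj
      simp [Pi.single_eq_of_ne hj]
    · simp
  rw [h2] at hk
  have h3 := hθ i (Set.mem_univ i)
  rw [← hk, Set.mem_Icc] at h3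
  -- `θ i = 2πk` is at most `π` in absolute value
  have h4 : |(k : ℝ)| < 1 := by
    rw [abs_lt]
    constructor <;> nlinarith [Real.pi_pos]
  have h5 : k = 0 := by
    rw [← Int.cast_abs] at h4
    exact Int.abs_lt_one_iff.1 (by exact_mod_cast h4)
  rw [← hk, h5]
  simp

/-- Quadratic lower bound for `1 - Re φ` on the fundamental domain. -/
lemma IsJumpLaw.exists_one_sub_re_ge {μ : PMF (Site d)} (hμ : IsJumpLaw μ) :
    ∃ c : ℝ, 0 < c ∧ ∀ θ ∈ cube d, c * normSq θ ≤ 1 - (latticeCharFun μ θ).re := by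
  obtain ⟨c, hc, hcov⟩ := hμ.exists_covForm_ge
  -- a finite set of jumps carries enough of the covariance form
  obtain ⟨S, hS⟩ : ∃ S : Finset (Site d), ∀ θ, c / 2 * normSq θ ≤
      ∑ x ∈ S, (μ x).toReal * pairing θ x ^ 2 := by
    have hsum := hμ.summable_euclNorm.hasSum
    obtain ⟨S, hS⟩ := (hsum.eventually (lt_mem_nhds (sub_lt_self _ (half_pos hc)))).exists
    refine ⟨S, fun θ => ?_⟩
    have h1 := hμ.hasSum_covForm θ
    have h2 := (h1.summable.sum_add_tsum_compl (s := S)).symm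
    rw [h1.tsum_eq] at h2
    have h3 := (hμ.summable_euclNorm.sum_add_tsum_compl (s := S)).symm
    have h4 : ∑' x : ↑((S : Set (Site d))ᶜ), (μ x).toReal * pairing θ x ^ 2 ≤
        normSq θ * ∑' x : ↑((S : Set (Site d))ᶜ), (μ x).toReal * euclNorm (x : Site d) ^ 2 := by
      rw [← tsum_mul_left]
      refine Summable.tsum_le_tsum (fun x => ?_) (h1.summable.subtype _)
        ((hμ.summable_euclNorm.subtype _).mul_left _)
      rw [mul_left_comm]
      exact mul_le_mul_of_nonneg_left (pairing_sq_le θ x) ENNReal.toReal_nonneg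
    have h5 := mul_le_mul_of_nonneg_left (show
      ∑' x : ↑((S : Set (Site d))ᶜ), (μ x).toReal * euclNorm (x : Site d) ^ 2 ≤ c / 2 by linarith)
      (normSq_nonneg θ)
    linarith [hcov θ]
  -- frequencies at which these jumps give angles at most `π`
  obtain ⟨δ, hδ, hδS⟩ : ∃ δ : ℝ, 0 < δ ∧ ∀ θ : Fin d → ℝ, normSq θ < δ →
      ∀ x ∈ S, |pairing θ x| ≤ Real.pi := by
    refine ⟨Real.pi ^ 2 / (1 + ∑ x ∈ S, euclNorm x ^ 2), by positivity, fun θ hθ x hx => ?_⟩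
    rw [lt_div_iff₀ (by positivity)] at hθ
    refine abs_le_of_sq_le_sq ?_ Real.pi_pos.le
    refine (pairing_sq_le θ x).trans (le_trans ?_ hθ.le)
    have := Finset.single_le_sum (f := fun x => euclNorm x ^ 2) (fun _ _ => sq_nonneg _) hx
    exact mul_le_mul_of_nonneg_left (by linarith) (normSq_nonneg θ)
  -- near the origin: `1 - cos u ≥ 2 u² / π²` for `|u| ≤ π`
  have hnear : ∀ θ : Fin d → ℝ, normSq θ < δ →
      2 / Real.pi ^ 2 * (c / 2) * normSq θ ≤ 1 - (latticeCharFun μ θ).re := fun θ hθ => by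
    refine le_trans ?_ (sum_le_hasSum S (fun x _ => mul_nonneg ENNReal.toReal_nonneg
      (sub_nonneg.2 (Real.cos_le_one _))) (hasSum_one_sub_re μ θ))
    rw [mul_assoc]
    refine (mul_le_mul_of_nonneg_left (hS θ) (by positivity)).trans ?_
    rw [Finset.mul_sum]
    refine Finset.sum_le_sum fun x hx => ?_
    rw [mul_left_comm]
    exact mul_le_mul_of_nonneg_left (by linarith [Real.cos_le_one_sub_mul_cos_sq (hδS θ hθ x hx)])
      ENNReal.toReal_nonneg
  -- away from the origin: a continuous positive function on a compact set
  have hcomp : IsCompact (cube d ∩ {θ | δ ≤ normSq θ}) :=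
    isCompact_cube.inter_right (isClosed_le continuous_const continuous_normSq)
  have hdN : ∀ θ ∈ cube d, normSq θ ≤ d * Real.pi ^ 2 := fun θ hθ => by
    refine (Finset.sum_le_card_nsmul _ _ (Real.pi ^ 2) fun i _ => ?_).trans (by simp)
    have := hθ i (Set.mem_univ i)
    exact sq_le_sq' this.1 this.2
  obtain ⟨m, hm, hfar⟩ : ∃ m : ℝ, 0 < m ∧ ∀ θ ∈ cube d ∩ {θ | δ ≤ normSq θ},
      m ≤ 1 - (latticeCharFun μ θ).re := by
    rcases (cube d ∩ {θ | δ ≤ normSq θ}).eq_empty_or_nonempty with he | hne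
    · exact ⟨1, one_pos, by simp [he]⟩
    · have hcont : Continuous fun θ => 1 - (latticeCharFun μ θ).re := by fun_prop
      obtain ⟨θ₀, h1, h2⟩ := hcomp.exists_isMinOn hne hcont.continuousOn
      refine ⟨_, hμ.one_sub_re_pos h1.1 ?_, fun θ hθ => h2 hθ⟩
      rintro rfl
      have := h1.2
      simp [normSq] at this
      linarith
  refine ⟨min (2 / Real.pi ^ 2 * (c / 2)) (m / (d * Real.pi ^ 2 + 1)), by positivity,
    fun θ hθ => ?_⟩
  rcases lt_or_ge (normSq θ) δ with h | h
  · exact (mul_le_mul_of_nonneg_right (min_le_left _ _) (normSq_nonneg θ)).trans (hnear θ h)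
  · refine (mul_le_mul_of_nonneg_right (min_le_right _ _) (normSq_nonneg θ)).trans
      (le_trans ?_ (hfar θ ⟨hθ, h⟩))
    rw [div_mul_eq_mul_div, div_le_iff₀ (by positivity)]
    exact mul_le_mul_of_nonneg_left (by linarith [hdN θ hθ]) hm.le

/-! ### Gaussian integrals and the local central limit theorem -/

/-- The quadratic form `x · Γ⁻¹ x`. -/
def invCovForm (μ : PMF (Site d)) (x : Site d) : ℝ :=
  (fun i => (x i : ℝ)) ⬝ᵥ ((covMatrix μ)⁻¹.mulVec fun i => (x i : ℝ))

/-- The centred Gaussian density with covariance matrix `t Γ`. -/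
def gaussHeat (μ : PMF (Site d)) (t : ℝ) (x : Site d) : ℝ :=
  (2 * Real.pi * t) ^ (-(d / 2 : ℝ)) * (Real.sqrt (covMatrix μ).det)⁻¹ *
    Real.exp (-(invCovForm μ x / 2) / t)

lemma integrable_exp_normSq {c : ℝ} (hc : 0 < c) :
    Integrable fun θ : Fin d → ℝ => Real.exp (-c * normSq θ) := by
  have h : ∀ θ : Fin d → ℝ, Real.exp (-c * normSq θ) = ∏ i, Real.exp (-c * θ i ^ 2) := fun θ => by
    rw [← Real.exp_sum, normSq, Finset.mul_sum]
  simp_rw [h]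
  exact Integrable.fintype_prod fun _ => integrable_exp_neg_mul_sq hc

lemma integral_exp_normSq {c : ℝ} (hc : 0 < c) :
    ∫ θ : Fin d → ℝ, Real.exp (-c * normSq θ) = (Real.pi / c) ^ (d / 2 : ℝ) := by
  have h : ∀ θ : Fin d → ℝ, Real.exp (-c * normSq θ) = ∏ i, Real.exp (-c * θ i ^ 2) := fun θ => by
    rw [← Real.exp_sum, normSq, Finset.mul_sum]
  simp_rw [h]
  rw [integral_fintype_prod_volume_eq_pow fun s : ℝ => Real.exp (-c * s ^ 2), integral_gaussian,
    Fintype.card_fin, Real.sqrt_eq_rpow, ← Real.rpow_natCast, ← Real.rpow_mul (by positivity)]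
  congr 1
  ring

lemma norm_exp_neg_mul (μ : PMF (Site d)) (t : ℝ) (θ : Fin d → ℝ) :
    ‖Complex.exp (-(t * (1 - latticeCharFun μ θ)))‖ =
      Real.exp (-(t * (1 - (latticeCharFun μ θ).re))) := by
  rw [Complex.norm_exp]
  simp

/-- The continuous-time walk has transition probabilities of order at most `t^{-d/2}`. -/
lemma IsJumpLaw.exists_heat_le {μ : PMF (Site d)} (hμ : IsJumpLaw μ) :
    ∃ C : ℝ, 0 < C ∧ ∀ t : ℝ, 0 < t → ∀ x, (heat μ t x).toReal ≤ C * t ^ (-(d / 2 : ℝ)) := by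
  obtain ⟨c, hc, hφ⟩ := hμ.exists_one_sub_re_ge
  have hpi := Real.pi_pos
  refine ⟨((2 * Real.pi) ^ d)⁻¹ * (Real.pi / c) ^ (d / 2 : ℝ), by positivity, fun t ht x => ?_⟩
  have h1 : (2 * Real.pi) ^ d * (heat μ t x).toReal ≤ (Real.pi / (t * c)) ^ (d / 2 : ℝ) := by
    rw [← integral_exp_normSq (by positivity)]
    calc (2 * Real.pi) ^ d * (heat μ t x).toReal
        = ‖((2 * Real.pi) ^ d * (heat μ t x).toReal : ℂ)‖ := by
          rw [norm_mul, norm_pow, norm_mul, Complex.norm_real, Complex.norm_real, Complex.norm_two,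
            Real.norm_of_nonneg hpi.le, Real.norm_of_nonneg ENNReal.toReal_nonneg]
      _ ≤ ∫ θ in cube d, Real.exp (-(t * c) * normSq θ) := by
          rw [heat_eq_integral μ ht.le]
          refine norm_integral_le_of_norm_le (integrable_exp_normSq (by positivity)).integrableOn ?_
          filter_upwards [ae_restrict_mem measurableSet_cube] with θ hθ
          rw [norm_mul, norm_exp_neg_pairing, one_mul, norm_exp_neg_mul]
          refine Real.exp_le_exp.2 ?_
          rw [neg_mul, mul_assoc]
          exact neg_le_neg (mul_le_mul_of_nonneg_left (hφ θ hθ) ht.le)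
      _ ≤ _ := setIntegral_le_integral (integrable_exp_normSq (by positivity))
          (ae_of_all _ fun θ => (Real.exp_pos _).le)
  rw [mul_assoc, inv_mul_eq_div, le_div_iff₀ (by positivity), mul_comm]
  refine h1.trans_eq ?_
  rw [Real.rpow_neg ht.le, ← div_eq_mul_inv, ← Real.div_rpow (by positivity) ht.le, div_div,
    mul_comm t c]

open scoped MatrixOrder Matrix.Norms.L2Operator in
/-- A square root of the covariance matrix. -/
lemma IsJumpLaw.exists_sqrt {μ : PMF (Site d)} (hμ : IsJumpLaw μ) :
    ∃ B : Matrix (Fin d) (Fin d) ℝ, covMatrix μ = B.transpose * B ∧ IsUnit B.det := by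
  obtain ⟨B, hB⟩ := CStarAlgebra.nonneg_iff_eq_star_mul_self.mp hμ.cov_posDef.posSemidef.nonneg
  rw [Matrix.star_eq_conjTranspose, Matrix.conjTranspose_eq_transpose_of_trivial] at hB
  refine ⟨B, hB, ?_⟩
  have := hμ.cov_posDef.det_pos.ne'
  rw [hB, Matrix.det_mul] at this
  exact (right_ne_zero_of_mul this).isUnit

lemma invCovForm_eq_normSq {μ : PMF (Site d)} {B : Matrix (Fin d) (Fin d) ℝ}
    (hB : covMatrix μ = B.transpose * B) (x : Site d) :
    invCovForm μ x = normSq ((B⁻¹.transpose).mulVec fun i => (x i : ℝ)) := by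
  rw [invCovForm, hB, Matrix.mul_inv_rev, ← Matrix.transpose_nonsing_inv, ← Matrix.mulVec_mulVec,
    Matrix.dotProduct_mulVec, ← Matrix.mulVec_transpose]
  simp [normSq, dotProduct, sq]

lemma covForm_eq_normSq {μ : PMF (Site d)} {B : Matrix (Fin d) (Fin d) ℝ}
    (hB : covMatrix μ = B.transpose * B) (θ : Fin d → ℝ) :
    covForm μ θ = normSq (B.mulVec θ) := by
  rw [covForm, hB, ← Matrix.mulVec_mulVec, Matrix.dotProduct_mulVec, ← Matrix.mulVec_transpose,
    Matrix.transpose_transpose]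
  simp [normSq, dotProduct, sq]

/-- Fourier inversion for the Gaussian density, by the linear change of variables `η = B θ` with `Γ
= Bᵀ B`. -/
lemma IsJumpLaw.gaussHeat_eq_integral {μ : PMF (Site d)} (hμ : IsJumpLaw μ) {t : ℝ} (ht : 0 < t)
    (x : Site d) :
    ((2 * Real.pi) ^ d * gaussHeat μ t x : ℂ) =
      ∫ θ, Complex.exp (-(pairing θ x * Complex.I)) * Complex.exp (-(t / 2 * covForm μ θ)) := by
  obtain ⟨B, hB, hdet⟩ := hμ.exists_sqrt
  have hpi := Real.pi_pos
  set w : Fin d → ℝ := (B⁻¹.transpose).mulVec fun i => (x i : ℝ) with hw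
  have hbw (θ : Fin d → ℝ) : pairing θ x = w ⬝ᵥ B.mulVec θ := by
    rw [Matrix.dotProduct_mulVec, ← Matrix.mulVec_transpose, hw, Matrix.mulVec_mulVec,
      ← Matrix.transpose_mul, Matrix.nonsing_inv_mul B hdet, Matrix.transpose_one,
      Matrix.one_mulVec]
    simp [pairing, dotProduct, mul_comm]
  let F : (Fin d → ℝ) → ℂ := fun η => Complex.exp (-((t / 2 : ℝ) : ℂ) * ∑ i, (η i : ℂ) ^ 2 +
    ∑ i, (-Complex.I * w i) * η i)
  have h1 : ∀ θ : Fin d → ℝ, Complex.exp (-(pairing θ x * Complex.I)) *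
      Complex.exp (-(t / 2 * covForm μ θ)) = F (Matrix.toLin' B θ) := fun θ => by
    rw [← Complex.exp_add, hbw, covForm_eq_normSq hB, Matrix.toLin'_apply]
    simp only [F, normSq, dotProduct]
    congr 1
    push_cast
    rw [add_comm, Finset.sum_mul, ← Finset.sum_neg_distrib]
    congr 1
    · ring
    · exact Finset.sum_congr rfl fun i _ => by ring
  have hmeas : Continuous F := by fun_prop
  simp_rw [h1]
  rw [← integral_map (φ := Matrix.toLin' B) (LinearMap.continuous_of_finiteDimensional _).aemeasurable
    hmeas.aestronglyMeasurable, Real.map_matrix_volume_pi_eq_smul_volume_pi hdet.ne_zero,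
    integral_smul_measure, GaussianFourier.integral_cexp_neg_mul_sum_add (by simpa using ht)]
  have hsum : ∑ i, (-Complex.I * (w i : ℂ)) ^ 2 = -(normSq w : ℂ) := by
    simp [normSq, mul_pow]
  have hdetB : |(B.det)⁻¹| = (Real.sqrt (covMatrix μ).det)⁻¹ := by
    rw [hB, Matrix.det_mul, Matrix.det_transpose, Real.sqrt_mul_self_eq_abs, abs_inv]
  rw [hsum, hdetB, ENNReal.toReal_ofReal (by positivity), Fintype.card_fin, gaussHeat,
    invCovForm_eq_normSq hB, ← hw]
  have e1 : ((Real.pi / ((t / 2 : ℝ) : ℂ)) ^ (d / 2 : ℂ) : ℂ) =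
      (((Real.pi / (t / 2)) ^ (d / 2 : ℝ) : ℝ) : ℂ) := by
    rw [Complex.ofReal_cpow (by positivity)]
    push_cast
    rfl
  have e2 : Complex.exp (-(normSq w : ℂ) / (4 * ((t / 2 : ℝ) : ℂ))) =
      ((Real.exp (-(normSq w / 2) / t) : ℝ) : ℂ) := by
    push_cast
    congr 1
    field_simp
    ring
  have e3 : (2 * Real.pi) ^ d * (2 * Real.pi * t) ^ (-(d / 2 : ℝ)) =
      (Real.pi / (t / 2)) ^ (d / 2 : ℝ) := by
    rw [Real.rpow_neg (by positivity), ← Real.rpow_natCast, ← div_eq_mul_inv,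
      show (2 * Real.pi) ^ (d : ℝ) = ((2 * Real.pi) ^ (2 : ℝ)) ^ (d / 2 : ℝ) by
        rw [← Real.rpow_mul (by positivity)]; congr 1; ring,
      ← Real.div_rpow (by positivity) (by positivity)]
    congr 1
    rw [Real.rpow_ofNat]
    field_simp
  rw [e1, e2, ← e3, Complex.real_smul]
  push_cast
  ring

/-- The time integral of the Gaussian density, by the substitution `t ↦ 1 / t`. -/
lemma integral_gaussTime {q : ℝ} (hq : 0 < q) {a : ℝ} (ha : 1 < a) :
    ∫ t in Set.Ioi (0 : ℝ), t ^ (-a) * Real.exp (-q / t) =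
      (1 / q) ^ (a - 1) * Real.Gamma (a - 1) := by
  rw [← Real.integral_rpow_mul_exp_neg_mul_Ioi (by linarith) hq,
    ← integral_comp_rpow_Ioi (fun t => t ^ (a - 1 - 1) * Real.exp (-(q * t)))
      (show (-1 : ℝ) ≠ 0 by norm_num)]
  refine setIntegral_congr_fun measurableSet_Ioi fun t ht => ?_
  have ht : 0 < t := ht
  simp only [abs_neg, abs_one, one_mul, smul_eq_mul]
  rw [← mul_assoc, ← Real.rpow_mul ht.le, ← Real.rpow_add ht, Real.rpow_neg_one]
  congr 2
  · ring
  · rw [div_eq_mul_inv, neg_mul]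

lemma IsJumpLaw.invCovForm_pos {μ : PMF (Site d)} (hμ : IsJumpLaw μ) {x : Site d} (hx : x ≠ 0) :
    0 < invCovForm μ x := by
  have := hμ.cov_posDef.inv.dotProduct_mulVec_pos (x := fun i => (x i : ℝ)) fun h => hx ?_
  · simpa [invCovForm] using this
  · funext i
    exact Int.cast_eq_zero.1 (congrFun h i)

/-- The Gaussian Green function, with the constant `c_d`. -/
lemma IsJumpLaw.integral_gaussHeat (hd : 3 ≤ d) {μ : PMF (Site d)} (hμ : IsJumpLaw μ)
    {x : Site d} (hx : x ≠ 0) :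
    jnorm μ x ^ (d - 2) * ∫ t in Set.Ioi (0 : ℝ), gaussHeat μ t x = greenConst μ := by
  have hq := hμ.invCovForm_pos hx
  have hpi := Real.pi_pos
  have hdet := hμ.cov_posDef.det_pos
  have hd' : (3 : ℝ) ≤ d := by exact_mod_cast hd
  have h1 : ∀ t ∈ Set.Ioi (0 : ℝ), gaussHeat μ t x = ((2 * Real.pi) ^ (-(d / 2 : ℝ)) *
      (Real.sqrt (covMatrix μ).det)⁻¹) * (t ^ (-(d / 2 : ℝ)) *
        Real.exp (-(invCovForm μ x / 2) / t)) := fun t ht => by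
    rw [gaussHeat, Real.mul_rpow (by positivity) (le_of_lt ht)]
    ring
  rw [setIntegral_congr_fun measurableSet_Ioi h1, integral_const_mul,
    integral_gaussTime (by positivity) (by linarith)]
  have h2 : jnorm μ x ^ (d - 2) = (invCovForm μ x / d) ^ (d / 2 - 1 : ℝ) := by
    change Real.sqrt (invCovForm μ x / d) ^ (d - 2) = _
    rw [Real.sqrt_eq_rpow, ← Real.rpow_natCast, ← Real.rpow_mul (by positivity),
      Nat.cast_sub (by omega)]
    congr 1
    push_cast
    ring
  -- the value at `d / 2 - 1` produced by the time integral is turned into the value at `d / 2` of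
  -- `c_d`
  have h3 : Real.Gamma (d / 2) = (d / 2 - 1) * Real.Gamma (d / 2 - 1 : ℝ) := by
    rw [← Real.Gamma_add_one (by linarith)]
    congr 1
    ring
  have h4 : (invCovForm μ x / d) ^ (d / 2 - 1 : ℝ) * (1 / (invCovForm μ x / 2)) ^ (d / 2 - 1 : ℝ) =
      2 ^ (d / 2 - 1 : ℝ) / d ^ (d / 2 - 1 : ℝ) := by
    rw [← Real.mul_rpow (by positivity) (by positivity), ← Real.div_rpow (by positivity)
      (by positivity)]
    congr 1
    field_simp
  have h5 : (2 * Real.pi) ^ (-(d / 2 : ℝ)) = (2 ^ (d / 2 - 1 : ℝ) * 2 * Real.pi ^ (d / 2 : ℝ))⁻¹ := by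
    rw [Real.rpow_neg (by positivity), Real.mul_rpow (by positivity) (by positivity),
      Real.rpow_sub_one (by norm_num)]
    congr 1
    ring
  have h6 : (0 : ℝ) < d / 2 - 1 := by linarith
  calc _ = (2 * Real.pi) ^ (-(d / 2 : ℝ)) * (Real.sqrt (covMatrix μ).det)⁻¹ *
        ((invCovForm μ x / d) ^ (d / 2 - 1 : ℝ) * (1 / (invCovForm μ x / 2)) ^ (d / 2 - 1 : ℝ)) *
        Real.Gamma (d / 2 - 1) := by rw [h2]; ring
    _ = _ := by
      rw [h4, h5, greenConst, h3]
      have : (d : ℝ) - 2 ≠ 0 := by linarith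
      have h7 : (0:ℝ) < 2 ^ (d / 2 - 1 : ℝ) := by positivity
      have h8 : (0:ℝ) < Real.pi ^ (d / 2 : ℝ) := by positivity
      have h9 : (0:ℝ) < d ^ (d / 2 - 1 : ℝ) := by positivity
      have h10 : (0:ℝ) < Real.sqrt (covMatrix μ).det := by positivity
      generalize (2:ℝ) ^ (d / 2 - 1 : ℝ) = A at *
      generalize Real.pi ^ (d / 2 : ℝ) = A2 at *
      generalize (d:ℝ) ^ (d / 2 - 1 : ℝ) = A3 at *
      field_simp

lemma norm_one_add_sub_exp_le (u : ℝ) :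
    ‖1 + u * Complex.I - Complex.exp (u * Complex.I)‖ ≤ 3 * u ^ 2 := by
  have hn : ‖(u : ℂ) * Complex.I‖ = |u| := by simp
  rcases le_or_gt |u| 1 with h | h
  · have := Complex.norm_exp_sub_one_sub_id_le (x := u * Complex.I) (by rwa [hn])
    rw [hn, sq_abs] at this
    rw [← norm_neg]
    calc _ = ‖Complex.exp (u * Complex.I) - 1 - u * Complex.I‖ := by congr 1; ring
      _ ≤ _ := by nlinarith [sq_nonneg u]
  · calc ‖1 + u * Complex.I - Complex.exp (u * Complex.I)‖
        ≤ ‖(1 : ℂ)‖ + ‖(u : ℂ) * Complex.I‖ + ‖Complex.exp (u * Complex.I)‖ :=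
          (norm_sub_le _ _).trans (by gcongr; exact norm_add_le _ _)
      _ = 2 + |u| := by rw [hn, Complex.norm_exp_ofReal_mul_I, norm_one]; ring
      _ ≤ 3 * u ^ 2 := by rw [← sq_abs u]; nlinarith

lemma tendsto_one_add_sub_exp (a : ℝ) :
    Tendsto (fun s : ℝ => (1 + (s * a : ℝ) * Complex.I - Complex.exp ((s * a : ℝ) * Complex.I)) /
      (s : ℂ) ^ 2) (𝓝[>] 0) (𝓝 ((a ^ 2 / 2 : ℝ) : ℂ)) := by
  rw [tendsto_iff_norm_sub_tendsto_zero]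
  have h0 : Tendsto (fun s : ℝ => s * (|a| ^ 3 * Real.exp |s * a|)) (𝓝[>] 0) (𝓝 0) := by
    have : Continuous fun s : ℝ => s * (|a| ^ 3 * Real.exp |s * a|) := by fun_prop
    simpa using (this.tendsto 0).mono_left nhdsWithin_le_nhds
  refine squeeze_zero' (Eventually.of_forall fun _ => norm_nonneg _) ?_ h0
  filter_upwards [self_mem_nhdsWithin] with s hs
  have hs : 0 < s := hs
  have hs' : (s : ℂ) ≠ 0 := by exact_mod_cast hs.ne'
  have h1 := Complex.norm_exp_sub_sum_le_norm_mul_exp ((s * a : ℝ) * Complex.I) 3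
  have hn : ‖((s * a : ℝ) : ℂ) * Complex.I‖ = |s * a| := by simp
  rw [hn] at h1
  have h2 : (1 + (s * a : ℝ) * Complex.I - Complex.exp ((s * a : ℝ) * Complex.I)) / (s : ℂ) ^ 2 -
      ((a ^ 2 / 2 : ℝ) : ℂ) = -(Complex.exp ((s * a : ℝ) * Complex.I) -
        ∑ m ∈ Finset.range 3, ((s * a : ℝ) * Complex.I) ^ m / m.factorial) / (s : ℂ) ^ 2 := by
    rw [eq_div_iff (pow_ne_zero 2 hs'), sub_mul, div_mul_cancel₀ _ (pow_ne_zero 2 hs')]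
    simp only [Finset.sum_range_succ, Finset.sum_range_zero, mul_pow, Complex.I_sq]
    push_cast
    simp only [Nat.factorial]
    push_cast
    ring
  rw [h2, norm_div, norm_neg, norm_pow, Complex.norm_real, Real.norm_of_nonneg hs.le,
    div_le_iff₀ (by positivity)]
  refine h1.trans_eq ?_
  rw [abs_mul, abs_of_pos hs]
  ring

/-- The second-order expansion of the characteristic function at the origin. -/
lemma IsJumpLaw.tendsto_one_sub_charFun {μ : PMF (Site d)} (hμ : IsJumpLaw μ) (η : Fin d → ℝ) :
    Tendsto (fun s : ℝ => (1 - latticeCharFun μ (s • η)) / (s : ℂ) ^ 2) (𝓝[>] 0)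
      (𝓝 ((covForm μ η / 2 : ℝ) : ℂ)) := by
  have hmean : HasSum (fun x => (μ x).toReal * pairing η x) 0 := by
    have := hasSum_sum fun (i : Fin d) (_ : i ∈ Finset.univ) => (hμ.mean_zero i).mul_left (η i)
    simp only [mul_zero, Finset.sum_const_zero] at this
    convert! this using 2 with x
    rw [pairing, Finset.mul_sum]
    exact Finset.sum_congr rfl fun i _ => by ring
  -- the mean is zero, so `1 - φ` is the mean of `1 + i u - e^{i u}`, where `u` is the angle of a
  -- jump; this is dominated by `3 u²`
  have key := tendsto_tsum_of_dominated_convergence (𝓕 := 𝓝[>] (0 : ℝ))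
    (f := fun s x => ((μ x).toReal : ℂ) * ((1 + (s * pairing η x : ℝ) * Complex.I -
      Complex.exp ((s * pairing η x : ℝ) * Complex.I)) / (s : ℂ) ^ 2))
    (g := fun x => ((μ x).toReal : ℂ) * ((pairing η x ^ 2 / 2 : ℝ) : ℂ))
    (bound := fun x => 3 * ((μ x).toReal * pairing η x ^ 2))
    ((hμ.hasSum_covForm η).summable.mul_left 3)
    (fun x => (tendsto_one_add_sub_exp _).const_mul _) ?_
  · have hlim : ∑' x, ((μ x).toReal : ℂ) * ((pairing η x ^ 2 / 2 : ℝ) : ℂ) =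
        ((covForm μ η / 2 : ℝ) : ℂ) := by
      rw [← ((hμ.hasSum_covForm η).div_const 2).tsum_eq, Complex.ofReal_tsum]
      exact tsum_congr fun x => by push_cast; ring
    rw [hlim] at key
    refine key.congr' ?_
    filter_upwards [self_mem_nhdsWithin] with s hs
    have h1 : HasSum (fun x => ((μ x).toReal : ℂ) * (s * pairing η x : ℝ) * Complex.I) 0 := by
      have := (Complex.hasSum_ofReal.2 (hmean.mul_left s)).mul_right Complex.I
      simp only [mul_zero, Complex.ofReal_zero, zero_mul] at this
      convert! this using 2 with x
      push_cast
      ring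
    have h2 := ((((Complex.hasSum_ofReal.2 (hasSum_toReal μ)).add h1).sub
      (summable_charFun_term μ (s • η)).hasSum).div_const ((s : ℂ) ^ 2)).tsum_eq
    rw [Complex.ofReal_one, add_zero] at h2
    change _ = (1 - latticeCharFun μ (s • η)) / (s : ℂ) ^ 2
    rw [latticeCharFun, ← h2]
    refine tsum_congr fun x => ?_
    rw [pairing_smul]
    ring
  · filter_upwards [self_mem_nhdsWithin] with s hs x
    have hs : 0 < s := hs
    rw [norm_mul, norm_div, norm_pow, Complex.norm_real, Complex.norm_real,
      Real.norm_of_nonneg hs.le, Real.norm_of_nonneg ENNReal.toReal_nonneg, mul_left_comm]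
    refine mul_le_mul_of_nonneg_left ?_ ENNReal.toReal_nonneg
    rw [div_le_iff₀ (by positivity)]
    refine (norm_one_add_sub_exp_le _).trans_eq ?_
    ring

/-- The difference of the (rescaled) Fourier transforms in the local limit theorem. -/
def fourierGap (μ : PMF (Site d)) (t : ℝ) (η : Fin d → ℝ) : ℂ :=
  (cube d).indicator (fun θ => Complex.exp (-(t * (1 - latticeCharFun μ θ))))
    ((Real.sqrt t)⁻¹ • η) - Complex.exp (-(1 / 2 * covForm μ η))

lemma IsJumpLaw.tendsto_fourierGap {μ : PMF (Site d)} (hμ : IsJumpLaw μ) (η : Fin d → ℝ) :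
    Tendsto (fun t => fourierGap μ t η) atTop (𝓝 0) := by
  have hs : Tendsto (fun t => (Real.sqrt t)⁻¹) atTop (𝓝[>] 0) :=
    tendsto_inv_atTop_nhdsGT_zero.comp Real.tendsto_sqrt_atTop
  have hs0 : Tendsto (fun t => (Real.sqrt t)⁻¹ • η) atTop (𝓝 0) := by
    simpa using (hs.mono_right nhdsWithin_le_nhds).smul_const η
  have hcube : cube d ∈ 𝓝 (0 : Fin d → ℝ) :=
    set_pi_mem_nhds Set.finite_univ fun i _ => Icc_mem_nhds (by simp [Real.pi_pos])
      (by simp [Real.pi_pos])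
  have h1 := ((hμ.tendsto_one_sub_charFun η).comp hs).neg.cexp.sub_const
    (Complex.exp (-(1 / 2 * covForm μ η)))
  have h2 : Complex.exp (-((covForm μ η / 2 : ℝ) : ℂ)) -
      Complex.exp (-(1 / 2 * covForm μ η)) = 0 := by
    rw [sub_eq_zero]
    congr 1
    push_cast
    ring
  rw [h2] at h1
  refine h1.congr' ?_
  filter_upwards [hs0.eventually hcube, eventually_gt_atTop 0] with t ht htpos
  rw [fourierGap, Set.indicator_of_mem ht]
  simp only [Function.comp_apply]
  congr 3
  rw [Complex.ofReal_inv, inv_pow, div_inv_eq_mul, mul_comm, ← Complex.ofReal_pow,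
    Real.sq_sqrt htpos.le]

lemma IsJumpLaw.tendsto_integral_fourierGap {μ : PMF (Site d)} (hμ : IsJumpLaw μ) :
    Tendsto (fun t => ∫ η, ‖fourierGap μ t η‖) atTop (𝓝 0) := by
  obtain ⟨c, hc, hφ⟩ := hμ.exists_one_sub_re_ge
  obtain ⟨c', hc', hcov⟩ := hμ.exists_covForm_ge
  have := tendsto_integral_filter_of_dominated_convergence (μ := volume) (l := atTop)
    (F := fun t η => ‖fourierGap μ t η‖) (f := fun _ => (0 : ℝ))
    (fun η : Fin d → ℝ => Real.exp (-c * normSq η) + Real.exp (-(c' / 2) * normSq η)) ?_ ?_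
    ((integrable_exp_normSq hc).add (integrable_exp_normSq (by positivity)))
    (ae_of_all _ fun η => by simpa using (hμ.tendsto_fourierGap η).norm)
  · simpa using this
  · refine Eventually.of_forall fun t => ?_
    refine (Measurable.aestronglyMeasurable ?_).norm
    have hm : Measurable ((cube d).indicator
        (fun θ => Complex.exp (-(t * (1 - latticeCharFun μ θ))))) :=
      Measurable.indicator (Continuous.measurable (by fun_prop)) measurableSet_cube
    exact (hm.comp (by fun_prop)).sub (Continuous.measurable (by fun_prop))
  · filter_upwards [eventually_gt_atTop 0] with t ht
    refine ae_of_all _ fun η => ?_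
    rw [norm_norm, fourierGap]
    refine (norm_sub_le _ _).trans (add_le_add ?_ ?_)
    -- the bound `1 - Re φ θ ≥ c |θ|²` holds on the whole cube, hence a bound independent of `t`
    · by_cases h : (Real.sqrt t)⁻¹ • η ∈ cube d
      · rw [Set.indicator_of_mem h, norm_exp_neg_mul]
        refine Real.exp_le_exp.2 ?_
        rw [neg_mul, neg_le_neg_iff]
        have := mul_le_mul_of_nonneg_left (hφ _ h) ht.le
        rw [normSq_smul, inv_pow, Real.sq_sqrt ht.le] at this
        refine le_trans (le_of_eq ?_) this
        field_simp
      · rw [Set.indicator_of_notMem h, norm_zero]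
        positivity
    · rw [Complex.norm_exp]
      refine Real.exp_le_exp.2 ?_
      have := hcov η
      norm_num
      linarith

/-- The local central limit theorem for the continuous-time walk, uniformly in space. -/
lemma IsJumpLaw.exists_heat_sub_gaussHeat_le {μ : PMF (Site d)} (hμ : IsJumpLaw μ) :
    ∃ ε : ℝ → ℝ, Tendsto ε atTop (𝓝 0) ∧ ∀ t : ℝ, 0 < t → ∀ x,
      |(heat μ t x).toReal - gaussHeat μ t x| ≤ ε t * t ^ (-(d / 2 : ℝ)) := by
  have hpi := Real.pi_pos
  refine ⟨fun t => ((2 * Real.pi) ^ d)⁻¹ * ∫ η, ‖fourierGap μ t η‖,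
    by simpa using hμ.tendsto_integral_fourierGap.const_mul ((2 * Real.pi) ^ d)⁻¹,
    fun t ht x => ?_⟩
  obtain ⟨c', hc', hcov⟩ := hμ.exists_covForm_ge
  let F1 : (Fin d → ℝ) → ℂ := (cube d).indicator fun θ => Complex.exp (-(pairing θ x * Complex.I)) *
    Complex.exp (-(t * (1 - latticeCharFun μ θ)))
  let F2 : (Fin d → ℝ) → ℂ := fun θ => Complex.exp (-(pairing θ x * Complex.I)) *
    Complex.exp (-(t / 2 * covForm μ θ))
  have hF1 : Integrable F1 := by
    refine (integrable_indicator_iff measurableSet_cube).2 ?_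
    exact (Continuous.continuousOn (by fun_prop)).integrableOn_compact isCompact_cube
  have hF2 : Integrable F2 := by
    refine (integrable_exp_normSq (c := t / 2 * c') (by positivity)).mono'
      (Continuous.aestronglyMeasurable (by fun_prop)) (ae_of_all _ fun θ => ?_)
    rw [norm_mul, norm_exp_neg_pairing, one_mul, Complex.norm_exp]
    refine Real.exp_le_exp.2 ?_
    have := mul_le_mul_of_nonneg_left (hcov θ) (half_pos ht).le
    have h3 : (-((t : ℂ) / 2 * covForm μ θ)).re = -(t / 2 * covForm μ θ) := by
      rw [← Complex.ofReal_ofNat, ← Complex.ofReal_div, ← Complex.ofReal_mul, ← Complex.ofReal_neg,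
        Complex.ofReal_re]
    rw [h3]
    linarith
  have h1 : ((2 * Real.pi) ^ d * ((heat μ t x).toReal - gaussHeat μ t x : ℝ) : ℂ) =
      ∫ θ, (F1 θ - F2 θ) := by
    rw [integral_sub hF1 hF2, integral_indicator measurableSet_cube, ← heat_eq_integral μ ht.le,
      ← hμ.gaussHeat_eq_integral ht]
    push_cast
    ring
  have h2 : ∀ η, ‖F1 ((Real.sqrt t)⁻¹ • η) - F2 ((Real.sqrt t)⁻¹ • η)‖ = ‖fourierGap μ t η‖ := by
    intro η
    rw [fourierGap, ← one_mul ‖_ - Complex.exp _‖,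
      ← norm_exp_neg_pairing ((Real.sqrt t)⁻¹ • η) x, ← norm_mul, mul_sub]
    have hst : (t / 2 * covForm μ ((Real.sqrt t)⁻¹ • η) : ℂ) = 1 / 2 * covForm μ η := by
      rw [covForm_smul, inv_pow, Real.sq_sqrt ht.le]
      push_cast
      have : (t : ℂ) ≠ 0 := by exact_mod_cast ht.ne'
      field_simp
    simp only [F1, F2]
    rw [hst]
    congr 2
    by_cases h : (Real.sqrt t)⁻¹ • η ∈ cube d
    · rw [Set.indicator_of_mem h, Set.indicator_of_mem h]
    · rw [Set.indicator_of_notMem h, Set.indicator_of_notMem h, mul_zero]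
  -- the substitution `θ = η / √t` produces the factor `t^{-d/2}`
  have h3 : ∫ η, ‖fourierGap μ t η‖ = t ^ (d / 2 : ℝ) * ∫ θ, ‖F1 θ - F2 θ‖ := by
    simp_rw [← h2]
    rw [Measure.integral_comp_smul volume (fun θ => ‖F1 θ - F2 θ‖), smul_eq_mul]
    congr 1
    rw [Module.finrank_fin_fun, inv_pow, inv_inv, abs_of_nonneg (by positivity), Real.sqrt_eq_rpow,
      ← Real.rpow_natCast, ← Real.rpow_mul ht.le]
    congr 1
    ring
  have h4 : (2 * Real.pi) ^ d * |(heat μ t x).toReal - gaussHeat μ t x| ≤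
      ∫ θ, ‖F1 θ - F2 θ‖ := by
    refine le_trans (le_of_eq ?_) (norm_integral_le_integral_norm _)
    rw [← h1, norm_mul, norm_pow, norm_mul, Complex.norm_real, Complex.norm_real, Complex.norm_two,
      Real.norm_of_nonneg hpi.le, Real.norm_eq_abs]
  dsimp only
  rw [h3, Real.rpow_neg ht.le]
  have htp : 0 < t ^ (d / 2 : ℝ) := by positivity
  calc _ ≤ ((2 * Real.pi) ^ d)⁻¹ * ∫ θ, ‖F1 θ - F2 θ‖ := by
        rw [inv_mul_eq_div, le_div_iff₀ (by positivity), mul_comm]; exact h4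
    _ = _ := by field_simp

/-! ### Asymptotics of the Green function -/

/-- The Green function is square summable in dimension at least five. -/
lemma IsJumpLaw.tsum_green_sq_lt_top (hd : 5 ≤ d) {μ : PMF (Site d)} (hμ : IsJumpLaw μ) :
    ∑' z, green μ z ^ 2 < ∞ := by
  obtain ⟨C, hC, hheat⟩ := hμ.exists_heat_le
  have hd' : (5 : ℝ) ≤ d := by exact_mod_cast hd
  -- `N t ^ 2` bounds the transition probabilities at time `t`; `N t` is of order `t^{-d/4}`, which
  -- is integrable at infinity exactly when `d ≥ 5`
  set N : ℝ → ℝ := fun t => Real.sqrt (min 1 (C * t ^ (-(d / 2 : ℝ)))) with hN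
  have hNm : Measurable N := by fun_prop
  have hbound : ∀ t, 0 < t → ∀ z, heat μ t z ≤ ENNReal.ofReal (N t) ^ 2 := fun t ht z => by
    rw [← ENNReal.ofReal_pow (Real.sqrt_nonneg _), Real.sq_sqrt (by positivity),
      ← ENNReal.ofReal_toReal ((heat_le_one μ ht.le z).trans_lt ENNReal.one_lt_top).ne]
    refine ENNReal.ofReal_le_ofReal (le_min ?_ (hheat t ht z))
    exact ENNReal.toReal_le_of_le_ofReal zero_le_one (by simpa using heat_le_one μ ht.le z)
  -- bound the factor with the larger time by its supremum, and sum the other one to `1`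
  have hpair : ∀ s, 0 < s → ∀ t, 0 < t → ∑' z, heat μ s z * heat μ t z ≤
      ENNReal.ofReal (N s) * ENNReal.ofReal (N t) := fun s hs t ht => by
    have h1 : ∑' z, heat μ s z * heat μ t z ≤ ENNReal.ofReal (N t) ^ 2 := by
      calc _ ≤ ∑' z, heat μ s z * ENNReal.ofReal (N t) ^ 2 :=
            ENNReal.tsum_le_tsum fun z => by gcongr; exact hbound t ht z
        _ = _ := by rw [ENNReal.tsum_mul_right, tsum_heat μ.tsum_coe hs.le, one_mul]
    have h2 : ∑' z, heat μ s z * heat μ t z ≤ ENNReal.ofReal (N s) ^ 2 := by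
      calc _ ≤ ∑' z, ENNReal.ofReal (N s) ^ 2 * heat μ t z :=
            ENNReal.tsum_le_tsum fun z => by gcongr; exact hbound s hs z
        _ = _ := by rw [ENNReal.tsum_mul_left, tsum_heat μ.tsum_coe ht.le, mul_one]
    rcases le_total (ENNReal.ofReal (N s)) (ENNReal.ofReal (N t)) with h | h
    · exact h2.trans (by rw [sq]; gcongr)
    · exact h1.trans (by rw [sq]; gcongr)
  have hfin : ∫⁻ t in Set.Ioi (0 : ℝ), ENNReal.ofReal (N t) < ∞ := by
    rw [← Set.Ioc_union_Ioi_eq_Ioi zero_le_one, lintegral_union measurableSet_Ioi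
      (Set.Ioc_disjoint_Ioi le_rfl)]
    refine ENNReal.add_lt_top.2 ⟨?_, ?_⟩
    · refine (setLIntegral_mono' measurableSet_Ioc (g := fun _ => 1) fun t _ => ?_).trans_lt
        (by simp)
      rw [← ENNReal.ofReal_one]
      exact ENNReal.ofReal_le_ofReal (Real.sqrt_le_one.2 (min_le_left _ _))
    · have hi : IntegrableOn (fun t : ℝ => Real.sqrt C * t ^ (-(d / 4 : ℝ))) (Set.Ioi 1) :=
        (integrableOn_Ioi_rpow_of_lt (by linarith) one_pos).const_mul _
      refine lt_of_le_of_lt (setLIntegral_mono' measurableSet_Ioi fun t ht => ?_)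
        hi.lintegral_lt_top
      have ht : 0 < t := one_pos.trans ht
      refine ENNReal.ofReal_le_ofReal ((Real.sqrt_le_sqrt (min_le_right _ _)).trans_eq ?_)
      rw [Real.sqrt_mul hC.le, Real.sqrt_eq_rpow (t ^ _), ← Real.rpow_mul ht.le]
      congr 2
      ring
  have hsq : ∀ z, green μ z ^ 2 = ∫⁻ s in Set.Ioi (0 : ℝ), ∫⁻ t in Set.Ioi (0 : ℝ),
      heat μ s z * heat μ t z := fun z => by
    simp_rw [lintegral_const_mul _ (measurable_heat (μ : Site d → ℝ≥0∞) z)]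
    rw [lintegral_mul_const _ (measurable_heat _ z), lintegral_heat, sq]
  calc ∑' z, green μ z ^ 2
      = ∫⁻ s in Set.Ioi (0 : ℝ), ∫⁻ t in Set.Ioi (0 : ℝ), ∑' z, heat μ s z * heat μ t z := by
        simp_rw [hsq]
        rw [← lintegral_tsum]
        · refine lintegral_congr fun s => ?_
          rw [← lintegral_tsum fun z => ((measurable_heat _ z).const_mul _).aemeasurable]
        · intro z
          simp_rw [lintegral_const_mul _ (measurable_heat (μ : Site d → ℝ≥0∞) z)]
          exact ((measurable_heat _ z).mul_const _).aemeasurable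
    _ ≤ ∫⁻ s in Set.Ioi (0 : ℝ), ∫⁻ t in Set.Ioi (0 : ℝ),
          ENNReal.ofReal (N s) * ENNReal.ofReal (N t) :=
        setLIntegral_mono' measurableSet_Ioi fun s hs =>
          setLIntegral_mono' measurableSet_Ioi fun t ht => hpair s hs t ht
    _ = (∫⁻ t in Set.Ioi (0 : ℝ), ENNReal.ofReal (N t)) ^ 2 := by
        simp_rw [lintegral_const_mul _ hNm.ennreal_ofReal]
        rw [lintegral_mul_const _ hNm.ennreal_ofReal, sq]
    _ < ∞ := ENNReal.pow_lt_top hfin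

lemma IsJumpLaw.green_lt_top (hd : 5 ≤ d) {μ : PMF (Site d)} (hμ : IsJumpLaw μ) (x : Site d) :
    green μ x < ∞ := by
  have := (ENNReal.le_tsum (f := fun z => green μ z ^ 2) x).trans_lt (hμ.tsum_green_sq_lt_top hd)
  by_contra h
  simp [not_lt, top_le_iff] at h
  simp [h] at this

/-- The jump law restricted to jumps of size at most `R`. -/
def truncLaw (μ : PMF (Site d)) (R : ℝ) (z : Site d) : ℝ≥0∞ := if euclNorm z ≤ R then μ z else 0

/-- The jump law restricted to jumps of size larger than `R`. -/
def bigLaw (μ : PMF (Site d)) (R : ℝ) (z : Site d) : ℝ≥0∞ := if euclNorm z ≤ R then 0 else μ z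

lemma truncLaw_add_bigLaw (μ : PMF (Site d)) (R : ℝ) :
    (μ : Site d → ℝ≥0∞) = truncLaw μ R + bigLaw μ R := by
  funext z
  by_cases h : euclNorm z ≤ R <;> simp [truncLaw, bigLaw, h]

lemma truncLaw_le (μ : PMF (Site d)) (R : ℝ) : truncLaw μ R ≤ μ := by
  conv_rhs => rw [truncLaw_add_bigLaw μ R]
  exact le_self_add

lemma tsum_bigLaw (μ : PMF (Site d)) (R : ℝ) :
    ∑' z, bigLaw μ R z = μ.toMeasure {x | R < euclNorm x} := by
  rw [PMF.toMeasure_apply μ (.of_discrete)]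
  refine tsum_congr fun z => ?_
  by_cases h : euclNorm z ≤ R
  · simp [bigLaw, h]
  · rw [bigLaw, if_neg h, Set.indicator_of_mem]
    exact not_le.1 h

lemma WeakLd.exists_tsum_bigLaw_le {μ : PMF (Site d)} (hw : WeakLd μ) :
    ∃ C : ℝ, 0 < C ∧ ∀ R : ℝ, 1 ≤ R → ∑' z, bigLaw μ R z ≤ ENNReal.ofReal (C * (R ^ d)⁻¹) := by
  obtain ⟨C, hC, h⟩ := hw
  refine ⟨C, hC, fun R hR => ?_⟩
  rw [tsum_bigLaw, ← ENNReal.ofReal_toReal (measure_ne_top μ.toMeasure _)]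
  exact ENNReal.ofReal_le_ofReal (h R hR).le

lemma exp_le_one_add_add_sq_mul (u : ℝ) : Real.exp u ≤ 1 + u + u ^ 2 * Real.exp |u| := by
  have h := Complex.norm_exp_sub_sum_le_norm_mul_exp (u : ℂ) 2
  have h2 : Complex.exp u - ∑ m ∈ Finset.range 2, (u : ℂ) ^ m / m.factorial =
      ((Real.exp u - (1 + u) : ℝ) : ℂ) := by
    simp [Finset.sum_range_succ]
  rw [h2, Complex.norm_real, Complex.norm_real, Real.norm_eq_abs, Real.norm_eq_abs, sq_abs] at h
  linarith [le_abs_self (Real.exp u - (1 + u))]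

/-- Exponential moments of the truncated jump law; the drift created by the truncation is
controlled by the second moment. -/
lemma IsJumpLaw.tsum_truncLaw_mul_exp_le {μ : PMF (Site d)} (hμ : IsJumpLaw μ) {R β : ℝ}
    (hR : 0 < R) (θ : Fin d → ℝ) (hθ : Real.sqrt (normSq θ) = β) :
    ∃ a : ℝ, 0 ≤ a ∧ a ≤ 1 + (β / R + β ^ 2 * Real.exp (β * R)) *
        ∑' z, (μ z).toReal * euclNorm z ^ 2 ∧
      ∑' z, truncLaw μ R z * ENNReal.ofReal (Real.exp (pairing θ z)) = ENNReal.ofReal a := by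
  have hβ : 0 ≤ β := hθ ▸ Real.sqrt_nonneg _
  have hmean : HasSum (fun x => (μ x).toReal * pairing θ x) 0 := by
    have := hasSum_sum fun (i : Fin d) (_ : i ∈ Finset.univ) => (hμ.mean_zero i).mul_left (θ i)
    simp only [mul_zero, Finset.sum_const_zero] at this
    convert! this using 2 with x
    rw [pairing, Finset.mul_sum]
    exact Finset.sum_congr rfl fun i _ => by ring
  have hmaj := ((hasSum_toReal μ).add hmean).add
    (hμ.summable_euclNorm.hasSum.mul_left (β / R + β ^ 2 * Real.exp (β * R)))
  -- for a jump of size larger than `R` the right-hand side is nonnegative, thanks to the term `β /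
  -- R`
  have hle : ∀ z, (truncLaw μ R z).toReal * Real.exp (pairing θ z) ≤
      (μ z).toReal + (μ z).toReal * pairing θ z + (β / R + β ^ 2 * Real.exp (β * R)) *
        ((μ z).toReal * euclNorm z ^ 2) := fun z => by
    have h1 := abs_pairing_le θ z
    rw [hθ] at h1
    have h0 := euclNorm_nonneg z
    have hp : 0 ≤ (μ z).toReal := ENNReal.toReal_nonneg
    rw [show (μ z).toReal + (μ z).toReal * pairing θ z + (β / R + β ^ 2 * Real.exp (β * R)) *
        ((μ z).toReal * euclNorm z ^ 2) = (μ z).toReal * (1 + pairing θ z +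
          (β / R * euclNorm z ^ 2 + β ^ 2 * euclNorm z ^ 2 * Real.exp (β * R))) by ring]
    by_cases h : euclNorm z ≤ R
    · rw [truncLaw, if_pos h]
      refine mul_le_mul_of_nonneg_left ((exp_le_one_add_add_sq_mul _).trans ?_) hp
      gcongr
      refine le_add_of_nonneg_of_le (by positivity) ?_
      refine mul_le_mul ?_ (Real.exp_le_exp.2 (h1.trans (by gcongr))) (Real.exp_pos _).le
        (by positivity)
      rw [← mul_pow, ← sq_abs]
      gcongr
    · rw [truncLaw, if_neg h]
      simp only [ENNReal.toReal_zero, zero_mul]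
      refine mul_nonneg hp ?_
      have h2 : β * euclNorm z ≤ β / R * euclNorm z ^ 2 := by
        rw [div_mul_eq_mul_div, le_div_iff₀ hR]
        nlinarith [mul_nonneg hβ h0]
      have h3 : 0 ≤ β ^ 2 * euclNorm z ^ 2 * Real.exp (β * R) := by positivity
      linarith [neg_abs_le (pairing θ z)]
  have hnn : ∀ z, 0 ≤ (truncLaw μ R z).toReal * Real.exp (pairing θ z) := fun z =>
    mul_nonneg ENNReal.toReal_nonneg (Real.exp_pos _).le
  have hs : Summable fun z => (truncLaw μ R z).toReal * Real.exp (pairing θ z) :=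
    Summable.of_nonneg_of_le hnn hle hmaj.summable
  refine ⟨∑' z, (truncLaw μ R z).toReal * Real.exp (pairing θ z), tsum_nonneg hnn, ?_, ?_⟩
  · refine (hs.tsum_le_tsum hle hmaj.summable).trans_eq ?_
    rw [hmaj.tsum_eq, add_zero]
  · rw [ENNReal.ofReal_tsum_of_nonneg hnn hs]
    refine tsum_congr fun z => ?_
    rw [ENNReal.ofReal_mul ENNReal.toReal_nonneg, ENNReal.ofReal_toReal]
    exact ((truncLaw_le μ R z).trans_lt (μ.apply_lt_top z)).ne

lemma sq_mul_exp_neg_half_le {l : ℝ} (hl : 0 ≤ l) : l ^ 2 * Real.exp (-(l / 2)) ≤ 8 := by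
  have h := Real.pow_div_factorial_le_exp (l / 2) (div_nonneg hl zero_le_two) 2
  rw [Real.exp_neg, ← div_eq_mul_inv, div_le_iff₀ (Real.exp_pos _)]
  norm_num [Nat.factorial] at h
  nlinarith

/-- At times `t ≤ |x|²` the walk with jumps of size at most `|x| / (2d)` charges `x` with at most
`C |x|^{-d}`: one half of the path has to travel a distance `|x| / 2`, which is measured with an
exponential moment of parameter proportional to `log (|x|² / t)`. -/
lemma IsJumpLaw.exists_heat_truncLaw_le (hd : 1 ≤ d) {μ : PMF (Site d)} (hμ : IsJumpLaw μ) :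
    ∃ C : ℝ, 0 < C ∧ ∀ x : Site d, 0 < euclNorm x → ∀ t : ℝ, 0 < t → t ≤ euclNorm x ^ 2 →
      heat (truncLaw μ (euclNorm x / (2 * d))) t x ≤ ENNReal.ofReal (C * (euclNorm x ^ d)⁻¹) := by
  obtain ⟨C, hC, hheat⟩ := hμ.exists_heat_le
  set V := ∑' z, (μ z).toReal * euclNorm z ^ 2 with hV
  have hV0 : 0 ≤ V := tsum_nonneg fun z => by positivity
  have hd' : (1 : ℝ) ≤ d := by exact_mod_cast hd
  refine ⟨2 * C * 2 ^ (d / 2 : ℝ) * Real.exp (6 * d ^ 2 * V), by positivity,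
    fun x hx t ht htr => ?_⟩
  set r := euclNorm x with hr
  set R := r / (2 * d) with hRdef
  have hR : 0 < R := by positivity
  -- `t = r² e^{-l}`
  set l := Real.log (r ^ 2 / t) with hl
  have hl0 : 0 ≤ l := Real.log_nonneg ((one_le_div ht).2 htr)
  have hexpl : Real.exp l = r ^ 2 / t := Real.exp_log (by positivity)
  have htl : t = r ^ 2 * Real.exp (-l) := by
    rw [Real.exp_neg, hexpl]; field_simp
  set b : ℝ := d * l / r ^ 2 with hb
  set θ : Fin d → ℝ := fun i => b * x i with hθ
  have hb0 : 0 ≤ b := by positivity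
  have hθn : Real.sqrt (normSq θ) = b * r := by
    rw [show θ = b • fun i => (x i : ℝ) from rfl, normSq_smul, Real.sqrt_mul (sq_nonneg _),
      Real.sqrt_sq hb0]
    rfl
  have hθx : pairing θ x = d * l := by
    have : pairing θ x = b * r ^ 2 := by
      rw [hr, euclNorm_sq, pairing, Finset.mul_sum]
      exact Finset.sum_congr rfl fun i _ => by simp only [hθ]; ring
    rw [this, hb]
    field_simp
  -- the tilt `θ` is parallel to `x`, with `θ · x = d l`
  obtain ⟨a, ha0, ha, hsum⟩ := hμ.tsum_truncLaw_mul_exp_le hR θ hθn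
  have hmass : ∑' z, heat (truncLaw μ R) (t / 2) z * ENNReal.ofReal (Real.exp (pairing θ z)) ≤
      ENNReal.ofReal (Real.exp (6 * d ^ 2 * V)) := by
    rw [tsum_heat_mul_ofReal _ _ (fun x y => by
      rw [pairing_add, Real.exp_add, ENNReal.ofReal_mul (Real.exp_pos _).le])
      (by simp [pairing]) (half_pos ht).le ha0 hsum]
    refine ENNReal.ofReal_le_ofReal (Real.exp_le_exp.2 ?_)
    have h1 : t / 2 * (a - 1) ≤ t / 2 * ((b * r / R + (b * r) ^ 2 * Real.exp (b * r * R)) * V) := by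
      have : 0 ≤ t / 2 := by positivity
      exact mul_le_mul_of_nonneg_left (by linarith) this
    have h2 : t / 2 * (b * r / R) = d ^ 2 * (l * Real.exp (-l)) := by
      rw [htl, hRdef, hb]; field_simp
    have h3 : b * r * R = l / 2 := by rw [hRdef, hb]; field_simp
    have h4 : t / 2 * (b * r) ^ 2 * Real.exp (b * r * R) =
        d ^ 2 / 2 * (l ^ 2 * Real.exp (-(l / 2))) := by
      rw [h3, show -(l / 2) = -l + l / 2 by ring, Real.exp_add, htl, hb]; field_simp
    have h5 : l * Real.exp (-l) ≤ 1 := by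
      rw [Real.exp_neg, ← div_eq_mul_inv, div_le_one (Real.exp_pos _)]
      linarith [Real.add_one_le_exp l]
    have h6 := sq_mul_exp_neg_half_le hl0
    calc t / 2 * (a - 1) ≤ (t / 2 * (b * r / R) +
          t / 2 * (b * r) ^ 2 * Real.exp (b * r * R)) * V := h1.trans_eq (by ring)
      _ ≤ (d ^ 2 * 1 + d ^ 2 / 2 * 8) * V := by rw [h2, h4]; gcongr
      _ ≤ 6 * d ^ 2 * V := by nlinarith [mul_nonneg (sq_nonneg (d : ℝ)) hV0]
  set S := ENNReal.ofReal (C * (t / 2) ^ (-(d / 2 : ℝ))) with hS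
  have hsup : ∀ z, heat (truncLaw μ R) (t / 2) z ≤ S := fun z => by
    refine (heat_mono (truncLaw_le μ R) _ z).trans ?_
    rw [← ENNReal.ofReal_toReal ((heat_le_one μ (half_pos ht).le z).trans_lt ENNReal.one_lt_top).ne]
    exact ENNReal.ofReal_le_ofReal (hheat _ (half_pos ht) z)
  set E := ENNReal.ofReal (Real.exp (-(d * l / 2))) with hE
  set w : Site d → ℝ≥0∞ := fun z =>
    heat (truncLaw μ R) (t / 2) z * ENNReal.ofReal (Real.exp (pairing θ z)) with hw
  have hone : ∀ z, d * l / 2 ≤ pairing θ z → heat (truncLaw μ R) (t / 2) z ≤ E * w z := fun z hz => by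
    rw [hw, hE, mul_left_comm, ← ENNReal.ofReal_mul (Real.exp_pos _).le, ← Real.exp_add]
    refine le_mul_of_one_le_right' ?_
    rw [ENNReal.one_le_ofReal, Real.one_le_exp_iff]
    linarith
  -- as `θ · z + θ · (x - z) = d l`, one of the two halves of the path has `θ`-displacement at least
  -- `d l / 2`: this half costs `E` in exponential moment, the other is bounded by `S`
  have hterm : ∀ z, heat (truncLaw μ R) (t / 2) z * heat (truncLaw μ R) (t / 2) (x - z) ≤
      S * E * (w z + w (x - z)) := fun z => by
    have hsplit : pairing θ z + pairing θ (x - z) = d * l := by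
      rw [← pairing_add, add_sub_cancel, hθx]
    rcases le_total (d * l / 2) (pairing θ z) with h | h
    · calc _ ≤ (E * w z) * S := mul_le_mul' (hone z h) (hsup _)
        _ = S * E * w z := by ring
        _ ≤ _ := by gcongr; exact le_self_add
    · calc _ ≤ S * (E * w (x - z)) := mul_le_mul' (hsup _) (hone _ (by linarith))
        _ = S * E * w (x - z) := by ring
        _ ≤ _ := by gcongr; exact le_add_self
  calc heat (truncLaw μ R) t x = latticeConv (heat (truncLaw μ R) (t / 2))
        (heat (truncLaw μ R) (t / 2)) x := by
        rw [← heat_add _ (half_pos ht).le (half_pos ht).le, add_halves]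
    _ ≤ ∑' z, S * E * (w z + w (x - z)) := ENNReal.tsum_le_tsum hterm
    _ = S * E * (2 * ∑' z, w z) := by
        rw [ENNReal.tsum_mul_left, ENNReal.tsum_add, two_mul]
        congr 2
        exact (Equiv.subLeft x).tsum_eq w
    _ ≤ S * E * (2 * ENNReal.ofReal (Real.exp (6 * d ^ 2 * V))) := by gcongr
    _ = _ := by
        rw [hS, hE, ← ENNReal.ofReal_ofNat 2, ← ENNReal.ofReal_mul (by positivity),
          ← ENNReal.ofReal_mul (by positivity), ← ENNReal.ofReal_mul (by positivity)]
        congr 1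
        -- `S E` is of order `t^{-d/2} (t / r²)^{d/2} = r^{-d}`
        have h7 : (t / 2) ^ (-(d / 2 : ℝ)) * Real.exp (-(d * l / 2)) =
            2 ^ (d / 2 : ℝ) * (r ^ d)⁻¹ := by
          rw [show -(d * l / 2) = l * (-(d / 2 : ℝ)) by ring, Real.exp_mul, hexpl,
            ← Real.mul_rpow (by positivity) (by positivity),
            show t / 2 * (r ^ 2 / t) = r ^ 2 / 2 by field_simp, Real.rpow_neg (by positivity),
            Real.div_rpow (by positivity) (by positivity), ← Real.rpow_natCast r 2,
            ← Real.rpow_mul hx.le, ← Real.rpow_natCast r d, inv_div, div_eq_mul_inv]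
          congr 3
          push_cast
          ring
        calc _ = 2 * C * Real.exp (6 * d ^ 2 * V) *
              ((t / 2) ^ (-(d / 2 : ℝ)) * Real.exp (-(d * l / 2))) := by ring
          _ = _ := by rw [h7]; ring

lemma IsJumpLaw.exists_invCovForm_ge {μ : PMF (Site d)} (hμ : IsJumpLaw μ) :
    ∃ c : ℝ, 0 < c ∧ ∀ x, c * euclNorm x ^ 2 ≤ invCovForm μ x := by
  obtain ⟨c, hc, h⟩ := exists_dotProduct_mulVec_ge hμ.cov_posDef.inv
  refine ⟨c, hc, fun x => ?_⟩
  have := h fun i => (x i : ℝ)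
  rwa [normSq, ← euclNorm_sq] at this

/-- The Gaussian density is at most `C |x|^{-d}` at all times. -/
lemma IsJumpLaw.exists_gaussHeat_le {μ : PMF (Site d)} (hμ : IsJumpLaw μ) :
    ∃ C : ℝ, 0 < C ∧ ∀ x : Site d, 0 < euclNorm x → ∀ t : ℝ, 0 < t →
      gaussHeat μ t x ≤ C * (euclNorm x ^ d)⁻¹ := by
  obtain ⟨c, hc, hq⟩ := hμ.exists_invCovForm_ge
  have hpi := Real.pi_pos
  have hdet := hμ.cov_posDef.det_pos
  refine ⟨(2 * Real.pi) ^ (-(d / 2 : ℝ)) * (Real.sqrt (covMatrix μ).det)⁻¹ *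
    (d.factorial * Real.exp (c / 2) / (c / 2) ^ d), by positivity, fun x hx t ht => ?_⟩
  set r := euclNorm x with hr
  -- `u^{d/2} e^{-(c/2) u}` is bounded, where `u = r² / t`
  set u := r ^ 2 / t with hu
  have hu0 : 0 < u := by positivity
  have h1 : Real.exp (-(invCovForm μ x / 2) / t) ≤ Real.exp (-(c / 2 * u)) := by
    refine Real.exp_le_exp.2 ?_
    rw [hu, neg_div, neg_le_neg_iff, mul_div_assoc', div_le_div_iff_of_pos_right ht]
    linarith [hq x]
  have h2 : u ^ (d / 2 : ℝ) * Real.exp (-(c / 2 * u)) ≤ d.factorial * Real.exp (c / 2) / (c / 2) ^ d := by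
    have hpow : u ^ (d / 2 : ℝ) ≤ (1 + u) ^ d := by
      calc u ^ (d / 2 : ℝ) ≤ (1 + u) ^ (d / 2 : ℝ) := by gcongr; linarith
        _ ≤ (1 + u) ^ (d : ℝ) := Real.rpow_le_rpow_of_exponent_le (by linarith)
            (by linarith [(Nat.cast_nonneg d : (0 : ℝ) ≤ d)])
        _ = _ := Real.rpow_natCast _ _
    have hexp := Real.pow_div_factorial_le_exp (c / 2 * (1 + u)) (by positivity) d
    rw [div_le_iff₀ (by positivity), mul_pow, mul_add, mul_one, Real.exp_add] at hexp
    rw [Real.exp_neg, ← div_eq_mul_inv, div_le_iff₀ (Real.exp_pos _), div_mul_eq_mul_div,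
      le_div_iff₀ (by positivity), mul_comm _ ((c / 2) ^ d)]
    calc (c / 2) ^ d * u ^ (d / 2 : ℝ) ≤ (c / 2) ^ d * (1 + u) ^ d := by gcongr
      _ ≤ _ := hexp.trans_eq (by ring)
  have h3 : t ^ (-(d / 2 : ℝ)) = u ^ (d / 2 : ℝ) * (r ^ d)⁻¹ := by
    rw [hu, Real.div_rpow (by positivity) ht.le, ← Real.rpow_natCast r 2, ← Real.rpow_mul hx.le,
      ← Real.rpow_natCast r d, Real.rpow_neg ht.le]
    have : ((2 : ℕ) : ℝ) * (d / 2) = d := by push_cast; ring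
    rw [this]
    field_simp
  rw [gaussHeat, Real.mul_rpow (by positivity) ht.le, h3]
  calc _ = (2 * Real.pi) ^ (-(d / 2 : ℝ)) * (Real.sqrt (covMatrix μ).det)⁻¹ *
        (u ^ (d / 2 : ℝ) * Real.exp (-(invCovForm μ x / 2) / t)) * (r ^ d)⁻¹ := by ring
    _ ≤ (2 * Real.pi) ^ (-(d / 2 : ℝ)) * (Real.sqrt (covMatrix μ).det)⁻¹ *
        (d.factorial * Real.exp (c / 2) / (c / 2) ^ d) * (r ^ d)⁻¹ := by
        gcongr
        exact (mul_le_mul_of_nonneg_left h1 (by positivity)).trans h2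

lemma latticeConv_bigLaw_le {μ : PMF (Site d)} (R : ℝ) (x : Site d) :
    latticeConv (green μ) (latticeConv (bigLaw μ R) (green μ)) x ≤
      (∑' z, bigLaw μ R z) * ∑' z, green μ z ^ 2 := by
  rw [latticeConv_comm, latticeConv_assoc]
  exact latticeConv_le_mul (latticeConv_self_le _) x

lemma integrableOn_heat_toReal (hd : 5 ≤ d) {μ : PMF (Site d)} (hμ : IsJumpLaw μ) (x : Site d) :
    IntegrableOn (fun t => (heat μ t x).toReal) (Set.Ioi 0) := by
  refine integrable_toReal_of_lintegral_ne_top (measurable_heat _ x).aemeasurable ?_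
  rw [lintegral_heat]
  exact (hμ.green_lt_top hd x).ne

lemma green_toReal_eq (μ : PMF (Site d)) (x : Site d) :
    (green μ x).toReal = ∫ t in Set.Ioi (0 : ℝ), (heat μ t x).toReal := by
  rw [integral_toReal (measurable_heat _ x).aemeasurable, lintegral_heat]
  filter_upwards [ae_restrict_mem measurableSet_Ioi] with t ht
  exact (heat_le_one μ (le_of_lt ht) x).trans_lt ENNReal.one_lt_top

/-- The contribution of the times `t ≤ ε |x|²` to the Green function. -/
lemma IsJumpLaw.exists_integral_heat_le (hd : 5 ≤ d) {μ : PMF (Site d)} (hμ : IsJumpLaw μ)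
    (hw : WeakLd μ) :
    ∃ C : ℝ, 0 < C ∧ ∀ x : Site d, 2 * d ≤ euclNorm x → ∀ ε : ℝ, 0 < ε → ε ≤ 1 →
      ∫ t in Set.Ioc (0 : ℝ) (ε * euclNorm x ^ 2), (heat μ t x).toReal ≤
        C * (ε * euclNorm x ^ 2 + 1) * (euclNorm x ^ d)⁻¹ := by
  obtain ⟨C₁, hC₁, h₁⟩ := hμ.exists_heat_truncLaw_le (by omega)
  obtain ⟨C₂, hC₂, h₂⟩ := hw.exists_tsum_bigLaw_le
  have hd' : (5 : ℝ) ≤ d := by exact_mod_cast hd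
  set A := (∑' z, green μ z ^ 2).toReal with hA
  have hA' : ∑' z, green μ z ^ 2 = ENNReal.ofReal A :=
    (ENNReal.ofReal_toReal (hμ.tsum_green_sq_lt_top hd).ne).symm
  have hA0 : 0 ≤ A := ENNReal.toReal_nonneg
  refine ⟨C₁ + C₂ * (2 * d) ^ d * A, by positivity, fun x hx ε hε hε1 => ?_⟩
  set r := euclNorm x with hr
  have hr0 : 0 < r := by linarith
  set R := r / (2 * d) with hRdef
  have hR : 1 ≤ R := by rw [hRdef, one_le_div (by positivity)]; exact hx
  -- paths without a jump larger than `R`, and the remainder `e` of the paths with such a jump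
  obtain ⟨e, he, hesum⟩ := convPow_le_of_eq_add (truncLaw_add_bigLaw μ R)
  have hT : 0 ≤ ε * r ^ 2 := by positivity
  have hle : ∫⁻ t in Set.Ioc (0 : ℝ) (ε * r ^ 2), heat μ t x ≤
      ENNReal.ofReal (C₁ * (r ^ d)⁻¹) * ENNReal.ofReal (ε * r ^ 2) +
        ENNReal.ofReal (C₂ * (R ^ d)⁻¹) * ENNReal.ofReal A := by
    calc ∫⁻ t in Set.Ioc (0 : ℝ) (ε * r ^ 2), heat μ t x
        ≤ ∫⁻ t in Set.Ioc (0 : ℝ) (ε * r ^ 2), (ENNReal.ofReal (C₁ * (r ^ d)⁻¹) +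
            ∑' n : ℕ, ENNReal.ofReal (Real.exp (-t) * (t ^ n / n.factorial)) * e n x) := by
          refine setLIntegral_mono' measurableSet_Ioc fun t ht => ?_
          refine le_trans ?_ (add_le_add_left (h₁ x hr0 t ht.1 (ht.2.trans ?_)) _)
          · rw [heat, heat, ← ENNReal.tsum_add]
            refine ENNReal.tsum_le_tsum fun n => ?_
            rw [← mul_add]
            gcongr
            exact he n x
          · exact mul_le_of_le_one_left (by positivity) hε1
      _ ≤ _ := by
          rw [lintegral_add_left measurable_const]
          refine add_le_add (by simp) ?_
          calc _ ≤ ∫⁻ t in Set.Ioi (0 : ℝ),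
                ∑' n : ℕ, ENNReal.ofReal (Real.exp (-t) * (t ^ n / n.factorial)) * e n x :=
                lintegral_mono_set Set.Ioc_subset_Ioi_self
            _ = ∑' n, e n x := by
                rw [lintegral_tsum fun n => by fun_prop]
                refine tsum_congr fun n => ?_
                rw [lintegral_mul_const _ (by fun_prop), lintegral_exp_neg_mul_pow, one_mul]
            _ ≤ _ := by
                rw [hesum]
                refine (latticeConv_bigLaw_le R x).trans ?_
                rw [hA']
                gcongr
                exact h₂ R hR
  rw [← ENNReal.ofReal_mul (by positivity), ← ENNReal.ofReal_mul (by positivity),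
    ← ENNReal.ofReal_add (by positivity) (by positivity)] at hle
  rw [integral_toReal (measurable_heat _ x).aemeasurable]
  · refine (ENNReal.toReal_le_of_le_ofReal (by positivity) hle).trans ?_
    have h3 : (R ^ d)⁻¹ = (2 * d) ^ d * (r ^ d)⁻¹ := by
      rw [hRdef, div_pow, inv_div, div_eq_mul_inv]
    rw [h3]
    have h4 : 0 ≤ C₂ * (2 * d) ^ d * A := by positivity
    have h5 : 0 ≤ (r ^ d)⁻¹ := by positivity
    nlinarith [mul_nonneg (mul_nonneg h4 hT) h5, mul_nonneg hC₁.le h5]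
  · filter_upwards [ae_restrict_mem measurableSet_Ioc] with t ht
    exact (heat_le_one μ ht.1.le x).trans_lt ENNReal.one_lt_top

lemma tendsto_euclNorm : Tendsto (euclNorm : Site d → ℝ) (atInfinity d) atTop := tendsto_comap

lemma eventually_ne_zero : ∀ᶠ x in atInfinity d, x ≠ 0 := by
  filter_upwards [tendsto_euclNorm.eventually_gt_atTop 0] with x hx h
  simp [h, euclNorm] at hx

lemma exists_jnorm_le (μ : PMF (Site d)) : ∃ C : ℝ, 0 < C ∧ ∀ x, jnorm μ x ≤ C * euclNorm x := by
  set S := ∑ i, ∑ j, |(covMatrix μ)⁻¹ i j| with hS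
  have hS0 : 0 ≤ S := Finset.sum_nonneg fun i _ => Finset.sum_nonneg fun j _ => abs_nonneg _
  refine ⟨Real.sqrt (S / d) + 1, by positivity, fun x => ?_⟩
  have hx (i : Fin d) : |(x i : ℝ)| ≤ euclNorm x := Real.abs_le_sqrt
    (Finset.single_le_sum (f := fun i => (x i : ℝ) ^ 2) (fun _ _ => sq_nonneg _)
      (Finset.mem_univ i))
  have h0 := euclNorm_nonneg x
  have h1 : invCovForm μ x ≤ S * euclNorm x ^ 2 := by
    rw [invCovForm, dotProduct, hS, Finset.sum_mul]
    refine Finset.sum_le_sum fun i _ => ?_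
    rw [Matrix.mulVec, dotProduct, Finset.mul_sum, Finset.sum_mul]
    refine Finset.sum_le_sum fun j _ => (le_abs_self _).trans ?_
    rw [abs_mul, abs_mul, sq]
    calc |(x i : ℝ)| * (|(covMatrix μ)⁻¹ i j| * |(x j : ℝ)|)
        = |(covMatrix μ)⁻¹ i j| * (|(x i : ℝ)| * |(x j : ℝ)|) := by ring
      _ ≤ _ := by gcongr <;> exact hx _
  have h2 : jnorm μ x ≤ Real.sqrt (S / d * euclNorm x ^ 2) := by
    refine Real.sqrt_le_sqrt ?_
    rw [div_mul_eq_mul_div]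
    exact div_le_div_of_nonneg_right h1 (Nat.cast_nonneg d)
  rw [Real.sqrt_mul (by positivity), Real.sqrt_sq h0] at h2
  linarith [add_mul (Real.sqrt (S / d)) 1 (euclNorm x)]

lemma jnorm_nonneg (μ : PMF (Site d)) (x : Site d) : 0 ≤ jnorm μ x := Real.sqrt_nonneg _

lemma greenConst_pos (hd : 3 ≤ d) {μ : PMF (Site d)} (hμ : IsJumpLaw μ) : 0 < greenConst μ := by
  have hd' : (3 : ℝ) ≤ d := by exact_mod_cast hd
  have := hμ.cov_posDef.det_pos
  have := Real.pi_pos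
  have : (0 : ℝ) < d - 2 := by linarith
  have := Real.Gamma_pos_of_pos (show (0 : ℝ) < d / 2 by positivity)
  unfold greenConst
  positivity

/-- The distance between the Green function and its Gaussian counterpart is `o(|x|^{2-d})`. -/
lemma IsJumpLaw.tendsto_green_sub (hd : 5 ≤ d) {μ : PMF (Site d)} (hμ : IsJumpLaw μ)
    (hw : WeakLd μ) :
    Tendsto (fun x => euclNorm x ^ (d - 2) *
      |(green μ x).toReal - ∫ t in Set.Ioi (0 : ℝ), gaussHeat μ t x|) (atInfinity d) (𝓝 0) := by
  obtain ⟨C₁, hC₁, h₁⟩ := hμ.exists_integral_heat_le hd hw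
  obtain ⟨C₂, hC₂, h₂⟩ := hμ.exists_gaussHeat_le
  obtain ⟨δ, hδ, h₃⟩ := hμ.exists_heat_sub_gaussHeat_le
  have hd' : (5 : ℝ) ≤ d := by exact_mod_cast hd
  have ha : (0 : ℝ) < d / 2 - 1 := by linarith
  rw [Metric.tendsto_nhds]
  intro η hη
  -- times before `ε r²` contribute at most `ε (C₁ + C₂)` up to lower order; `κ` is the accuracy of
  -- the local limit theorem needed after that time
  set ε : ℝ := min 1 (η / (4 * (C₁ + C₂))) with hε
  have hε0 : 0 < ε := by positivity
  have hε1 : ε ≤ 1 := min_le_left _ _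
  set κ : ℝ := η / 4 * (d / 2 - 1) * ε ^ (d / 2 - 1 : ℝ) with hκ
  have hκ0 : 0 < κ := by positivity
  obtain ⟨T, hT⟩ := eventually_atTop.1 ((hδ.eventually (gt_mem_nhds hκ0)))
  have hr2 : Tendsto (fun x : Site d => ε * euclNorm x ^ 2) (atInfinity d) atTop :=
    ((tendsto_pow_atTop two_ne_zero).comp tendsto_euclNorm).const_mul_atTop hε0
  filter_upwards [tendsto_euclNorm.eventually_ge_atTop (2 * d), hr2.eventually_ge_atTop T,
    hr2.eventually_gt_atTop (ε * (4 * C₁ / η))] with x hx hxT hxC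
  set r := euclNorm x with hr
  have hr0 : 0 < r := by linarith
  have hx0 : x ≠ 0 := by
    rintro rfl
    simp [hr, euclNorm] at hr0
  have hτ : 0 < ε * r ^ 2 := by positivity
  have hγint : IntegrableOn (fun t => gaussHeat μ t x) (Set.Ioi 0) := by
    have h := hμ.integral_gaussHeat (by omega) hx0
    -- a non-integrable function would have integral `0`, but the integral is known to be positive
    refine not_imp_comm.1 integral_undef fun h0 => ?_
    rw [h0, mul_zero] at h
    exact (greenConst_pos (by omega) hμ).ne h
  have hhint := integrableOn_heat_toReal hd hμ x
  have hγ0 : ∀ t, 0 < t → 0 ≤ gaussHeat μ t x := fun t ht => by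
    have := Real.pi_pos
    unfold gaussHeat
    positivity
  set s₁ := Set.Ioc (0 : ℝ) (ε * r ^ 2)
  have hs₁ : s₁ ⊆ Set.Ioi 0 := Set.Ioc_subset_Ioi_self
  have hs₂ : Set.Ioi (ε * r ^ 2) ⊆ Set.Ioi 0 := Set.Ioi_subset_Ioi hτ.le
  have hB : ∫ t in s₁, gaussHeat μ t x ≤ C₂ * (r ^ d)⁻¹ * (ε * r ^ 2) := by
    calc _ ≤ ∫ t in s₁, C₂ * (r ^ d)⁻¹ := setIntegral_mono_on (hγint.mono_set hs₁)
          (integrableOn_const (by simp [s₁])) measurableSet_Ioc fun t ht => h₂ x hr0 t ht.1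
      _ = _ := by
          rw [setIntegral_const, smul_eq_mul, Measure.real, Real.volume_Ioc, sub_zero,
            ENNReal.toReal_ofReal hτ.le, mul_comm]
  have hC : ∫ t in Set.Ioi (ε * r ^ 2), |(heat μ t x).toReal - gaussHeat μ t x| ≤
      κ * ((ε * r ^ 2) ^ (1 - d / 2 : ℝ) / (d / 2 - 1)) := by
    have hexp : -(d / 2 : ℝ) < -1 := by linarith
    calc _ ≤ ∫ t in Set.Ioi (ε * r ^ 2), κ * t ^ (-(d / 2 : ℝ)) := by
          refine setIntegral_mono_on ((hhint.mono_set hs₂).sub (hγint.mono_set hs₂)).abs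
            ((integrableOn_Ioi_rpow_of_lt hexp hτ).const_mul _) measurableSet_Ioi fun t ht => ?_
          have ht0 : 0 < t := hτ.trans ht
          refine (h₃ t ht0 x).trans ?_
          gcongr
          exact (hT t (hxT.trans (le_of_lt ht))).le
      _ = _ := by
          rw [integral_const_mul, integral_Ioi_rpow_of_lt hexp hτ]
          congr 1
          rw [show -(d / 2 : ℝ) + 1 = 1 - d / 2 by ring, neg_div, ← div_neg]
          congr 1
          ring
  have hint : IntegrableOn (fun t => (heat μ t x).toReal - gaussHeat μ t x) (Set.Ioi 0) :=
    hhint.sub hγint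
  have hmain : |(green μ x).toReal - ∫ t in Set.Ioi (0 : ℝ), gaussHeat μ t x| ≤
      C₁ * (ε * r ^ 2 + 1) * (r ^ d)⁻¹ + C₂ * (r ^ d)⁻¹ * (ε * r ^ 2) +
        κ * ((ε * r ^ 2) ^ (1 - d / 2 : ℝ) / (d / 2 - 1)) := by
    rw [green_toReal_eq, ← integral_sub hhint hγint, ← Set.Ioc_union_Ioi_eq_Ioi hτ.le,
      setIntegral_union (Set.Ioc_disjoint_Ioi le_rfl) measurableSet_Ioi
        (hint.mono_set hs₁) (hint.mono_set hs₂),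
      integral_sub (hhint.mono_set hs₁) (hγint.mono_set hs₁)]
    refine (abs_add_le _ _).trans (add_le_add ?_ ((abs_integral_le_integral_abs).trans hC))
    refine (abs_sub _ _).trans (add_le_add ?_ ?_)
    · rw [abs_of_nonneg (integral_nonneg fun t => ENNReal.toReal_nonneg)]
      exact h₁ x hx ε hε0 hε1
    · rw [abs_of_nonneg (setIntegral_nonneg measurableSet_Ioc fun t ht => hγ0 t ht.1)]
      exact hB
  rw [Real.dist_eq, sub_zero, abs_of_nonneg (by positivity)]
  have hrd : r ^ d = r ^ (d - 2) * r ^ 2 := by rw [← pow_add]; congr 1; omega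
  have hrp : r ^ (d - 2) * (ε * r ^ 2) ^ (1 - d / 2 : ℝ) = (ε ^ (d / 2 - 1 : ℝ))⁻¹ := by
    rw [Real.mul_rpow hε0.le (by positivity), ← Real.rpow_natCast r 2, ← Real.rpow_mul hr0.le,
      mul_left_comm, ← Real.rpow_natCast r (d - 2), ← Real.rpow_add hr0, ← Real.rpow_neg hε0.le,
      Nat.cast_sub (by omega)]
    have : (d : ℝ) - (2 : ℕ) + (2 : ℕ) * (1 - d / 2) = 0 := by push_cast; ring
    rw [this, Real.rpow_zero, mul_one]
    congr 1
    ring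
  have hεC : ε * (C₁ + C₂) ≤ η / 4 := by
    calc ε * (C₁ + C₂) ≤ η / (4 * (C₁ + C₂)) * (C₁ + C₂) := by gcongr; exact min_le_right _ _
      _ = η / 4 := by field_simp
  have hC₁r : C₁ / r ^ 2 < η / 4 := by
    rw [mul_lt_mul_iff_right₀ hε0, div_lt_iff₀ hη] at hxC
    rw [div_lt_iff₀ (by positivity)]
    linarith
  calc r ^ (d - 2) * |(green μ x).toReal - ∫ t in Set.Ioi (0 : ℝ), gaussHeat μ t x|
      ≤ r ^ (d - 2) * (C₁ * (ε * r ^ 2 + 1) * (r ^ d)⁻¹ + C₂ * (r ^ d)⁻¹ * (ε * r ^ 2) +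
        κ * ((ε * r ^ 2) ^ (1 - d / 2 : ℝ) / (d / 2 - 1))) := by gcongr
    _ = ε * (C₁ + C₂) + C₁ / r ^ 2 +
        κ / (d / 2 - 1) * (r ^ (d - 2) * (ε * r ^ 2) ^ (1 - d / 2 : ℝ)) := by
        rw [hrd]; field_simp; ring
    _ = ε * (C₁ + C₂) + C₁ / r ^ 2 + η / 4 := by
        have hd2 : (d : ℝ) - 2 ≠ 0 := by linarith
        rw [hrp, hκ]; field_simp
    _ < η := by linarith

/-- The asymptotics of the Green function: `g(x) ∼ c_d 𝒥(x)^{2-d}`. -/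
lemma IsJumpLaw.tendsto_green (hd : 5 ≤ d) {μ : PMF (Site d)} (hμ : IsJumpLaw μ)
    (hw : WeakLd μ) :
    Tendsto (fun x => jnorm μ x ^ (d - 2) * (green μ x).toReal) (atInfinity d)
      (𝓝 (greenConst μ)) := by
  obtain ⟨C, hC, hJ⟩ := exists_jnorm_le μ
  rw [tendsto_iff_norm_sub_tendsto_zero]
  have h0 := (hμ.tendsto_green_sub hd hw).const_mul (C ^ (d - 2))
  rw [mul_zero] at h0
  refine squeeze_zero' (Eventually.of_forall fun _ => norm_nonneg _) ?_ h0
  filter_upwards [eventually_ne_zero] with x hx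
  rw [← hμ.integral_gaussHeat (by omega) hx, ← mul_sub, norm_mul, norm_pow,
    Real.norm_of_nonneg (jnorm_nonneg μ x), Real.norm_eq_abs, ← mul_assoc, ← mul_pow]
  gcongr
  · exact jnorm_nonneg μ x
  · exact hJ x

/-! ### The branching recursion -/

/-- Words are empty or of the form `u ++ [j]`: such a word is the individual `u` of the subtree of
the `j`-th child of the root. -/
def wordEquiv : Option (ℕ × List ℕ) ≃ List ℕ :=
  Equiv.ofBijective (fun o => o.elim [] fun q => q.2 ++ [q.1]) <| by
    refine ⟨?_, fun l => ?_⟩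
    · rintro (_ | ⟨j, u⟩) (_ | ⟨j', u'⟩) h
      · rfl
      · simp at h
      · simp at h
      · have := List.append_inj' h rfl
        simp_all
    · rcases List.eq_nil_or_concat l with h | ⟨u, j, h⟩
      · exact ⟨none, h.symm⟩
      · exact ⟨some (j, u), by simp [h]⟩

lemma tsum_word (F : List ℕ → ℝ≥0∞) : ∑' u, F u = F [] + ∑' j, ∑' u, F (u ++ [j]) := by
  rw [← wordEquiv.tsum_eq, ENNReal.tsum_eq_add_tsum_ite none,
    ← (Option.some_injective (ℕ × List ℕ)).tsum_eq, ENNReal.tsum_prod']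
  · simp
    rfl
  · rintro (_ | q) h
    · simp at h
    · exact ⟨q, rfl⟩

/-- The number of words of length `n` in a set of words. -/
def genCount (A : Set (List ℕ)) (n : ℕ) : ℝ≥0∞ :=
  ∑' u : List ℕ, if u.length = n then A.indicator 1 u else 0

lemma tsum_genCount (A : Set (List ℕ)) : ∑' n, genCount A n = ∑' u : List ℕ, A.indicator 1 u := by
  unfold genCount
  rw [ENNReal.tsum_comm]
  exact tsum_congr fun u => tsum_ite_eq' _ _

lemma genCount_zero (A : Set (List ℕ)) : genCount A 0 = A.indicator 1 [] := by
  rw [genCount, tsum_eq_single [] fun u hu => if_neg (by simpa using hu)]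
  simp

/-- The words of length `n + 1` are sorted according to their last letter, which is the child of the
root they descend from. -/
lemma genCount_succ (A : Set (List ℕ)) (n : ℕ) :
    genCount A (n + 1) = ∑' j, genCount {u | u ++ [j] ∈ A} n := by
  rw [genCount, tsum_word]
  simp only [List.length_nil, Nat.zero_ne_add_one, if_false, zero_add, List.length_append,
    List.length_cons, Nat.add_right_cancel_iff]
  rfl

lemma genCount_empty (n : ℕ) : genCount ∅ n = 0 := by simp [genCount]

/-- The environment of the subtree of the `j`-th child of the root. -/
def subEnv (ω : Env d) (j : ℕ) : Env d := fun u => ω (u ++ [j])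

lemma inTree_append (ω : Env d) (u : List ℕ) (j : ℕ) :
    InTree ω (u ++ [j]) ↔ j < (ω []).1 ∧ InTree (subEnv ω j) u := by
  induction u with
  | nil => simp [InTree]
  | cons i u ih => simp only [List.cons_append, InTree, ih, and_assoc]; rfl

lemma pos_append (x : Site d) (ω : Env d) (u : List ℕ) (j : ℕ) :
    pos x ω (u ++ [j]) = pos (x + (subEnv ω j []).2) (subEnv ω j) u := by
  induction u with
  | nil => rfl
  | cons i u ih => simp only [List.cons_append, pos, ih]; rfl

lemma visits_append (K : Finset (Site d)) (x : Site d) (ω : Env d) (j : ℕ) :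
    {u | u ++ [j] ∈ visits K x ω} =
      if j < (ω []).1 then visits K (x + (subEnv ω j []).2) (subEnv ω j) else ∅ := by
  ext u
  split_ifs with h <;> simp [visits, inTree_append, pos_append, h]

/-- If the root is in `K` it is the only pioneer; otherwise the pioneers are those of the subtrees
of the children of the root. -/
lemma pioneers_append (K : Finset (Site d)) (x : Site d) (ω : Env d) (j : ℕ) :
    {u | u ++ [j] ∈ pioneers K x ω} = if x ∈ K then ∅ else
      if j < (ω []).1 then pioneers K (x + (subEnv ω j []).2) (subEnv ω j) else ∅ := by
  have hsuf (u : List ℕ) : (∀ v : List ℕ, v <:+ u ++ [j] → v ≠ u ++ [j] → pos x ω v ∉ K) ↔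
      x ∉ K ∧ ∀ v : List ℕ, v <:+ u → v ≠ u →
        pos (x + (subEnv ω j []).2) (subEnv ω j) v ∉ K := by
    constructor
    · intro h
      refine ⟨h [] (List.nil_suffix) (by simp), fun v hv hne => ?_⟩
      rw [← pos_append]
      exact h _ (List.suffix_append_self_iff.2 hv) (by simpa using hne)
    · rintro ⟨hx, h⟩ v hv hne
      rcases List.eq_nil_or_concat v with rfl | ⟨v', i, rfl⟩
      · exact hx
      · obtain ⟨w, hw⟩ := hv
        rw [List.concat_eq_append] at hne ⊢
        rw [List.concat_eq_append, ← List.append_assoc] at hw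
        obtain ⟨h1, h2⟩ := List.append_inj' hw rfl
        obtain rfl : i = j := by simpa using h2
        rw [pos_append]
        exact h v' ⟨w, h1⟩ fun h3 => hne (by rw [h3])
  ext u
  change (InTree ω (u ++ [j]) ∧ pos x ω (u ++ [j]) ∈ K ∧ _) ↔ _
  rw [hsuf, inTree_append, pos_append]
  by_cases h1 : x ∈ K <;> by_cases h2 : j < (ω []).1 <;> simp [pioneers, h1, h2]

lemma occ_eq_tsum (K : Finset (Site d)) (x : Site d) (ω : Env d) :
    occ K x ω = ∑' n, genCount (visits K x ω) n := (tsum_genCount _).symm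

lemma numPioneers_eq_tsum (K : Finset (Site d)) (x : Site d) (ω : Env d) :
    numPioneers K x ω = ∑' n, genCount (pioneers K x ω) n := (tsum_genCount _).symm

lemma tsum_ite_lt (N : ℕ) (f : ℕ → ℝ≥0∞) :
    ∑' j, (if j < N then f j else 0) = ∑ j ∈ Finset.range N, f j := by
  rw [tsum_eq_sum (s := Finset.range N) fun j hj => if_neg (by simpa using hj)]
  exact Finset.sum_congr rfl fun j hj => if_pos (Finset.mem_range.1 hj)

lemma genCount_visits_zero (K : Finset (Site d)) (x : Site d) (ω : Env d) :
    genCount (visits K x ω) 0 = if x ∈ K then 1 else 0 := by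
  classical
  rw [genCount_zero, Set.indicator_apply]
  exact if_congr (by simp [visits, InTree, pos]) rfl rfl

lemma genCount_visits_succ (K : Finset (Site d)) (x : Site d) (ω : Env d) (n : ℕ) :
    genCount (visits K x ω) (n + 1) = ∑ j ∈ Finset.range (ω []).1,
      genCount (visits K (x + (subEnv ω j []).2) (subEnv ω j)) n := by
  rw [genCount_succ, ← tsum_ite_lt]
  refine tsum_congr fun j => ?_
  rw [visits_append]
  split_ifs
  · rfl
  · exact genCount_empty n

lemma genCount_pioneers_zero (K : Finset (Site d)) (x : Site d) (ω : Env d) :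
    genCount (pioneers K x ω) 0 = if x ∈ K then 1 else 0 := by
  classical
  rw [genCount_zero, Set.indicator_apply]
  exact if_congr (by simp +contextual [pioneers, InTree, pos]) rfl rfl

lemma genCount_pioneers_succ (K : Finset (Site d)) (x : Site d) (ω : Env d) (n : ℕ) :
    genCount (pioneers K x ω) (n + 1) = if x ∈ K then 0 else ∑ j ∈ Finset.range (ω []).1,
      genCount (pioneers K (x + (subEnv ω j []).2) (subEnv ω j)) n := by
  rw [genCount_succ]
  split_ifs with hx
  · simp only [pioneers_append, if_pos hx, genCount_empty, tsum_zero]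
  · rw [← tsum_ite_lt]
    refine tsum_congr fun j => ?_
    rw [pioneers_append, if_neg hx]
    split_ifs
    · rfl
    · exact genCount_empty n

lemma occ_eq_add (K : Finset (Site d)) (x : Site d) (ω : Env d) :
    occ K x ω = (if x ∈ K then 1 else 0) + ∑ j ∈ Finset.range (ω []).1,
      occ K (x + (subEnv ω j []).2) (subEnv ω j) := by
  rw [occ_eq_tsum, tsum_eq_zero_add' ENNReal.summable, genCount_visits_zero]
  simp_rw [genCount_visits_succ, occ_eq_tsum]
  rw [Summable.tsum_finsetSum fun _ _ => ENNReal.summable]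

lemma numPioneers_of_mem {K : Finset (Site d)} {x : Site d} (hx : x ∈ K) (ω : Env d) :
    numPioneers K x ω = 1 := by
  rw [numPioneers_eq_tsum, tsum_eq_zero_add' ENNReal.summable, genCount_pioneers_zero, if_pos hx]
  simp [genCount_pioneers_succ, hx]

lemma numPioneers_of_notMem {K : Finset (Site d)} {x : Site d} (hx : x ∉ K) (ω : Env d) :
    numPioneers K x ω = ∑ j ∈ Finset.range (ω []).1,
      numPioneers K (x + (subEnv ω j []).2) (subEnv ω j) := by
  rw [numPioneers_eq_tsum, tsum_eq_zero_add' ENNReal.summable, genCount_pioneers_zero, if_neg hx,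
    zero_add]
  simp_rw [genCount_pioneers_succ, if_neg hx, numPioneers_eq_tsum]
  rw [Summable.tsum_finsetSum fun _ _ => ENNReal.summable]

lemma numPioneers_le_occ (K : Finset (Site d)) (x : Site d) (ω : Env d) :
    numPioneers K x ω ≤ occ K x ω :=
  ENNReal.tsum_le_tsum fun u => Set.indicator_le_indicator_of_subset
    (fun v (hv : v ∈ pioneers K x ω) => (⟨hv.1, hv.2.1⟩ : v ∈ visits K x ω)) (fun _ => zero_le) u

/-- The pioneers are the first visits on each ancestral line, so there is a pioneer as soon as
there is a visit. -/
lemma numPioneers_eq_zero_iff (K : Finset (Site d)) (x : Site d) (ω : Env d) :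
    numPioneers K x ω = 0 ↔ occ K x ω = 0 := by
  refine ⟨fun h => ?_, fun h => le_antisymm (h ▸ numPioneers_le_occ K x ω) zero_le⟩
  have hgen : ∀ n x ω, numPioneers K x ω = 0 → genCount (visits K x ω) n = 0 := by
    intro n
    induction n with
    | zero =>
      intro x ω h
      rw [genCount_visits_zero, if_neg]
      intro hx
      simp [numPioneers_of_mem hx] at h
    | succ n ih =>
      intro x ω h
      by_cases hx : x ∈ K
      · simp [numPioneers_of_mem hx] at h
      · rw [numPioneers_of_notMem hx, Finset.sum_eq_zero_iff] at h
        rw [genCount_visits_succ]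
        exact Finset.sum_eq_zero fun j hj => ih _ _ (h j hj)
  rw [occ_eq_tsum]
  simp [hgen _ x ω h]

/-! ### Measurability of the counts -/

@[fun_prop]
lemma measurable_pos (x : Site d) (u : List ℕ) : Measurable fun ω : Env d => pos x ω u := by
  induction u with
  | nil => exact measurable_const
  | cons j u ih => unfold pos; fun_prop

lemma measurableSet_inTree (u : List ℕ) : MeasurableSet {ω : Env d | InTree ω u} := by
  induction u with
  | nil => simp [InTree]
  | cons j u ih =>
    have h : MeasurableSet {ω : Env d | j < (ω u).1} := measurableSet_lt measurable_const (by fun_prop)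
    exact ih.inter h

lemma measurableSet_pos_mem (K : Finset (Site d)) (x : Site d) (u : List ℕ) :
    MeasurableSet {ω : Env d | pos x ω u ∈ K} :=
  measurable_pos x u (MeasurableSet.of_discrete (s := (K : Set (Site d))))

lemma measurable_occ (K : Finset (Site d)) (x : Site d) : Measurable (occ K x) := by
  refine Measurable.tsum fun u => ?_
  have h : MeasurableSet {ω : Env d | u ∈ visits K x ω} :=
    (measurableSet_inTree u).inter (measurableSet_pos_mem K x u)
  exact (measurable_const (a := (1 : ℝ≥0∞))).indicator h

lemma measurable_numPioneers (K : Finset (Site d)) (x : Site d) : Measurable (numPioneers K x) := by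
  refine Measurable.tsum fun u => ?_
  have h : MeasurableSet {ω : Env d | u ∈ pioneers K x ω} := by
    refine (measurableSet_inTree u).inter ((measurableSet_pos_mem K x u).inter ?_)
    refine MeasurableSet.congr (s := ⋂ v : List ℕ, ⋂ _ : v <:+ u, ⋂ _ : v ≠ u,
      {ω : Env d | pos x ω v ∈ K}ᶜ) ?_ (by ext ω; simp; rfl)
    exact MeasurableSet.iInter fun v => MeasurableSet.iInter fun _ => MeasurableSet.iInter fun _ =>
      (measurableSet_pos_mem K x v).compl
  exact (measurable_const (a := (1 : ℝ≥0∞))).indicator h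

lemma measurable_uncurry_site {α β : Type*} [MeasurableSpace α] [MeasurableSpace β]
    {f : Site d → α → β} (hf : ∀ x, Measurable (f x)) : Measurable fun q : Site d × α => f q.1 q.2 :=
  measurable_from_prod_countable_right hf

@[fun_prop]
lemma Measurable.occ {α : Type*} [MeasurableSpace α] {K : Finset (Site d)} {f : α → Site d}
    {g : α → Env d} (hf : Measurable f) (hg : Measurable g) :
    Measurable fun a => occ K (f a) (g a) :=
  (measurable_uncurry_site (measurable_occ K)).comp (hf.prodMk hg)

@[fun_prop]
lemma Measurable.numPioneers {α : Type*} [MeasurableSpace α] {K : Finset (Site d)} {f : α → Site d}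
    {g : α → Env d} (hf : Measurable f) (hg : Measurable g) :
    Measurable fun a => numPioneers K (f a) (g a) :=
  (measurable_uncurry_site (measurable_numPioneers K)).comp (hf.prodMk hg)

@[fun_prop]
lemma measurable_subEnv : Measurable (subEnv : Env d → ℕ → Env d) := by
  unfold subEnv; fun_prop

/-! ### Product measures -/

section Split

variable {α ι E : Type*} [MeasurableSpace E]

open scoped Classical in
lemma map_split_option (Q : Measure E) [IsProbabilityMeasure Q] :
    (Measure.infinitePi fun _ : Option α => Q).map (fun ω => (ω none, fun a => ω (some a))) =
      Q.prod (Measure.infinitePi fun _ : α => Q) := by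
  let glue : E × (α → E) → Option α → E := fun q o => o.elim q.1 q.2
  have hglue : Measurable glue := measurable_pi_lambda _ fun o => by
    cases o with
    | none => exact measurable_fst
    | some a => exact (measurable_pi_apply a).comp measurable_snd
  have h : (Q.prod (Measure.infinitePi fun _ : α => Q)).map glue =
      Measure.infinitePi fun _ : Option α => Q := by
    refine Measure.eq_infinitePi _ fun s t ht => ?_
    rw [Measure.map_apply hglue (.pi s.countable_toSet fun i _ => ht i)]
    have hpre : glue ⁻¹' Set.pi s t = (if none ∈ s then t none else Set.univ) ×ˢ
        Set.pi (s.eraseNone : Set α) fun a => t (some a) := by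
      ext q
      simp only [Set.mem_preimage, Set.mem_pi, Set.mem_prod, Finset.mem_coe, Finset.mem_eraseNone]
      constructor
      · intro hq
        refine ⟨?_, fun a ha => hq _ ha⟩
        split_ifs with hn
        · exact hq _ hn
        · trivial
      · rintro ⟨h1, h2⟩ (_ | a) ha
        · rwa [if_pos ha] at h1
        · exact h2 a ha
    have hprod : ∏ a ∈ s.eraseNone, Q (t (some a)) = ∏ o ∈ s.erase none, Q (t o) := by
      rw [← Finset.map_some_eraseNone, Finset.prod_map]
      rfl
    rw [hpre, Measure.prod_prod, Measure.infinitePi_pi _ fun a _ => ht _, hprod]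
    split_ifs with hn
    · exact Finset.mul_prod_erase s (fun o => Q (t o)) hn
    · rw [measure_univ, one_mul, Finset.erase_eq_of_notMem hn]
  rw [← h, Measure.map_map (by fun_prop) hglue]
  exact Measure.map_id

/-- In a product measure, one coordinate and a family of other coordinates are independent. -/
lemma map_split (Q : Measure E) [IsProbabilityMeasure Q] {i : ι} {f : α → ι}
    (hf : Function.Injective f) (hi : ∀ a, f a ≠ i) :
    (Measure.infinitePi fun _ : ι => Q).map (fun ω => (ω i, fun a => ω (f a))) =
      Q.prod (Measure.infinitePi fun _ : α => Q) := by
  let e : Option α → ι := fun o => o.elim i f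
  have he : Function.Injective e := by
    rintro (_ | a) (_ | b) h
    · rfl
    · exact absurd h.symm (hi b)
    · exact absurd h (hi a)
    · exact congrArg some (hf h)
  rw [← map_split_option, ← Measure.map_infinitePi_infinitePi_of_inj (P := fun _ : ι => Q) he,
    Measure.map_map (by fun_prop) (by fun_prop)]
  rfl

end Split

/-- The root and the environments of the subtrees of its potential children are independent. -/
lemma map_root_subEnv (p : PMF ℕ) (μ : PMF (Site d)) :
    (envLaw p μ).map (fun ω => (ω [], subEnv ω)) =
      (p.toMeasure.prod μ.toMeasure).prod (Measure.infinitePi fun _ : ℕ => envLaw p μ) := by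
  have h := map_split (p.toMeasure.prod μ.toMeasure) (ι := List ℕ) (i := [])
    (f := fun q : ℕ × List ℕ => q.2 ++ [q.1]) (fun q q' hq => by
      have := List.append_inj' hq rfl
      ext1 <;> simp_all) (by simp)
  have h2 := Measure.infinitePi_map_curry (ι := ℕ) (κ := List ℕ)
    fun _ _ => p.toMeasure.prod μ.toMeasure
  change _ = Measure.infinitePi fun _ => envLaw p μ at h2
  have h3 := Measure.map_prod_map (p.toMeasure.prod μ.toMeasure)
    (Measure.infinitePi fun _ : ℕ × List ℕ => p.toMeasure.prod μ.toMeasure) measurable_id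
    (MeasurableEquiv.curry ℕ (List ℕ) (ℕ × Site d)).measurable
  rw [h2, Measure.map_id, ← h, Measure.map_map (by fun_prop) (by fun_prop)] at h3
  exact h3.symm

/-! ### The law of the branching random walk seen from the children of the root -/

lemma lintegral_pmf {α : Type*} [Countable α] [MeasurableSpace α] [MeasurableSingletonClass α]
    (p : PMF α) (f : α → ℝ≥0∞) : ∫⁻ k, f k ∂p.toMeasure = ∑' k, p k * f k := by
  rw [lintegral_countable']
  refine tsum_congr fun k => ?_
  rw [p.toMeasure_apply_singleton _ (measurableSet_singleton k), mul_comm]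

lemma measurable_comp_nat {α β ι : Type*} [MeasurableSpace α] [MeasurableSpace β]
    [MeasurableSpace ι] [Countable ι] [MeasurableSingletonClass ι] {F : ι → α → β}
    (hF : ∀ n, Measurable (F n)) {N : α → ι} (hN : Measurable N) : Measurable fun a => F (N a) a :=
  (measurable_from_prod_countable_right (f := fun q : ι × α => F q.1 q.2) hF).comp
    (hN.prodMk measurable_id)

@[fun_prop]
lemma measurable_sum_range {α : Type*} [MeasurableSpace α] {f : ℕ → α → ℝ≥0∞}
    (hf : ∀ j, Measurable (f j)) {N : α → ℕ} (hN : Measurable N) :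
    Measurable fun a => ∑ j ∈ Finset.range (N a), f j a :=
  measurable_comp_nat (F := fun n a => ∑ j ∈ Finset.range n, f j a)
    (fun _ => Finset.measurable_sum _ fun j _ => hf j) hN

@[fun_prop]
lemma measurable_prod_range {α : Type*} [MeasurableSpace α] {f : ℕ → α → ℝ≥0∞}
    (hf : ∀ j, Measurable (f j)) {N : α → ℕ} (hN : Measurable N) :
    Measurable fun a => ∏ j ∈ Finset.range (N a), f j a :=
  measurable_comp_nat (F := fun n a => ∏ j ∈ Finset.range n, f j a)
    (fun _ => Finset.measurable_prod _ fun j _ => hf j) hN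

lemma lintegral_split {α ι E : Type*} [MeasurableSpace E] (Q : Measure E) [IsProbabilityMeasure Q]
    {i : ι} {f : α → ι} (hf : Function.Injective f) (hi : ∀ a, f a ≠ i)
    {F : E × (α → E) → ℝ≥0∞} (hF : Measurable F) :
    ∫⁻ ω, F (ω i, fun a => ω (f a)) ∂(Measure.infinitePi fun _ : ι => Q) =
      ∫⁻ c, ∫⁻ s, F (c, s) ∂(Measure.infinitePi fun _ : α => Q) ∂Q := by
  rw [← lintegral_prod _ hF.aemeasurable, ← map_split Q hf hi, lintegral_map hF (by fun_prop)]

/-- The enumeration of `ℕ` without `n`. -/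
def skipIdx (n m : ℕ) : ℕ := if m < n then m else m + 1

lemma skipIdx_of_lt {n m : ℕ} (h : m < n) : skipIdx n m = m := if_pos h

lemma skipIdx_injective (n : ℕ) : Function.Injective (skipIdx n) := by
  intro a b h
  unfold skipIdx at h
  split_ifs at h <;> omega

lemma skipIdx_ne (n m : ℕ) : skipIdx n m ≠ n := by
  unfold skipIdx
  split_ifs <;> omega

lemma sum_range_eq_add_skipIdx (c : ℕ → ℝ≥0∞) (j r : ℕ) :
    ∑ i ∈ Finset.range (j + r + 1), c i =
      c j + ∑ m ∈ Finset.range (j + r), c (skipIdx j m) := by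
  rw [add_assoc, Finset.sum_range_add, Finset.sum_range_succ', Finset.sum_range_add]
  have h1 : ∑ m ∈ Finset.range j, c (skipIdx j m) = ∑ m ∈ Finset.range j, c m :=
    Finset.sum_congr rfl fun m hm => by rw [skipIdx_of_lt (Finset.mem_range.1 hm)]
  have h2 : ∑ m ∈ Finset.range r, c (skipIdx j (j + m)) =
      ∑ m ∈ Finset.range r, c (j + (m + 1)) :=
    Finset.sum_congr rfl fun m _ => by rw [skipIdx, if_neg (by omega), add_assoc]
  rw [h1, h2, add_zero]
  ring

/-- The environment of a child, with its jump recorded at its root. -/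
def reroot (c : Site d × Env d) : Env d := Function.update c.2 [] ((c.2 []).1, c.1)

@[simp]
lemma reroot_nil (c : Site d × Env d) : reroot c [] = ((c.2 []).1, c.1) := Function.update_self ..

@[simp]
lemma subEnv_reroot (c : Site d × Env d) : subEnv (reroot c) = subEnv c.2 := by
  funext j u
  exact Function.update_of_ne (by simp) _ _

lemma measurable_reroot : Measurable (reroot : Site d × Env d → Env d) := by
  refine measurable_pi_lambda _ fun u => ?_
  by_cases hu : u = []
  · subst hu
    simp only [reroot_nil]
    fun_prop
  · have : (fun c : Site d × Env d => reroot c u) = fun c => c.2 u :=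
      funext fun c => Function.update_of_ne hu _ _
    rw [this]
    fun_prop

/-- The environment with given root and given subtrees. -/
def graft (q : (ℕ × Site d) × (ℕ → Env d)) : Env d := fun u =>
  (wordEquiv.symm u).elim q.1 fun v => q.2 v.1 v.2

lemma graft_nil (q : (ℕ × Site d) × (ℕ → Env d)) : graft q [] = q.1 := by
  have : wordEquiv.symm [] = none := wordEquiv.symm_apply_eq.2 rfl
  simp [graft, this]

lemma graft_append (q : (ℕ × Site d) × (ℕ → Env d)) (u : List ℕ) (j : ℕ) :
    graft q (u ++ [j]) = q.2 j u := by
  have : wordEquiv.symm (u ++ [j]) = some (j, u) := wordEquiv.symm_apply_eq.2 rfl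
  simp [graft, this]

lemma measurable_graft : Measurable (graft : (ℕ × Site d) × (ℕ → Env d) → Env d) := by
  refine measurable_pi_lambda _ fun u => ?_
  unfold graft
  cases wordEquiv.symm u with
  | none => exact measurable_fst
  | some v => simp only [Option.elim]; fun_prop

lemma graft_subEnv (ω : Env d) : graft (ω [], subEnv ω) = ω := by
  funext u
  rcases List.eq_nil_or_concat u with rfl | ⟨v, j, rfl⟩
  · exact graft_nil _
  · rw [List.concat_eq_append, graft_append]
    rfl

lemma lintegral_envLaw_graft (p : PMF ℕ) (μ : PMF (Site d)) {f : Env d → ℝ≥0∞}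
    (hf : Measurable f) :
    ∫⁻ ω, f ω ∂(envLaw p μ) = ∑' k, p k * ∫⁻ z, ∫⁻ e, f (graft ((k, z), e))
      ∂(Measure.infinitePi fun _ : ℕ => envLaw p μ) ∂μ.toMeasure := by
  have hg : Measurable fun q : (ℕ × Site d) × (ℕ → Env d) => f (graft q) :=
    hf.comp measurable_graft
  calc ∫⁻ ω, f ω ∂(envLaw p μ) = ∫⁻ ω, f (graft (ω [], subEnv ω)) ∂(envLaw p μ) := by
        simp only [graft_subEnv]
    _ = _ := by
        rw [← lintegral_map (f := fun q => f (graft q)) hg (by fun_prop), map_root_subEnv,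
          lintegral_prod _ hg.aemeasurable, lintegral_prod _ hg.lintegral_prod_right'.aemeasurable,
          lintegral_pmf]

/-- The environment of a subtree has the same law as the environment of the whole tree, once the
unused jump of the root is replaced by an independent one. -/
lemma map_reroot (p : PMF ℕ) (μ : PMF (Site d)) :
    (μ.toMeasure.prod (envLaw p μ)).map reroot = envLaw p μ := by
  refine Measure.ext_of_lintegral _ fun f hf => ?_
  have h : ∀ (z : Site d) (ω : Env d), f (reroot (z, ω)) = f (graft (((ω []).1, z), subEnv ω)) := by
    intro z ω
    congr 1
    conv_lhs => rw [← graft_subEnv (reroot (z, ω))]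
    simp
  have hfm : Measurable fun c : Site d × Env d => f (reroot c) := hf.comp measurable_reroot
  rw [lintegral_map hf measurable_reroot, lintegral_prod _ hfm.aemeasurable,
    lintegral_envLaw_graft p μ hf]
  simp_rw [h]
  -- after the replacement, the original jump of the root no longer appears
  have h2 : ∀ z : Site d, ∫⁻ ω, f (graft (((ω []).1, z), subEnv ω)) ∂(envLaw p μ) =
      ∑' k, p k * ∫⁻ e, f (graft ((k, z), e)) ∂(Measure.infinitePi fun _ : ℕ => envLaw p μ) := by
    intro z
    have hm : Measurable fun ω : Env d => f (graft (((ω []).1, z), subEnv ω)) :=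
      hf.comp (measurable_graft.comp (by fun_prop))
    rw [lintegral_envLaw_graft p μ hm]
    refine tsum_congr fun k => ?_
    have h3 : ∀ (y : Site d) (e : ℕ → Env d), subEnv (graft ((k, y), e)) = e := fun y e => by
      funext j u
      exact graft_append _ _ _
    simp only [graft_nil, h3, lintegral_const, measure_univ, mul_one]
  simp_rw [h2]
  have hm (k : ℕ) : Measurable fun z : Site d => ∫⁻ e, f (graft ((k, z), e))
      ∂(Measure.infinitePi fun _ : ℕ => envLaw p μ) := .of_discrete
  rw [lintegral_tsum fun k => ((hm k).const_mul _).aemeasurable]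
  exact tsum_congr fun k => lintegral_const_mul _ (hm k)

/-- The branching property: the root has `k` children with probability `p k`, whose jumps and
environments are independent. -/
lemma lintegral_envLaw (p : PMF ℕ) (μ : PMF (Site d)) {F : ℕ → (ℕ → Env d) → ℝ≥0∞}
    (hF : ∀ k, Measurable (F k)) :
    ∫⁻ ω, F (ω []).1 (subEnv ω) ∂(envLaw p μ) = ∑' k, p k * ∫⁻ a, F k (fun j => reroot (a j))
      ∂(Measure.infinitePi fun _ : ℕ => μ.toMeasure.prod (envLaw p μ)) := by
  rw [lintegral_envLaw_graft p μ (measurable_comp_nat (F := fun k ω => F k (subEnv ω))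
    (fun k => (hF k).comp measurable_subEnv) (by fun_prop))]
  refine tsum_congr fun k => ?_
  have h3 : ∀ (y : Site d) (e : ℕ → Env d), subEnv (graft ((k, y), e)) = e := fun y e => by
    funext j u
    exact graft_append _ _ _
  simp only [graft_nil, h3, lintegral_const, measure_univ, mul_one]
  have h4 := Measure.infinitePi_map_pi (ι := ℕ) (fun _ => μ.toMeasure.prod (envLaw p μ))
    (f := fun _ => reroot) fun _ => measurable_reroot
  simp only [map_reroot] at h4
  have hm : Measurable fun (a : ℕ → Site d × Env d) j => reroot (a j) :=
    measurable_pi_lambda _ fun j => measurable_reroot.comp (measurable_pi_apply j)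
  rw [← h4, lintegral_map (hF k) hm]

lemma occ_reroot (K : Finset (Site d)) (x : Site d) (c : Site d × Env d) :
    occ K x (reroot c) = occ K x c.2 := by
  rw [occ_eq_add, occ_eq_add K x c.2]
  simp

lemma numPioneers_reroot (K : Finset (Site d)) (x : Site d) (c : Site d × Env d) :
    numPioneers K x (reroot c) = numPioneers K x c.2 := by
  by_cases hx : x ∈ K
  · rw [numPioneers_of_mem hx, numPioneers_of_mem hx]
  · rw [numPioneers_of_notMem hx, numPioneers_of_notMem hx]
    simp

/-! ### First moments -/

lemma measurable_genCount_visits (K : Finset (Site d)) (x : Site d) (n : ℕ) :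
    Measurable fun ω => genCount (visits K x ω) n := by
  refine Measurable.tsum fun u => ?_
  have h : MeasurableSet {ω : Env d | u ∈ visits K x ω} :=
    (measurableSet_inTree u).inter (measurableSet_pos_mem K x u)
  by_cases hu : u.length = n
  · simp only [if_pos hu]
    exact (measurable_const (a := (1 : ℝ≥0∞))).indicator h
  · simp only [if_neg hu]
    exact measurable_const

lemma genCount_visits_reroot (K : Finset (Site d)) (x : Site d) (c : Site d × Env d) (n : ℕ) :
    genCount (visits K x (reroot c)) n = genCount (visits K x c.2) n := by
  cases n with
  | zero => rw [genCount_visits_zero, genCount_visits_zero]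
  | succ n => rw [genCount_visits_succ, genCount_visits_succ]; simp

lemma lintegral_eval_kids {E : Type*} [MeasurableSpace E] (Q : Measure E) [IsProbabilityMeasure Q]
    {f : E → ℝ≥0∞} (hf : Measurable f) (j : ℕ) :
    ∫⁻ a, f (a j) ∂(Measure.infinitePi fun _ : ℕ => Q) = ∫⁻ c, f c ∂Q := by
  have h := lintegral_map (μ := Measure.infinitePi fun _ : ℕ => Q) hf (measurable_pi_apply j)
  rw [Measure.infinitePi_map_eval (fun _ : ℕ => Q) j] at h
  exact h.symm

lemma lintegral_kid (p : PMF ℕ) (μ : PMF (Site d)) {f : Site d × Env d → ℝ≥0∞}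
    (hf : Measurable f) : ∫⁻ c, f c ∂(μ.toMeasure.prod (envLaw p μ)) =
      ∑' z, μ z * ∫⁻ ω, f (z, ω) ∂(envLaw p μ) := by
  rw [lintegral_prod _ hf.aemeasurable, lintegral_pmf]

/-- The expected number of visits to `K` in generation `n`. -/
lemma lintegral_genCount_visits (p : PMF ℕ) (hp : offspringMean p = 1) (μ : PMF (Site d))
    (K : Finset (Site d)) (n : ℕ) (x : Site d) :
    ∫⁻ ω, genCount (visits K x ω) n ∂(envLaw p μ) = ∑ y ∈ K, convPow μ n (y - x) := by
  induction n generalizing x with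
  | zero =>
    simp only [genCount_visits_zero, lintegral_const, measure_univ, mul_one, convPow,
      Pi.single_apply, sub_eq_zero]
    rw [Finset.sum_ite_eq' K x]
  | succ n ih =>
    have hm : Measurable fun ω : Env d => genCount (visits K (x + (ω []).2) ω) n :=
      measurable_comp_nat (F := fun z ω => genCount (visits K (x + z) ω) n)
        (fun z => measurable_genCount_visits K (x + z) n) (by fun_prop)
    have hm2 : Measurable fun c : Site d × Env d => genCount (visits K (x + c.1) c.2) n :=
      measurable_uncurry_site (f := fun z ω => genCount (visits K (x + z) ω) n)
        fun z => measurable_genCount_visits K (x + z) n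
    simp_rw [genCount_visits_succ]
    rw [lintegral_envLaw p μ (F := fun k e => ∑ j ∈ Finset.range k,
      genCount (visits K (x + (e j []).2) (e j)) n) fun k => Finset.measurable_sum _ fun j _ =>
        hm.comp (measurable_pi_apply j)]
    simp only [reroot_nil, genCount_visits_reroot]
    have h1 : ∀ k, ∫⁻ a : ℕ → Site d × Env d, ∑ j ∈ Finset.range k,
        genCount (visits K (x + (a j).1) (a j).2) n
          ∂(Measure.infinitePi fun _ : ℕ => μ.toMeasure.prod (envLaw p μ)) =
        k * ∑ y ∈ K, convPow μ (n + 1) (y - x) := fun k => by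
      have hm3 (j : ℕ) : Measurable fun a : ℕ → Site d × Env d =>
        genCount (visits K (x + (a j).1) (a j).2) n := hm2.comp (measurable_pi_apply j)
      rw [lintegral_finsetSum _ fun j _ => hm3 j]
      rw [Finset.sum_congr rfl fun j _ => lintegral_eval_kids _ hm2 j, Finset.sum_const,
        Finset.card_range, nsmul_eq_mul, lintegral_kid p μ hm2]
      simp_rw [ih]
      congr 1
      simp_rw [Finset.mul_sum]
      rw [Summable.tsum_finsetSum fun _ _ => ENNReal.summable]
      refine Finset.sum_congr rfl fun y _ => ?_
      rw [convPow, latticeConv]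
      exact tsum_congr fun z => by rw [sub_add_eq_sub_sub]
    simp_rw [h1, ← mul_assoc]
    rw [ENNReal.tsum_mul_right]
    simp_rw [mul_comm (p _)]
    rw [← offspringMean, hp, one_mul]

/-- The expected occupation time of `K`. -/
lemma lintegral_occ (p : PMF ℕ) (hp : offspringMean p = 1) (μ : PMF (Site d))
    (K : Finset (Site d)) (x : Site d) :
    ∫⁻ ω, occ K x ω ∂(envLaw p μ) = ∑ y ∈ K, green μ (y - x) := by
  simp_rw [occ_eq_tsum]
  rw [lintegral_tsum fun n => (measurable_genCount_visits K x n).aemeasurable]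
  simp_rw [lintegral_genCount_visits p hp μ K]
  rw [Summable.tsum_finsetSum fun _ _ => ENNReal.summable]
  rfl

/-- The expected occupation time of `K` by the descendants of a child of `x`. -/
lemma lintegral_kid_occ_le (p : PMF ℕ) (hp : offspringMean p = 1) (μ : PMF (Site d))
    (K : Finset (Site d)) (x : Site d) :
    ∫⁻ c, occ K (x + c.1) c.2 ∂(μ.toMeasure.prod (envLaw p μ)) ≤ ∑ y ∈ K, green μ (y - x) := by
  rw [lintegral_kid p μ (by fun_prop)]
  simp_rw [lintegral_occ p hp μ K, Finset.mul_sum]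
  rw [Summable.tsum_finsetSum fun _ _ => ENNReal.summable]
  refine Finset.sum_le_sum fun y _ => ?_
  calc _ = latticeConv μ (green μ) (y - x) := tsum_congr fun z => by rw [sub_add_eq_sub_sub]
    _ ≤ green μ (y - x) := by
      conv_rhs => rw [green_eq_add]
      exact le_add_self

/-! ### The spine decomposition of the branching random walk -/

/-- The law of the jumps and of the environments of an infinite sequence of children. -/
abbrev kidsLaw (p : PMF ℕ) (μ : PMF (Site d)) : Measure (ℕ → Site d × Env d) :=
  Measure.infinitePi fun _ : ℕ => μ.toMeasure.prod (envLaw p μ)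

/-- Summing over a number `k` of children and one of them, `j < k`, is summing over its numbers `j`
of left and `k - j - 1` of right siblings. -/
lemma tsum_sum_range (T : ℕ → ℕ → ℝ≥0∞) :
    ∑' k, ∑ j ∈ Finset.range k, T k j = ∑' q : ℕ × ℕ, T (q.1 + q.2 + 1) q.1 := by
  have h (j : ℕ) : ∑' k, (if j < k then T k j else 0) = ∑' r, T (j + r + 1) j := by
    have hinj : Function.Injective fun r => j + r + 1 := fun a b hab => by simpa using hab
    rw [← hinj.tsum_eq]
    · exact tsum_congr fun r => if_pos (by omega)
    · intro k hk
      have hjk : j < k := by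
        by_contra hjk
        simp [hjk] at hk
      exact ⟨k - j - 1, by change j + (k - j - 1) + 1 = k; omega⟩
  rw [ENNReal.tsum_prod', ← tsum_congr h, ENNReal.tsum_comm]
  exact tsum_congr fun k => (tsum_ite_lt k fun j => T k j).symm

/-- Singling out one of the children of the root. The child with `i` left and `j` right siblings
is present with probability `p (i + j + 1)`. -/
lemma lintegral_children {E : Type*} [MeasurableSpace E] (Q : Measure E) [IsProbabilityMeasure Q]
    (p : PMF ℕ) {P G N Z : E → ℝ≥0∞} (hP : Measurable P) (hG : Measurable G) (hN : Measurable N)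
    (hZ : Measurable Z) {Φ : ℝ≥0∞ × ℝ≥0∞ → ℝ≥0∞} (hΦ : Measurable Φ) (a b : ℝ≥0∞) :
    ∑' k, p k * ∫⁻ c, (∑ j ∈ Finset.range k, (∏ i ∈ Finset.range j, P (c i)) * G (c j)) *
        Φ (a + ∑ i ∈ Finset.range k, N (c i), b + ∑ i ∈ Finset.range k, Z (c i))
        ∂(Measure.infinitePi fun _ : ℕ => Q) =
      ∑' q : ℕ × ℕ, p (q.1 + q.2 + 1) * ∫⁻ c, (∏ i ∈ Finset.range q.1, P (c i)) *
        ∫⁻ e, G e * Φ (a + ∑ i ∈ Finset.range (q.1 + q.2), N (c i) + N e,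
          b + ∑ i ∈ Finset.range (q.1 + q.2), Z (c i) + Z e) ∂Q
        ∂(Measure.infinitePi fun _ : ℕ => Q) := by
  have hm (k j : ℕ) : Measurable fun c : ℕ → E => (∏ i ∈ Finset.range j, P (c i)) * G (c j) *
      Φ (a + ∑ i ∈ Finset.range k, N (c i), b + ∑ i ∈ Finset.range k, Z (c i)) := by
    refine Measurable.mul (by fun_prop) (hΦ.comp ?_)
    fun_prop
  simp_rw [Finset.sum_mul]
  rw [tsum_congr fun k => by rw [lintegral_finsetSum _ fun j _ => hm k j, Finset.mul_sum],
    tsum_sum_range fun k j => p k * ∫⁻ c, (∏ i ∈ Finset.range j, P (c i)) * G (c j) *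
      Φ (a + ∑ i ∈ Finset.range k, N (c i), b + ∑ i ∈ Finset.range k, Z (c i))
      ∂(Measure.infinitePi fun _ : ℕ => Q)]
  refine tsum_congr fun q => ?_
  congr 1
  have hF : Measurable fun s : E × (ℕ → E) => (∏ i ∈ Finset.range q.1, P (s.2 i)) * (G s.1 *
      Φ (a + ∑ i ∈ Finset.range (q.1 + q.2), N (s.2 i) + N s.1,
        b + ∑ i ∈ Finset.range (q.1 + q.2), Z (s.2 i) + Z s.1)) := by
    refine Measurable.mul (by fun_prop) (Measurable.mul (by fun_prop) (hΦ.comp ?_))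
    fun_prop
  -- the child `q.1` is separated from its siblings, which are renumbered by `skipIdx`
  calc _ = ∫⁻ c, (∏ i ∈ Finset.range q.1, P (c (skipIdx q.1 i))) * (G (c q.1) *
        Φ (a + ∑ i ∈ Finset.range (q.1 + q.2), N (c (skipIdx q.1 i)) + N (c q.1),
          b + ∑ i ∈ Finset.range (q.1 + q.2), Z (c (skipIdx q.1 i)) + Z (c q.1)))
        ∂(Measure.infinitePi fun _ : ℕ => Q) := by
        refine lintegral_congr fun c => ?_
        rw [sum_range_eq_add_skipIdx (fun i => N (c i)), sum_range_eq_add_skipIdx (fun i => Z (c i)),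
          mul_assoc, Finset.prod_congr rfl (g := fun i => P (c (skipIdx q.1 i))) fun i hi => by
            rw [skipIdx_of_lt (Finset.mem_range.1 hi)], add_comm (N (c q.1)),
          add_comm (Z (c q.1)), add_assoc a, add_assoc b]
    _ = _ := by
        have h := lintegral_split Q (skipIdx_injective q.1) (skipIdx_ne q.1) hF
        refine h.trans ?_
        rw [lintegral_lintegral_swap hF.aemeasurable]
        refine lintegral_congr fun c => ?_
        have hΨ : Measurable fun e => G e * Φ (a + ∑ i ∈ Finset.range (q.1 + q.2), N (c i) + N e,
            b + ∑ i ∈ Finset.range (q.1 + q.2), Z (c i) + Z e) := hG.mul (hΦ.comp (by fun_prop))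
        exact lintegral_const_mul (∏ i ∈ Finset.range q.1, P (c i)) hΨ

/-- The pioneers in generation `n`, where a pioneer is weighted by the product of `κ` of the
numbers of pioneers in the subtrees attached on the left of its ancestral line. -/
def genWeight (κ : ℝ≥0∞ → ℝ≥0∞) (K : Finset (Site d)) : ℕ → Site d → Env d → ℝ≥0∞
  | 0, x, _ => if x ∈ K then 1 else 0
  | n + 1, x, ω => if x ∈ K then 0 else ∑ j ∈ Finset.range (ω []).1,
      (∏ i ∈ Finset.range j, κ (numPioneers K (x + (subEnv ω i []).2) (subEnv ω i))) *
        genWeight κ K n (x + (subEnv ω j []).2) (subEnv ω j)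

lemma genWeight_reroot (κ : ℝ≥0∞ → ℝ≥0∞) (K : Finset (Site d)) (n : ℕ) (x : Site d)
    (c : Site d × Env d) : genWeight κ K n x (reroot c) = genWeight κ K n x c.2 := by
  cases n <;> simp [genWeight]

lemma measurable_genWeight {κ : ℝ≥0∞ → ℝ≥0∞} (hκ : Measurable κ) (K : Finset (Site d)) (n : ℕ)
    (x : Site d) : Measurable (genWeight κ K n x) := by
  induction n generalizing x with
  | zero => exact measurable_const
  | succ n ih =>
    change Measurable fun ω => genWeight κ K (n + 1) x ω
    by_cases hx : x ∈ K
    · simp only [genWeight, if_pos hx]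
      exact measurable_const
    · simp only [genWeight, if_neg hx]
      have h : Measurable fun q : Site d × Env d => genWeight κ K n q.1 q.2 :=
        measurable_uncurry_site ih
      refine measurable_sum_range (fun j => Measurable.mul ?_ ?_) (by fun_prop)
      · exact Finset.measurable_prod _ fun i _ => hκ.comp (by fun_prop)
      · exact h.comp (f := fun ω : Env d => (x + (subEnv ω j []).2, subEnv ω j)) (by fun_prop)

/-- With `κ = 1`, all the pioneers of generation `n` are counted. -/
lemma genWeight_one (K : Finset (Site d)) (n : ℕ) (x : Site d) (ω : Env d) :
    genWeight (fun _ => 1) K n x ω = genCount (pioneers K x ω) n := by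
  induction n generalizing x ω with
  | zero => rw [genCount_pioneers_zero]; rfl
  | succ n ih => rw [genCount_pioneers_succ]; simp [genWeight, ih]

/-- The pioneers in the subtrees of the siblings of a spine vertex whose parent is at `z`. -/
def stepPioneers (K : Finset (Site d)) (z : Site d) (s : Step d) : ℝ≥0∞ :=
  ∑ j ∈ Finset.range (s.2.1.1 + s.2.1.2), numPioneers K (z + (s.2.2 j).1) (s.2.2 j).2

/-- The occupation time of the subtrees of the siblings of a spine vertex whose parent is at
`z`. -/
def stepOcc (K : Finset (Site d)) (z : Site d) (s : Step d) : ℝ≥0∞ :=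
  ∑ j ∈ Finset.range (s.2.1.1 + s.2.1.2), occ K (z + (s.2.2 j).1) (s.2.2 j).2

/-- The product of `κ` of the numbers of pioneers in the subtrees of the left siblings. -/
def stepWeight (κ : ℝ≥0∞ → ℝ≥0∞) (K : Finset (Site d)) (z : Site d) (s : Step d) : ℝ≥0∞ :=
  ∏ j ∈ Finset.range s.2.1.1, κ (numPioneers K (z + (s.2.2 j).1) (s.2.2 j).2)

lemma measurable_stepPioneers (K : Finset (Site d)) :
    Measurable fun q : Site d × Step d => stepPioneers K q.1 q.2 :=
  measurable_sum_range (fun j => by fun_prop) (by fun_prop)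

lemma measurable_stepOcc (K : Finset (Site d)) :
    Measurable fun q : Site d × Step d => stepOcc K q.1 q.2 :=
  measurable_sum_range (fun j => by fun_prop) (by fun_prop)

lemma measurable_stepWeight {κ : ℝ≥0∞ → ℝ≥0∞} (hκ : Measurable κ) (K : Finset (Site d)) :
    Measurable fun q : Site d × Step d => stepWeight κ K q.1 q.2 :=
  measurable_prod_range (fun j => hκ.comp (by fun_prop)) (by fun_prop)

@[fun_prop]
lemma Measurable.stepPioneers {α : Type*} [MeasurableSpace α] {K : Finset (Site d)}
    {f : α → Site d} {g : α → Step d} (hf : Measurable f) (hg : Measurable g) :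
    Measurable fun a => stepPioneers K (f a) (g a) :=
  (measurable_stepPioneers K).comp (f := fun a => (f a, g a)) (hf.prodMk hg)

@[fun_prop]
lemma Measurable.stepOcc {α : Type*} [MeasurableSpace α] {K : Finset (Site d)}
    {f : α → Site d} {g : α → Step d} (hf : Measurable f) (hg : Measurable g) :
    Measurable fun a => stepOcc K (f a) (g a) :=
  (measurable_stepOcc K).comp (f := fun a => (f a, g a)) (hf.prodMk hg)

lemma lintegral_stepLaw (p : PMF ℕ) (hp : offspringMean p = 1) (μ : PMF (Site d))
    {F : Step d → ℝ≥0∞} (hF : Measurable F) :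
    ∫⁻ s, F s ∂(stepLaw p hp μ) = ∑' z, μ z * ∑' q : ℕ × ℕ, p (q.1 + q.2 + 1) *
      ∫⁻ e, F (-z, q, e) ∂(kidsLaw p μ) := by
  rw [stepLaw, lintegral_prod _ hF.aemeasurable, ← PMF.toMeasure_map _ _ (by fun_prop),
    lintegral_map hF.lintegral_prod_right' (by fun_prop), lintegral_pmf]
  refine tsum_congr fun z => ?_
  rw [lintegral_prod _ (by fun_prop), lintegral_pmf]
  rfl

lemma lintegral_stepLaw' (p : PMF ℕ) (hp : offspringMean p = 1) (μ : PMF (Site d))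
    {F : Step d → ℝ≥0∞} (hF : Measurable F) :
    ∫⁻ s, F s ∂(stepLaw p hp μ) = ∑' q : ℕ × ℕ, p (q.1 + q.2 + 1) *
      ∫⁻ e, ∑' z, μ z * F (-z, q, e) ∂(kidsLaw p μ) := by
  have hm (z : Site d) (q : ℕ × ℕ) : Measurable fun e => F (-z, q, e) := hF.comp (by fun_prop)
  rw [lintegral_stepLaw p hp μ hF]
  simp_rw [← ENNReal.tsum_mul_left]
  rw [ENNReal.tsum_comm]
  refine tsum_congr fun q => ?_
  rw [lintegral_tsum fun z => ((hm z q).const_mul _).aemeasurable, ← ENNReal.tsum_mul_left]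
  exact tsum_congr fun z => by rw [lintegral_const_mul _ (hm z q), mul_left_comm]

/-- First step of the branching random walk along the ancestral line of a pioneer. -/
lemma lintegral_genWeight_succ (p : PMF ℕ) (hp : offspringMean p = 1) (μ : PMF (Site d))
    {κ : ℝ≥0∞ → ℝ≥0∞} (hκ : Measurable κ) {Φ : ℝ≥0∞ × ℝ≥0∞ → ℝ≥0∞} (hΦ : Measurable Φ)
    {K : Finset (Site d)} {x : Site d} (hx : x ∉ K) (n : ℕ) (a b : ℝ≥0∞) :
    ∫⁻ ω, genWeight κ K (n + 1) x ω * Φ (a + numPioneers K x ω, b + occ K x ω) ∂(envLaw p μ) =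
      ∫⁻ s, stepWeight κ K x s * ∫⁻ ω, genWeight κ K n (x - s.1) ω *
        Φ (a + stepPioneers K x s + numPioneers K (x - s.1) ω,
          b + stepOcc K x s + occ K (x - s.1) ω) ∂(envLaw p μ) ∂(stepLaw p hp μ) := by
  have hgw : Measurable fun q : Site d × Env d => genWeight κ K n q.1 q.2 :=
    measurable_uncurry_site (measurable_genWeight hκ K n)
  have hF (k : ℕ) : Measurable fun e : ℕ → Env d => (∑ j ∈ Finset.range k,
      (∏ i ∈ Finset.range j, κ (numPioneers K (x + (e i []).2) (e i))) *
        genWeight κ K n (x + (e j []).2) (e j)) *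
      Φ (a + ∑ j ∈ Finset.range k, numPioneers K (x + (e j []).2) (e j),
        b + ∑ j ∈ Finset.range k, occ K (x + (e j []).2) (e j)) := by
    refine Measurable.mul (Finset.measurable_sum _ fun j _ => Measurable.mul ?_ ?_) (hΦ.comp ?_)
    · exact Finset.measurable_prod _ fun i _ => hκ.comp (by fun_prop)
    · exact hgw.comp (f := fun e : ℕ → Env d => (x + (e j []).2, e j)) (by fun_prop)
    · fun_prop
  have h1 := lintegral_envLaw p μ hF
  simp only [reroot_nil, genWeight_reroot, numPioneers_reroot, occ_reroot] at h1
  simp_rw [genWeight, if_neg hx, numPioneers_of_notMem hx, occ_eq_add K x, if_neg hx, zero_add]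
  have hN : Measurable fun c : Site d × Env d => numPioneers K (x + c.1) c.2 := by fun_prop
  have hZ : Measurable fun c : Site d × Env d => occ K (x + c.1) c.2 := by fun_prop
  have hG : Measurable fun c : Site d × Env d => genWeight κ K n (x + c.1) c.2 :=
    hgw.comp (f := fun c : Site d × Env d => (x + c.1, c.2)) (by fun_prop)
  have hP : Measurable fun c : Site d × Env d => κ (numPioneers K (x + c.1) c.2) := hκ.comp hN
  rw [h1, lintegral_children (μ.toMeasure.prod (envLaw p μ)) p hP hG hN hZ hΦ a b,
    lintegral_stepLaw']
  · refine tsum_congr fun q => ?_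
    congr 1
    refine lintegral_congr fun c => ?_
    have hΨ : Measurable fun e : Site d × Env d => genWeight κ K n (x + e.1) e.2 *
        Φ (a + ∑ i ∈ Finset.range (q.1 + q.2), numPioneers K (x + (c i).1) (c i).2 +
            numPioneers K (x + e.1) e.2,
          b + ∑ i ∈ Finset.range (q.1 + q.2), occ K (x + (c i).1) (c i).2 +
            occ K (x + e.1) e.2) := hG.mul (hΦ.comp (by fun_prop))
    rw [lintegral_kid p μ hΨ, ← ENNReal.tsum_mul_left]
    refine tsum_congr fun z => ?_
    rw [mul_left_comm, sub_neg_eq_add]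
    rfl
  · refine Measurable.mul ((measurable_stepWeight hκ K).comp (f := fun s => (x, s)) (by fun_prop)) ?_
    refine Measurable.lintegral_prod_right' (f := fun q : Step d × Env d =>
      genWeight κ K n (x - q.1.1) q.2 * Φ (a + stepPioneers K x q.1 + numPioneers K (x - q.1.1) q.2,
        b + stepOcc K x q.1 + occ K (x - q.1.1) q.2)) (Measurable.mul ?_ (hΦ.comp ?_))
    · exact hgw.comp (f := fun q : Step d × Env d => (x - q.1.1, q.2)) (by fun_prop)
    · fun_prop

/-- The spine without the step of index `n`. -/
def dropStep (n : ℕ) (b : Spine d) : Spine d := (fun m => b.1 (skipIdx n m), b.2)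

@[fun_prop]
lemma measurable_dropStep (n : ℕ) : Measurable (dropStep n : Spine d → Spine d) := by
  unfold dropStep; fun_prop

lemma dropStep_fst_of_lt {n k : ℕ} (h : k < n) (b : Spine d) : (dropStep n b).1 k = b.1 k := by
  simp [dropStep, skipIdx_of_lt h]

lemma spinePos_dropStep {n k : ℕ} (h : k ≤ n) (y : Site d) (b : Spine d) :
    spinePos y (dropStep n b) k = spinePos y b k := by
  unfold spinePos
  congr 1
  exact Finset.sum_congr rfl fun i hi => by
    rw [dropStep_fst_of_lt ((Finset.mem_range.1 hi).trans_le h)]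

lemma spinePos_zero (y : Site d) (b : Spine d) : spinePos y b 0 = y := by simp [spinePos]

lemma spinePos_succ (y : Site d) (b : Spine d) (n : ℕ) :
    spinePos y b (n + 1) = spinePos y b n + (b.1 n).1 := by
  simp [spinePos, Finset.sum_range_succ, add_assoc]

@[fun_prop]
lemma measurable_spinePos (y : Site d) (n : ℕ) : Measurable fun b : Spine d => spinePos y b n := by
  unfold spinePos; fun_prop

/-- Each step of the spine is independent of the rest. -/
lemma lintegral_spineLaw (p : PMF ℕ) (hp : offspringMean p = 1) (μ : PMF (Site d)) (n : ℕ)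
    {F : Step d × Spine d → ℝ≥0∞} (hF : Measurable F) :
    ∫⁻ b, F (b.1 n, dropStep n b) ∂(spineLaw p hp μ) =
      ∫⁻ s, ∫⁻ b, F (s, b) ∂(spineLaw p hp μ) ∂(stepLaw p hp μ) := by
  have h1 : Measurable fun b : Spine d => F (b.1 n, dropStep n b) := hF.comp (by fun_prop)
  have h2 (e : Env d) : Measurable fun q : Step d × (ℕ → Step d) => F (q.1, q.2, e) :=
    hF.comp (by fun_prop)
  have h3 : Measurable fun q : Env d × Step d => ∫⁻ v, F (q.2, v, q.1)
      ∂(Measure.infinitePi fun _ : ℕ => stepLaw p hp μ) :=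
    Measurable.lintegral_prod_right' (f := fun r : (Env d × Step d) × (ℕ → Step d) =>
      F (r.1.2, r.2, r.1.1)) (hF.comp (by fun_prop))
  have h4 (s : Step d) : Measurable fun b : Spine d => F (s, b) := hF.comp (by fun_prop)
  have h5 (e : Env d) : ∫⁻ v, F (v n, dropStep n (v, e))
      ∂(Measure.infinitePi fun _ : ℕ => stepLaw p hp μ) = ∫⁻ s, ∫⁻ v, F (s, v, e)
        ∂(Measure.infinitePi fun _ : ℕ => stepLaw p hp μ) ∂(stepLaw p hp μ) :=
    lintegral_split (stepLaw p hp μ) (skipIdx_injective n) (skipIdx_ne n) (h2 e)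
  rw [spineLaw, lintegral_prod_symm _ h1.aemeasurable]
  simp_rw [h5]
  rw [lintegral_lintegral_swap h3.aemeasurable]
  refine lintegral_congr fun s => ?_
  rw [lintegral_prod_symm _ (h4 s).aemeasurable]

/-- The product over the first `n` steps of the spine of the weights of the left siblings, on the
event that the spine avoids `K` up to time `n`. -/
def pathWeight (κ : ℝ≥0∞ → ℝ≥0∞) (K : Finset (Site d)) (y : Site d) (n : ℕ) (b : Spine d) : ℝ≥0∞ :=
  ∏ k ∈ Finset.range n, (if spinePos y b (k + 1) ∈ K then 0 else
    stepWeight κ K (spinePos y b (k + 1)) (b.1 k))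

/-- The weight `pathWeight` times a function of the numbers of pioneers and of visits collected
along the first `n` steps of the spine, from initial values `a` and `b`. -/
def pathTerm (κ : ℝ≥0∞ → ℝ≥0∞) (Φ : ℝ≥0∞ × ℝ≥0∞ → ℝ≥0∞) (K : Finset (Site d)) (y : Site d) (n : ℕ)
    (a b : ℝ≥0∞) (q : Spine d) : ℝ≥0∞ :=
  pathWeight κ K y n q * Φ
    (a + 1 + ∑ k ∈ Finset.range n, stepPioneers K (spinePos y q (k + 1)) (q.1 k),
      b + occ K y q.2 + ∑ k ∈ Finset.range n, stepOcc K (spinePos y q (k + 1)) (q.1 k))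

lemma pathWeight_dropStep (κ : ℝ≥0∞ → ℝ≥0∞) (K : Finset (Site d)) (y : Site d) {n k : ℕ}
    (h : k ≤ n) (b : Spine d) : pathWeight κ K y k (dropStep n b) = pathWeight κ K y k b := by
  refine Finset.prod_congr rfl fun i hi => ?_
  have hi := Finset.mem_range.1 hi
  rw [spinePos_dropStep (by omega), dropStep_fst_of_lt (by omega)]

lemma pathTerm_dropStep (κ : ℝ≥0∞ → ℝ≥0∞) (Φ : ℝ≥0∞ × ℝ≥0∞ → ℝ≥0∞) (K : Finset (Site d))
    (y : Site d) {n k : ℕ} (h : k ≤ n) (a b : ℝ≥0∞) (q : Spine d) :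
    pathTerm κ Φ K y k a b (dropStep n q) = pathTerm κ Φ K y k a b q := by
  have h1 : ∀ i ∈ Finset.range k, stepPioneers K (spinePos y (dropStep n q) (i + 1))
      ((dropStep n q).1 i) = stepPioneers K (spinePos y q (i + 1)) (q.1 i) := fun i hi => by
    have hi := Finset.mem_range.1 hi
    rw [spinePos_dropStep (by omega), dropStep_fst_of_lt (by omega)]
  have h2 : ∀ i ∈ Finset.range k, stepOcc K (spinePos y (dropStep n q) (i + 1))
      ((dropStep n q).1 i) = stepOcc K (spinePos y q (i + 1)) (q.1 i) := fun i hi => by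
    have hi := Finset.mem_range.1 hi
    rw [spinePos_dropStep (by omega), dropStep_fst_of_lt (by omega)]
  rw [pathTerm, pathWeight_dropStep κ K y h, Finset.sum_congr rfl h1, Finset.sum_congr rfl h2]
  rfl

lemma measurable_ite_site {α : Type*} [MeasurableSpace α] (A : Site d → Prop) [DecidablePred A]
    {f : α → Site d} (hf : Measurable f) {g h : α → ℝ≥0∞} (hg : Measurable g) (hh : Measurable h) :
    Measurable fun a => if A (f a) then g a else h a :=
  Measurable.ite (hf (MeasurableSet.of_discrete (s := {x | A x}))) hg hh

lemma measurable_pathWeight {κ : ℝ≥0∞ → ℝ≥0∞} (hκ : Measurable κ) (K : Finset (Site d)) (y : Site d)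
    (n : ℕ) : Measurable (pathWeight κ K y n) := by
  refine Finset.measurable_prod _ fun k _ => measurable_ite_site (· ∈ K) (by fun_prop)
    measurable_const ?_
  exact (measurable_stepWeight hκ K).comp
    (f := fun b : Spine d => (spinePos y b (k + 1), b.1 k)) (by fun_prop)

lemma measurable_pathTerm {κ : ℝ≥0∞ → ℝ≥0∞} (hκ : Measurable κ) {Φ : ℝ≥0∞ × ℝ≥0∞ → ℝ≥0∞}
    (hΦ : Measurable Φ) (K : Finset (Site d)) (y : Site d) (n : ℕ) (a b : ℝ≥0∞) :
    Measurable (pathTerm κ Φ K y n a b) :=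
  (measurable_pathWeight hκ K y n).mul (hΦ.comp (by fun_prop))

/-- The last step of the spine is separated from the others: it is the counterpart along the spine
of `lintegral_genWeight_succ`. -/
lemma lintegral_stepWeight_pathTerm (p : PMF ℕ) (hp : offspringMean p = 1) (μ : PMF (Site d))
    {κ : ℝ≥0∞ → ℝ≥0∞} (hκ : Measurable κ) {Φ : ℝ≥0∞ × ℝ≥0∞ → ℝ≥0∞} (hΦ : Measurable Φ)
    (K : Finset (Site d)) {x : Site d} (hx : x ∉ K) (y : Site d) (n : ℕ) (a b : ℝ≥0∞) :
    ∫⁻ q, (if spinePos y q (n + 1) = x then pathTerm κ Φ K y (n + 1) a b q else 0)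
        ∂(spineLaw p hp μ) =
      ∫⁻ s, stepWeight κ K x s * ∫⁻ q, (if spinePos y q n = x - s.1 then
        pathTerm κ Φ K y n (a + stepPioneers K x s) (b + stepOcc K x s) q else 0)
        ∂(spineLaw p hp μ) ∂(stepLaw p hp μ) := by
  let F : Step d × Spine d → ℝ≥0∞ := fun r => stepWeight κ K x r.1 *
    (if spinePos y r.2 n = x - r.1.1 then
      pathTerm κ Φ K y n (a + stepPioneers K x r.1) (b + stepOcc K x r.1) r.2 else 0)
  have hT : Measurable fun r : Step d × Spine d =>
      pathTerm κ Φ K y n (a + stepPioneers K x r.1) (b + stepOcc K x r.1) r.2 :=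
    ((measurable_pathWeight hκ K y n).comp measurable_snd).mul (hΦ.comp (by fun_prop))
  have hI : Measurable fun r : Step d × Spine d => (if spinePos y r.2 n = x - r.1.1 then
      pathTerm κ Φ K y n (a + stepPioneers K x r.1) (b + stepOcc K x r.1) r.2 else 0) :=
    Measurable.ite (measurableSet_eq_fun (by fun_prop) (by fun_prop)) hT measurable_const
  have hW : Measurable fun s : Step d => stepWeight κ K x s :=
    (measurable_stepWeight hκ K).comp (f := fun s => (x, s)) (by fun_prop)
  have hF : Measurable F := (hW.comp measurable_fst).mul hI
  calc _ = ∫⁻ q, F (q.1 n, dropStep n q) ∂(spineLaw p hp μ) := by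
        refine lintegral_congr fun q => ?_
        simp only [F]
        rw [spinePos_dropStep le_rfl, pathTerm_dropStep _ _ _ _ le_rfl]
        by_cases h : spinePos y q n = x - (q.1 n).1
        · have hpos : spinePos y q (n + 1) = x := by rw [spinePos_succ, h, sub_add_cancel]
          rw [if_pos hpos, if_pos h, pathTerm, pathTerm, pathWeight, Finset.prod_range_succ, Finset.sum_range_succ,
            Finset.sum_range_succ, hpos, if_neg hx, ← pathWeight]
          rw [mul_left_comm, ← mul_assoc]
          congr 3 <;> ring
        · rw [if_neg h, mul_zero, if_neg]
          rwa [spinePos_succ, ← eq_sub_iff_add_eq]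
    _ = _ := by
        rw [lintegral_spineLaw p hp μ n hF]
        refine lintegral_congr fun s => ?_
        have hIs : Measurable fun q => (if spinePos y q n = x - s.1 then
            pathTerm κ Φ K y n (a + stepPioneers K x s) (b + stepOcc K x s) q else 0) :=
          hI.comp (f := fun q => (s, q)) (by fun_prop)
        exact lintegral_const_mul (stepWeight κ K x s) hIs

/-- The many-to-one formula: seen from a pioneer, the ancestral line is a backward spine, and the
remaining pioneers and visits are those of the siblings along the spine, together with the visits
by the descendants of the pioneer. -/
lemma many_to_one (p : PMF ℕ) (hp : offspringMean p = 1) (μ : PMF (Site d))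
    {κ : ℝ≥0∞ → ℝ≥0∞} (hκ : Measurable κ) {Φ : ℝ≥0∞ × ℝ≥0∞ → ℝ≥0∞} (hΦ : Measurable Φ)
    (K : Finset (Site d)) (n : ℕ) (x : Site d) (a b : ℝ≥0∞) :
    ∫⁻ ω, genWeight κ K n x ω * Φ (a + numPioneers K x ω, b + occ K x ω) ∂(envLaw p μ) =
      ∑ y ∈ K, ∫⁻ q, (if spinePos y q n = x then pathTerm κ Φ K y n a b q else 0)
        ∂(spineLaw p hp μ) := by
  induction n generalizing x a b with
  | zero =>
    simp only [spinePos_zero, genWeight]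
    by_cases hx : x ∈ K
    · rw [Finset.sum_eq_single_of_mem x hx fun y _ hy => by simp [hy]]
      simp only [if_pos hx, numPioneers_of_mem hx, one_mul, if_true, pathTerm, pathWeight,
        Finset.range_zero, Finset.prod_empty, Finset.sum_empty, add_zero]
      have hm : Measurable fun q : Spine d => Φ (a + 1, b + occ K x q.2) := hΦ.comp (by fun_prop)
      rw [spineLaw, lintegral_prod _ hm.aemeasurable]
      simp
    · simp only [if_neg hx, zero_mul, lintegral_zero]
      refine (Finset.sum_eq_zero fun y hy => ?_).symm
      have hyx : y ≠ x := fun h => hx (h ▸ hy)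
      simp [hyx]
  | succ n ih =>
    by_cases hx : x ∈ K
    · simp only [genWeight, if_pos hx, zero_mul, lintegral_zero]
      refine (Finset.sum_eq_zero fun y _ => ?_).symm
      rw [lintegral_congr (g := fun _ => 0) fun q => ?_, lintegral_zero]
      split_ifs with h
      · rw [pathTerm, pathWeight, Finset.prod_range_succ, h, if_pos hx, mul_zero, zero_mul]
      · rfl
    -- the first step of the walk from `x` to `K` is the last step of the spine from `K` to `x`
    · rw [lintegral_genWeight_succ p hp μ hκ hΦ hx]
      simp_rw [ih]
      rw [Finset.sum_congr rfl fun y _ => lintegral_stepWeight_pathTerm p hp μ hκ hΦ K hx y n a b,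
        ← lintegral_finsetSum]
      · simp_rw [Finset.mul_sum]
      · intro y _
        refine Measurable.mul
          ((measurable_stepWeight hκ K).comp (f := fun s => (x, s)) (by fun_prop)) ?_
        have hT : Measurable fun r : Step d × Spine d =>
            pathTerm κ Φ K y n (a + stepPioneers K x r.1) (b + stepOcc K x r.1) r.2 :=
          ((measurable_pathWeight hκ K y n).comp measurable_snd).mul (hΦ.comp (by fun_prop))
        exact Measurable.lintegral_prod_right' (f := fun r : Step d × Spine d =>
          if spinePos y r.2 n = x - r.1.1 then
            pathTerm κ Φ K y n (a + stepPioneers K x r.1) (b + stepOcc K x r.1) r.2 else 0)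
          (Measurable.ite (measurableSet_eq_fun (by fun_prop) (by fun_prop)) hT measurable_const)

/-! ### Summing the weights of the pioneers -/

/-- The indicator function of `0`. -/
def zeroInd (r : ℝ≥0∞) : ℝ≥0∞ := if r = 0 then 1 else 0

lemma measurable_zeroInd : Measurable zeroInd :=
  Measurable.ite (measurableSet_singleton 0) measurable_const measurable_const

lemma zeroInd_le_one (r : ℝ≥0∞) : zeroInd r ≤ 1 := by
  unfold zeroInd; split_ifs <;> simp

/-- The first nonzero term of a finite sequence is counted once. -/
lemma sum_prod_zeroInd (L : ℕ → ℝ≥0∞) (N : ℕ) :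
    ∑ j ∈ Finset.range N, (∏ i ∈ Finset.range j, zeroInd (L i)) * (if L j = 0 then 0 else 1) =
      if ∑ j ∈ Finset.range N, L j = 0 then 0 else 1 := by
  have hprod (j : ℕ) : ∏ i ∈ Finset.range j, zeroInd (L i) =
      if ∑ i ∈ Finset.range j, L i = 0 then 1 else 0 := by
    induction j with
    | zero => simp
    | succ j ih =>
      rw [Finset.prod_range_succ, ih, Finset.sum_range_succ]
      unfold zeroInd
      by_cases h1 : ∑ i ∈ Finset.range j, L i = 0 <;> by_cases h2 : L j = 0 <;> simp_all
  induction N with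
  | zero => simp
  | succ N ih =>
    rw [Finset.sum_range_succ, ih, hprod, Finset.sum_range_succ]
    by_cases h1 : ∑ i ∈ Finset.range N, L i = 0 <;> by_cases h2 : L N = 0 <;>
      simp only [add_eq_zero, h1, h2] <;> simp

lemma genWeight_zeroInd_le (K : Finset (Site d)) (n : ℕ) (x : Site d) (ω : Env d) :
    genWeight zeroInd K n x ω ≤ genCount (pioneers K x ω) n := by
  rw [← genWeight_one]
  induction n generalizing x ω with
  | zero => exact le_rfl
  | succ n ih =>
    simp only [genWeight]
    split_ifs
    · exact le_rfl
    · exact Finset.sum_le_sum fun j _ => mul_le_mul'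
        (Finset.prod_le_prod' fun i _ => zeroInd_le_one _) (ih _ _)

/-- A finite set of words has no word of large length. -/
lemma exists_genCount_eq_zero {A : Set (List ℕ)} (hA : ∑' u : List ℕ, A.indicator (1 : List ℕ → ℝ≥0∞) u < ∞) :
    ∃ D, ∀ n, D ≤ n → genCount A n = 0 := by
  have hfin : A.Finite := by
    by_contra h
    have : Infinite A := Set.infinite_coe_iff.2 h
    rw [← tsum_subtype] at hA
    simp only [Pi.one_apply] at hA
    rw [ENNReal.tsum_const_eq_top_of_ne_zero one_ne_zero] at hA
    exact hA.ne rfl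
  obtain ⟨D, hD⟩ := (hfin.image List.length).bddAbove
  refine ⟨D + 1, fun n hn => ENNReal.tsum_eq_zero.2 fun u => ?_⟩
  split_ifs with hu
  · refine Set.indicator_of_notMem (fun huA => ?_) _
    have := hD (Set.mem_image_of_mem _ huA)
    omega
  · rfl

/-- With `κ` the indicator of `0`, only the leftmost pioneer is counted. -/
lemma tsum_genWeight_zeroInd {K : Finset (Site d)} {x : Site d} {ω : Env d}
    (h : numPioneers K x ω < ∞) :
    ∑' n, genWeight zeroInd K n x ω = if numPioneers K x ω = 0 then 0 else 1 := by
  -- induction on a bound `D` on the generations of the pioneers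
  obtain ⟨D, hD⟩ := exists_genCount_eq_zero h
  clear h
  induction D generalizing x ω with
  | zero =>
    have h0 : numPioneers K x ω = 0 := by
      rw [numPioneers_eq_tsum]
      exact ENNReal.tsum_eq_zero.2 fun n => hD n (Nat.zero_le n)
    rw [if_pos h0]
    exact ENNReal.tsum_eq_zero.2 fun n => le_antisymm
      ((genWeight_zeroInd_le K n x ω).trans (hD n (Nat.zero_le n)).le) zero_le
  | succ D ih =>
    rw [tsum_eq_zero_add' ENNReal.summable]
    by_cases hx : x ∈ K
    · simp [genWeight, hx, numPioneers_of_mem hx]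
    · simp only [genWeight, if_neg hx, zero_add]
      rw [Summable.tsum_finsetSum fun _ _ => ENNReal.summable, numPioneers_of_notMem hx,
        ← sum_prod_zeroInd]
      refine Finset.sum_congr rfl fun j hj => ?_
      rw [ENNReal.tsum_mul_left, ih]
      intro n hn
      have h1 := hD (n + 1) (by omega)
      rw [genCount_pioneers_succ, if_neg hx, Finset.sum_eq_zero_iff] at h1
      exact h1 j hj

lemma tsum_genWeight_one (K : Finset (Site d)) (x : Site d) (ω : Env d) :
    ∑' n, genWeight (fun _ => 1) K n x ω = numPioneers K x ω := by
  simp_rw [genWeight_one, numPioneers_eq_tsum]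

/-! ### First moments along the spine -/

/-- The mean number of siblings along the spine is `∑ k (k - 1) p_k`, and `k (k - 1) ≤ 2 (k - 1)²`.
-/
lemma tsum_numSib_le (p : PMF ℕ) :
    ∑' q : ℕ × ℕ, p (q.1 + q.2 + 1) * (q.1 + q.2 : ℕ) ≤ 2 * offspringVariance p := by
  have h := tsum_sum_range fun k _ => p k * ((k - 1 : ℕ) : ℝ≥0∞)
  simp only [Nat.add_sub_cancel] at h
  rw [← h, offspringVariance, ← ENNReal.tsum_mul_left]
  refine ENNReal.tsum_le_tsum fun k => ?_
  rw [Finset.sum_const, Finset.card_range, nsmul_eq_mul]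
  rcases k with _ | k
  · simp
  · have hk : ((k + 1 : ℕ) : ℝ≥0∞) * ((k : ℕ) : ℝ≥0∞) ≤ 2 * ENNReal.ofReal (((k + 1 : ℕ) - 1 : ℝ) ^ 2) := by
      have h1 : ((k + 1 : ℕ) - 1 : ℝ) = k := by push_cast; ring
      rw [h1, ENNReal.ofReal_pow (by positivity), ENNReal.ofReal_natCast]
      have h2 : (k + 1) * k ≤ 2 * k ^ 2 := by nlinarith [Nat.zero_le k, k.le_mul_self]
      exact_mod_cast h2
    simp only [Nat.add_sub_cancel]
    calc ((k + 1 : ℕ) : ℝ≥0∞) * (p (k + 1) * (k : ℕ)) = ((k + 1 : ℕ) : ℝ≥0∞) * (k : ℕ) * p (k + 1) := by ring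
      _ ≤ _ := by
        rw [← mul_assoc]
        exact mul_le_mul_left hk _

/-- The mean occupation time of the subtrees of the siblings of a spine vertex whose parent is at
`z`. -/
def meanStepOcc (p : PMF ℕ) (μ : PMF (Site d)) (K : Finset (Site d)) (z : Site d) : ℝ≥0∞ :=
  ∑' q : ℕ × ℕ, p (q.1 + q.2 + 1) * ∫⁻ e, stepOcc K z (0, q, e) ∂(kidsLaw p μ)

lemma meanStepOcc_le (p : PMF ℕ) (hp : offspringMean p = 1) (μ : PMF (Site d))
    (K : Finset (Site d)) (z : Site d) :
    meanStepOcc p μ K z ≤ 2 * offspringVariance p * ∑ y ∈ K, green μ (y - z) := by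
  have hm : Measurable fun c : Site d × Env d => occ K (z + c.1) c.2 := by fun_prop
  calc meanStepOcc p μ K z ≤ ∑' q : ℕ × ℕ, p (q.1 + q.2 + 1) * (q.1 + q.2 : ℕ) *
        ∑ y ∈ K, green μ (y - z) := by
        refine ENNReal.tsum_le_tsum fun q => ?_
        rw [mul_assoc]
        refine mul_le_mul_right ?_ _
        have hm3 (j : ℕ) : Measurable fun e : ℕ → Site d × Env d => occ K (z + (e j).1) (e j).2 :=
          hm.comp (measurable_pi_apply j)
        simp only [stepOcc]
        rw [lintegral_finsetSum _ fun j _ => hm3 j,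
          Finset.sum_congr rfl fun j _ => lintegral_eval_kids _ hm j, Finset.sum_const,
          Finset.card_range, nsmul_eq_mul]
        exact mul_le_mul_right (lintegral_kid_occ_le p hp μ K z) _
    _ ≤ _ := by
        rw [ENNReal.tsum_mul_right]
        exact mul_le_mul_left (tsum_numSib_le p) _

lemma tsum_siblingLaw (p : PMF ℕ) (hp : offspringMean p = 1) :
    ∑' q : ℕ × ℕ, p (q.1 + q.2 + 1) = 1 := (siblingLaw p hp).tsum_coe

/-- Future positions of the spine, given its first `m` steps. -/
lemma lintegral_ite_spinePos (p : PMF ℕ) (hp : offspringMean p = 1) (μ : PMF (Site d))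
    {f : Spine d → ℝ≥0∞} (hf : Measurable f) {m : ℕ} (hfm : ∀ k, m ≤ k → ∀ b, f (dropStep k b) = f b)
    (y x : Site d) (r : ℕ) :
    ∫⁻ b, (if spinePos y b (m + r) = x then f b else 0) ∂(spineLaw p hp μ) =
      ∫⁻ b, f b * convPow μ r (spinePos y b m - x) ∂(spineLaw p hp μ) := by
  induction r generalizing x with
  | zero =>
    refine lintegral_congr fun b => ?_
    simp [convPow, Pi.single_apply, sub_eq_zero]
  | succ r ih =>
    have hF : Measurable fun q : Step d × Spine d =>
        if spinePos y q.2 (m + r) = x - q.1.1 then f q.2 else 0 :=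
      Measurable.ite (measurableSet_eq_fun (by fun_prop) (by fun_prop)) (by fun_prop)
        measurable_const
    have hG : Measurable fun s : Step d => ∫⁻ b,
        (if spinePos y b (m + r) = x - s.1 then f b else 0) ∂(spineLaw p hp μ) :=
      hF.lintegral_prod_right'
    calc _ = ∫⁻ b, (if spinePos y (dropStep (m + r) b) (m + r) = x - (b.1 (m + r)).1 then
          f (dropStep (m + r) b) else 0) ∂(spineLaw p hp μ) := by
          refine lintegral_congr fun b => ?_
          rw [spinePos_dropStep le_rfl, hfm _ (by omega)]
          refine if_congr ?_ rfl rfl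
          rw [← add_assoc, spinePos_succ, ← eq_sub_iff_add_eq]
      _ = ∑' z, μ z * ∫⁻ b, (if spinePos y b (m + r) = x + z then f b else 0)
          ∂(spineLaw p hp μ) := by
          rw [lintegral_spineLaw p hp μ (m + r) hF, lintegral_stepLaw p hp μ hG]
          simp only [lintegral_const, measure_univ, mul_one, sub_neg_eq_add]
          refine tsum_congr fun z => ?_
          rw [ENNReal.tsum_mul_right, tsum_siblingLaw p hp, one_mul]
      _ = _ := by
          simp_rw [ih]
          have hm (z : Site d) : Measurable fun b : Spine d =>
              f b * convPow μ r (spinePos y b m - (x + z)) :=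
            hf.mul ((Measurable.of_discrete (f := convPow μ r)).comp (by fun_prop))
          calc _ = ∑' z, ∫⁻ b, μ z * (f b * convPow μ r (spinePos y b m - (x + z)))
                ∂(spineLaw p hp μ) := tsum_congr fun z => (lintegral_const_mul _ (hm z)).symm
            _ = _ := by
              rw [← lintegral_tsum fun z => ((hm z).const_mul _).aemeasurable]
              refine lintegral_congr fun b => ?_
              rw [convPow, latticeConv, ← ENNReal.tsum_mul_left]
              refine tsum_congr fun z => ?_
              rw [mul_left_comm, sub_add_eq_sub_sub]

/-- The law of the positions of the spine. -/
lemma lintegral_comp_spinePos (p : PMF ℕ) (hp : offspringMean p = 1) (μ : PMF (Site d))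
    (φ : Site d → ℝ≥0∞) (y : Site d) (n : ℕ) :
    ∫⁻ b, φ (spinePos y b n) ∂(spineLaw p hp μ) = ∑' z, convPow μ n (y - z) * φ z := by
  have h (z : Site d) : ∫⁻ b, (if spinePos y b n = z then φ z else 0) ∂(spineLaw p hp μ) =
      convPow μ n (y - z) * φ z := by
    have h1 := lintegral_ite_spinePos p hp μ (f := fun _ => φ z) measurable_const (m := 0)
      (fun _ _ _ => rfl) y z n
    simp only [zero_add, spinePos_zero, lintegral_const, measure_univ, mul_one] at h1
    rw [h1, mul_comm]
  simp_rw [← h]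
  rw [← lintegral_tsum fun z => Measurable.aemeasurable (Measurable.ite
    (measurableSet_eq_fun (by fun_prop) (by fun_prop)) measurable_const measurable_const)]
  refine lintegral_congr fun b => ?_
  rw [tsum_eq_single (spinePos y b n) fun z hz => if_neg hz.symm, if_pos rfl]

/-- The siblings at a step of the spine can be averaged out, given the positions of the spine. -/
lemma lintegral_stepOcc_mul (p : PMF ℕ) (hp : offspringMean p = 1) (μ : PMF (Site d))
    (K : Finset (Site d)) (φ : Site d → ℝ≥0∞) (y : Site d) (k : ℕ) :
    ∫⁻ b, stepOcc K (spinePos y b (k + 1)) (b.1 k) * φ (spinePos y b (k + 1)) ∂(spineLaw p hp μ) =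
      ∫⁻ b, meanStepOcc p μ K (spinePos y b (k + 1)) * φ (spinePos y b (k + 1))
        ∂(spineLaw p hp μ) := by
  have hφ : Measurable φ := .of_discrete
  have hmean : Measurable (meanStepOcc p μ K) := .of_discrete
  have hF : Measurable fun q : Step d × Spine d => stepOcc K (spinePos y q.2 k + q.1.1) q.1 *
      φ (spinePos y q.2 k + q.1.1) := by fun_prop
  have hG : Measurable fun q : Step d × Spine d => meanStepOcc p μ K (spinePos y q.2 k + q.1.1) *
      φ (spinePos y q.2 k + q.1.1) := by fun_prop
  have h1 := lintegral_spineLaw p hp μ k hF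
  have h2 := lintegral_spineLaw p hp μ k hG
  simp only [spinePos_dropStep le_rfl, ← spinePos_succ] at h1 h2
  rw [h1.trans (lintegral_lintegral_swap hF.aemeasurable),
    h2.trans (lintegral_lintegral_swap hG.aemeasurable)]
  refine lintegral_congr fun b => ?_
  have hF' : Measurable fun s : Step d => stepOcc K (spinePos y b k + s.1) s *
      φ (spinePos y b k + s.1) := by fun_prop
  have hG' : Measurable fun s : Step d => meanStepOcc p μ K (spinePos y b k + s.1) *
      φ (spinePos y b k + s.1) := by fun_prop
  rw [lintegral_stepLaw p hp μ hF', lintegral_stepLaw p hp μ hG']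
  refine tsum_congr fun z => ?_
  congr 1
  simp only [lintegral_const, measure_univ, mul_one]
  rw [ENNReal.tsum_mul_right, tsum_siblingLaw p hp, one_mul, meanStepOcc, ← ENNReal.tsum_mul_right]
  refine tsum_congr fun q => ?_
  rw [mul_assoc]
  congr 1
  have hm : Measurable fun e : ℕ → Site d × Env d => stepOcc K (spinePos y b k + -z) (0, q, e) := by
    fun_prop
  exact lintegral_mul_const _ hm

/-- The visits to `K` by the spine at time `k + 1` and by the descendants of the siblings at that
time. -/
def stepVisits (K : Finset (Site d)) (y : Site d) (k : ℕ) (b : Spine d) : ℝ≥0∞ :=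
  (if spinePos y b (k + 1) ∈ K then 1 else 0) + stepOcc K (spinePos y b (k + 1)) (b.1 k)

@[fun_prop]
lemma measurable_stepVisits (K : Finset (Site d)) (y : Site d) (k : ℕ) :
    Measurable (stepVisits K y k) :=
  (measurable_ite_site (· ∈ K) (by fun_prop) measurable_const measurable_const).add (by fun_prop)

lemma stepVisits_dropStep (K : Finset (Site d)) (y : Site d) {k n : ℕ} (h : k + 1 ≤ n)
    (b : Spine d) : stepVisits K y k (dropStep n b) = stepVisits K y k b := by
  rw [stepVisits, spinePos_dropStep h, dropStep_fst_of_lt h]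
  rfl

/-- The mean number of visits at a step of the spine that leads to `z`. -/
def meanStepVisits (p : PMF ℕ) (μ : PMF (Site d)) (K : Finset (Site d)) (z : Site d) : ℝ≥0∞ :=
  (if z ∈ K then 1 else 0) + meanStepOcc p μ K z

lemma one_le_green_zero (μ : PMF (Site d)) : 1 ≤ green μ 0 := by
  have h := convPow_le_green μ 0 (0 : Site d)
  simpa [convPow] using h

lemma meanStepVisits_le (p : PMF ℕ) (hp : offspringMean p = 1) (μ : PMF (Site d))
    (K : Finset (Site d)) (z : Site d) :
    meanStepVisits p μ K z ≤ (1 + 2 * offspringVariance p) * ∑ y ∈ K, green μ (y - z) := by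
  rw [add_mul, one_mul]
  refine add_le_add ?_ (meanStepOcc_le p hp μ K z)
  split_ifs with hz
  · refine le_trans ?_ (Finset.single_le_sum (f := fun y => green μ (y - z)) (fun _ _ => zero_le) hz)
    simpa using one_le_green_zero μ
  · exact zero_le

lemma lintegral_stepVisits_mul (p : PMF ℕ) (hp : offspringMean p = 1) (μ : PMF (Site d))
    (K : Finset (Site d)) (φ : Site d → ℝ≥0∞) (y : Site d) (k : ℕ) :
    ∫⁻ b, stepVisits K y k b * φ (spinePos y b (k + 1)) ∂(spineLaw p hp μ) =
      ∑' z, convPow μ (k + 1) (y - z) * (meanStepVisits p μ K z * φ z) := by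
  have hφ : Measurable φ := .of_discrete
  have hmean : Measurable (meanStepOcc p μ K) := .of_discrete
  have hI : Measurable fun b : Spine d => (if spinePos y b (k + 1) ∈ K then (1 : ℝ≥0∞) else 0) *
      φ (spinePos y b (k + 1)) :=
    (measurable_ite_site (· ∈ K) (by fun_prop) measurable_const measurable_const).mul (by fun_prop)
  rw [← lintegral_comp_spinePos p hp μ (fun z => meanStepVisits p μ K z * φ z)]
  simp only [stepVisits, meanStepVisits, add_mul]
  rw [lintegral_add_left hI, lintegral_add_left hI, lintegral_stepOcc_mul]

lemma tsum_convPow_add_le_green (μ : PMF (Site d)) (m : ℕ) (x : Site d) :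
    ∑' k, convPow μ (m + k) x ≤ green μ x :=
  ENNReal.tsum_comp_le_tsum_of_injective (add_right_injective m) _

/-- The Green functions of two points have a finite scalar product in dimension at least five. -/
lemma tsum_green_mul_green_le (μ : PMF (Site d)) (x y : Site d) :
    ∑' z, green μ (x - z) * green μ (y - z) ≤ 2 * ∑' z, green μ z ^ 2 := by
  have h (x : Site d) : ∑' z, green μ (x - z) ^ 2 = ∑' z, green μ z ^ 2 :=
    (Equiv.subLeft x).tsum_eq fun z => green μ z ^ 2
  calc _ ≤ ∑' z, (green μ (x - z) ^ 2 + green μ (y - z) ^ 2) := by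
        refine ENNReal.tsum_le_tsum fun z => ?_
        rcases le_total (green μ (x - z)) (green μ (y - z)) with h | h
        · exact (mul_le_mul_left h _).trans ((sq _).symm.le.trans le_add_self)
        · exact (mul_le_mul_right h _).trans ((sq _).symm.le.trans le_self_add)
    _ = _ := by rw [ENNReal.tsum_add, h, h, two_mul]

lemma tsum_green_mul_meanStepVisits_lt_top (hd : 5 ≤ d) (p : PMF ℕ) (hp : offspringMean p = 1)
    (hvar : offspringVariance p < ∞) (μ : PMF (Site d)) (hμ : IsJumpLaw μ) (K : Finset (Site d))
    (y : Site d) : ∑' z, green μ (y - z) * meanStepVisits p μ K z < ∞ := by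
  calc _ ≤ ∑' z, (1 + 2 * offspringVariance p) * ∑ y' ∈ K, green μ (y - z) * green μ (y' - z) := by
        refine ENNReal.tsum_le_tsum fun z => ?_
        rw [← Finset.mul_sum, mul_left_comm]
        exact mul_le_mul_right (meanStepVisits_le p hp μ K z) _
    _ = (1 + 2 * offspringVariance p) * ∑ y' ∈ K, ∑' z, green μ (y - z) * green μ (y' - z) := by
        rw [ENNReal.tsum_mul_left, Summable.tsum_finsetSum fun _ _ => ENNReal.summable]
    _ < ∞ := by
        refine ENNReal.mul_lt_top ?_ (ENNReal.sum_lt_top.2 fun y' _ => ?_)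
        · exact ENNReal.add_lt_top.2 ⟨ENNReal.one_lt_top, ENNReal.mul_lt_top (by simp) hvar⟩
        · exact (tsum_green_mul_green_le μ y y').trans_lt
            (ENNReal.mul_lt_top (by simp) (hμ.tsum_green_sq_lt_top hd))

/-- The spine and the branching random walks issued from the siblings visit `K` finitely often: the
mean number of visits is at most a constant times `∑ z, g (y - z) * g (y' - z)`. -/
lemma ae_tsum_stepVisits_lt_top (hd : 5 ≤ d) (p : PMF ℕ) (hp : offspringMean p = 1)
    (hvar : offspringVariance p < ∞) (μ : PMF (Site d)) (hμ : IsJumpLaw μ) (K : Finset (Site d))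
    (y : Site d) : ∀ᵐ b ∂(spineLaw p hp μ), ∑' k, stepVisits K y k b < ∞ := by
  refine ae_lt_top (Measurable.tsum fun k => measurable_stepVisits K y k) (ne_of_lt ?_)
  have h (k : ℕ) := lintegral_stepVisits_mul p hp μ K (fun _ => 1) y k
  simp only [mul_one] at h
  rw [lintegral_tsum fun k => (measurable_stepVisits K y k).aemeasurable]
  simp_rw [h]
  rw [ENNReal.tsum_comm]
  refine lt_of_le_of_lt (ENNReal.tsum_le_tsum fun z => ?_)
    (tsum_green_mul_meanStepVisits_lt_top hd p hp hvar μ hμ K y)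
  rw [ENNReal.tsum_mul_right]
  refine mul_le_mul_left ?_ _
  simp_rw [add_comm _ 1]
  exact tsum_convPow_add_le_green μ 1 _

lemma one_le_of_tsum_indicator_ne_zero {α : Type*} {A : Set α}
    (h : ∑' u, A.indicator (1 : α → ℝ≥0∞) u ≠ 0) : 1 ≤ ∑' u, A.indicator (1 : α → ℝ≥0∞) u := by
  obtain ⟨u, hu⟩ : ∃ u, A.indicator (1 : α → ℝ≥0∞) u ≠ 0 := by
    by_contra! h'
    exact h (ENNReal.tsum_eq_zero.2 h')
  have huA : u ∈ A := Set.mem_of_indicator_ne_zero hu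
  refine le_trans ?_ (ENNReal.le_tsum u)
  simp [huA]

lemma one_le_occ {K : Finset (Site d)} {x : Site d} {ω : Env d} (h : occ K x ω ≠ 0) :
    1 ≤ occ K x ω := one_le_of_tsum_indicator_ne_zero h

lemma one_le_numPioneers {K : Finset (Site d)} {x : Site d} {ω : Env d}
    (h : numPioneers K x ω ≠ 0) : 1 ≤ numPioneers K x ω := one_le_of_tsum_indicator_ne_zero h

lemma one_le_stepVisits {K : Finset (Site d)} {y : Site d} {k : ℕ} {b : Spine d}
    (h : stepVisits K y k b ≠ 0) : 1 ≤ stepVisits K y k b := by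
  unfold stepVisits at h ⊢
  split_ifs at h ⊢ with hK
  · exact le_self_add
  · rw [zero_add] at h ⊢
    obtain ⟨j, hj, hj0⟩ : ∃ j ∈ Finset.range ((b.1 k).2.1.1 + (b.1 k).2.1.2),
        occ K (spinePos y b (k + 1) + ((b.1 k).2.2 j).1) ((b.1 k).2.2 j).2 ≠ 0 := by
      by_contra! h'
      exact h (Finset.sum_eq_zero h')
    exact (one_le_occ hj0).trans (Finset.single_le_sum
      (f := fun j => occ K (spinePos y b (k + 1) + ((b.1 k).2.2 j).1) ((b.1 k).2.2 j).2)
      (fun _ _ => zero_le) hj)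

lemma sibPioneers_eq (K : Finset (Site d)) (y : Site d) (b : Spine d) :
    sibPioneers K y b = ∑' k, stepPioneers K (spinePos y b (k + 1)) (b.1 k) := rfl

lemma sibOcc_eq (K : Finset (Site d)) (y : Site d) (b : Spine d) :
    sibOcc K y b = ∑' k, stepOcc K (spinePos y b (k + 1)) (b.1 k) := rfl

lemma sibPioneers_le_sibOcc (K : Finset (Site d)) (y : Site d) (b : Spine d) :
    sibPioneers K y b ≤ sibOcc K y b :=
  ENNReal.tsum_le_tsum fun _ => Finset.sum_le_sum fun _ _ => numPioneers_le_occ _ _ _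

lemma sibOcc_le_tsum_stepVisits (K : Finset (Site d)) (y : Site d) (b : Spine d) :
    sibOcc K y b ≤ ∑' k, stepVisits K y k b := by
  rw [sibOcc_eq]
  exact ENNReal.tsum_le_tsum fun _ => le_add_self

/-- Only finitely many steps of the spine lead to visits to `K`. -/
lemma exists_stepVisits_eq_zero {K : Finset (Site d)} {y : Site d} {b : Spine d}
    (h : ∑' k, stepVisits K y k b < ∞) : ∃ m, ∀ k, m ≤ k → stepVisits K y k b = 0 := by
  have h1 := (ENNReal.tendsto_atTop_zero_of_tsum_ne_top h.ne).eventually_lt_const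
    (show (0 : ℝ≥0∞) < 1 by simp)
  obtain ⟨m, hm⟩ := eventually_atTop.1 h1
  refine ⟨m, fun k hk => ?_⟩
  by_contra h0
  exact absurd (hm k hk) (not_lt.2 (one_le_stepVisits h0))

lemma ae_occ_lt_top (hd : 5 ≤ d) (p : PMF ℕ) (hp : offspringMean p = 1) (μ : PMF (Site d))
    (hμ : IsJumpLaw μ) (K : Finset (Site d)) (x : Site d) :
    ∀ᵐ ω ∂(envLaw p μ), occ K x ω < ∞ := by
  refine ae_lt_top (measurable_occ K x) (ne_of_lt ?_)
  rw [lintegral_occ p hp μ K x]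
  exact ENNReal.sum_lt_top.2 fun y _ => hμ.green_lt_top hd _

/-! ### The norm `𝒥` and uniform bounds on the Green function -/

lemma sqrt_normSq_eq_norm (v : Fin d → ℝ) : Real.sqrt (normSq v) = ‖WithLp.toLp 2 v‖ := by
  rw [EuclideanSpace.norm_eq, normSq]
  simp

lemma euclNorm_eq_norm (x : Site d) :
    euclNorm x = ‖(WithLp.toLp 2 fun i => (x i : ℝ) : EuclideanSpace ℝ (Fin d))‖ := by
  rw [← sqrt_normSq_eq_norm]
  rfl

lemma euclNorm_add_le (x y : Site d) : euclNorm (x + y) ≤ euclNorm x + euclNorm y := by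
  simp only [euclNorm_eq_norm]
  refine le_trans (le_of_eq ?_) (norm_add_le _ _)
  rw [← WithLp.toLp_add]
  congr 2
  funext i
  simp

lemma euclNorm_neg (x : Site d) : euclNorm (-x) = euclNorm x := by simp [euclNorm]

lemma euclNorm_sub_comm (x y : Site d) : euclNorm (x - y) = euclNorm (y - x) := by
  rw [← euclNorm_neg, neg_sub]

lemma euclNorm_le_add (x y : Site d) : euclNorm x ≤ euclNorm (x - y) + euclNorm y := by
  simpa using euclNorm_add_le (x - y) y

lemma euclNorm_zero : euclNorm (0 : Site d) = 0 := by simp [euclNorm]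

lemma IsJumpLaw.jnorm_add_le {μ : PMF (Site d)} (hμ : IsJumpLaw μ) (x y : Site d) :
    jnorm μ (x + y) ≤ jnorm μ x + jnorm μ y := by
  obtain ⟨B, hB, -⟩ := hμ.exists_sqrt
  have h (x : Site d) : jnorm μ x =
      ‖WithLp.toLp 2 ((B⁻¹.transpose).mulVec fun i => (x i : ℝ))‖ / Real.sqrt d := by
    rw [← sqrt_normSq_eq_norm, ← invCovForm_eq_normSq hB, ← Real.sqrt_div']
    · rfl
    · exact Nat.cast_nonneg d
  rw [h, h, h, ← add_div]
  refine div_le_div_of_nonneg_right (le_trans (le_of_eq ?_) (norm_add_le _ _)) (Real.sqrt_nonneg _)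
  rw [← WithLp.toLp_add, ← Matrix.mulVec_add]
  congr 3
  funext i
  simp

lemma jnorm_neg (μ : PMF (Site d)) (x : Site d) : jnorm μ (-x) = jnorm μ x := by
  have h : (fun i => ((-x) i : ℝ)) = -fun i => (x i : ℝ) := by
    funext i
    simp
  simp only [jnorm, h, Matrix.mulVec_neg, neg_dotProduct_neg]

lemma IsJumpLaw.exists_le_jnorm (hd : 1 ≤ d) {μ : PMF (Site d)} (hμ : IsJumpLaw μ) :
    ∃ c : ℝ, 0 < c ∧ ∀ x, c * euclNorm x ≤ jnorm μ x := by
  obtain ⟨c, hc, h⟩ := hμ.exists_invCovForm_ge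
  have hd' : (0 : ℝ) < d := by exact_mod_cast hd
  refine ⟨Real.sqrt (c / d), by positivity, fun x => ?_⟩
  rw [← Real.sqrt_sq (euclNorm_nonneg x), ← Real.sqrt_mul (by positivity)]
  refine Real.sqrt_le_sqrt ?_
  rw [div_mul_eq_mul_div]
  exact div_le_div_of_nonneg_right (h x) hd'.le

lemma tendsto_sub_atInfinity (z : Site d) :
    Tendsto (fun x => z - x) (atInfinity d) (atInfinity d) := by
  refine tendsto_comap_iff.2 (tendsto_atTop_mono (fun x => ?_)
    (tendsto_atTop_add_const_right _ (-euclNorm z) tendsto_euclNorm))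
  have h := euclNorm_le_add x z
  rw [euclNorm_sub_comm] at h
  simp only [Function.comp]
  linarith

lemma IsJumpLaw.tendsto_jnorm (hd : 1 ≤ d) {μ : PMF (Site d)} (hμ : IsJumpLaw μ) :
    Tendsto (jnorm μ) (atInfinity d) atTop := by
  obtain ⟨c, hc, h⟩ := hμ.exists_le_jnorm hd
  exact tendsto_atTop_mono h (tendsto_euclNorm.const_mul_atTop hc)

/-- The normalisation `𝒥(x)^(d-2)`. -/
def jweight (μ : PMF (Site d)) (x : Site d) : ℝ≥0∞ := ENNReal.ofReal (jnorm μ x ^ (d - 2))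

lemma jweight_ne_top (μ : PMF (Site d)) (x : Site d) : jweight μ x ≠ ∞ := ENNReal.ofReal_ne_top

lemma IsJumpLaw.tendsto_jweight_mul_green (hd : 5 ≤ d) {μ : PMF (Site d)} (hμ : IsJumpLaw μ)
    (hw : WeakLd μ) (z : Site d) :
    Tendsto (fun x => jweight μ x * green μ (z - x)) (atInfinity d)
      (𝓝 (ENNReal.ofReal (greenConst μ))) := by
  have h1 := (hμ.tendsto_green hd hw).comp (tendsto_sub_atInfinity z)
  have hJ := (hμ.tendsto_jnorm (by omega)).comp (tendsto_sub_atInfinity z)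
  -- `𝒥(x) / 𝒥(z - x)` tends to `1` by the triangle inequality
  have h2 : Tendsto (fun x => jnorm μ x / jnorm μ (z - x)) (atInfinity d) (𝓝 1) := by
    rw [tendsto_iff_norm_sub_tendsto_zero]
    refine squeeze_zero' (Eventually.of_forall fun _ => norm_nonneg _) ?_
      (hJ.const_div_atTop (jnorm μ z))
    filter_upwards [hJ.eventually_gt_atTop 0] with x hx
    simp only [Function.comp] at hx ⊢
    rw [div_sub_one hx.ne', norm_div, Real.norm_of_nonneg hx.le, Real.norm_eq_abs]
    refine div_le_div_of_nonneg_right (abs_le.2 ⟨?_, ?_⟩) hx.le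
    · have := hμ.jnorm_add_le z (-x)
      rw [← sub_eq_add_neg, jnorm_neg] at this
      linarith
    · have := hμ.jnorm_add_le (-(z - x)) z
      rw [jnorm_neg, neg_sub, sub_add_cancel] at this
      linarith
  have h3 := (h2.pow (d - 2)).mul h1
  rw [one_pow, one_mul] at h3
  refine (ENNReal.tendsto_ofReal h3).congr' ?_
  filter_upwards [hJ.eventually_gt_atTop 0] with x hx
  simp only [Function.comp] at hx ⊢
  rw [div_pow, div_mul_eq_mul_div, mul_div_assoc, mul_div_cancel_left₀ _ (pow_pos hx _).ne',
    ENNReal.ofReal_mul (pow_nonneg (jnorm_nonneg μ x) _),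
    ENNReal.ofReal_toReal (hμ.green_lt_top hd _).ne]
  rfl

lemma green_le_one_add (μ : PMF (Site d)) (x : Site d) : green μ x ≤ 1 + ∑' z, green μ z ^ 2 := by
  rcases le_total (green μ x) 1 with h | h
  · exact h.trans le_self_add
  · refine le_trans ?_ ((ENNReal.le_tsum (f := fun z => green μ z ^ 2) x).trans le_add_self)
    rw [sq]
    exact le_mul_of_one_le_left' h

/-- If `|w|` is at least a fixed multiple of `|x|`, the Green function at `w` is at most a constant
times `𝒥(x)^{2-d}`. -/
lemma IsJumpLaw.exists_jweight_mul_green_le (hd : 5 ≤ d) {μ : PMF (Site d)} (hμ : IsJumpLaw μ)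
    (hw : WeakLd μ) : ∃ C : ℝ≥0∞, C ≠ ∞ ∧ ∀ x w, euclNorm x ≤ 4 * euclNorm w →
      jweight μ x * green μ w ≤ C := by
  obtain ⟨c, hc, hcJ⟩ := hμ.exists_le_jnorm (by omega)
  obtain ⟨C, hC, hJC⟩ := exists_jnorm_le μ
  have h1 := hμ.tendsto_jweight_mul_green hd hw 0
  have h2 := (h1.comp (tendsto_sub_atInfinity 0)).eventually_le_const
    (ENNReal.lt_add_right ENNReal.ofReal_ne_top one_ne_zero)
  obtain ⟨R, hR⟩ := (eventually_comap.1 h2).exists_forall_of_atTop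
  have hG : 1 + ∑' z, green μ z ^ 2 ≠ ∞ :=
    (ENNReal.add_lt_top.2 ⟨ENNReal.one_lt_top, hμ.tsum_green_sq_lt_top hd⟩).ne
  refine ⟨ENNReal.ofReal ((4 * C / c) ^ (d - 2)) * (ENNReal.ofReal (greenConst μ) + 1) +
    ENNReal.ofReal ((C * (4 * R)) ^ (d - 2)) * (1 + ∑' z, green μ z ^ 2), by finiteness,
    fun x w hxw => ?_⟩
  rcases le_total R (euclNorm w) with hw | hw
  · refine le_trans ?_ le_self_add
    have h3 : jweight μ x ≤ ENNReal.ofReal ((4 * C / c) ^ (d - 2)) * jweight μ w := by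
      rw [jweight, jweight, ← ENNReal.ofReal_mul (by positivity), ← mul_pow]
      refine ENNReal.ofReal_le_ofReal (pow_le_pow_left₀ (jnorm_nonneg μ x) ?_ _)
      calc jnorm μ x ≤ C * (4 * euclNorm w) := (hJC x).trans (by gcongr)
        _ = 4 * C / c * (c * euclNorm w) := by field_simp
        _ ≤ _ := by gcongr; exact hcJ w
    have h4 := hR _ hw w rfl
    simp only [Function.comp, zero_sub, neg_neg] at h4
    have h5 : jweight μ (-w) = jweight μ w := by rw [jweight, jweight, jnorm_neg]
    rw [h5] at h4
    calc _ ≤ _ := mul_le_mul_left h3 _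
      _ ≤ _ := by rw [mul_assoc]; exact mul_le_mul_right h4 _
  · refine le_trans ?_ le_add_self
    refine mul_le_mul' (ENNReal.ofReal_le_ofReal (pow_le_pow_left₀ (jnorm_nonneg μ x) ?_ _))
      (green_le_one_add μ w)
    refine (hJC x).trans ?_
    gcongr
    linarith

/-! ### Large deviations of the walk at a fixed time -/

/-- The probability that the walk is at distance more than `R` of its starting point at time
`n`. -/
def tailMass (μ : PMF (Site d)) (n : ℕ) (R : ℝ) : ℝ≥0∞ :=
  ∑' z, if R < euclNorm z then convPow μ n z else 0

lemma tailMass_le_one (μ : PMF (Site d)) (n : ℕ) (R : ℝ) : tailMass μ n R ≤ 1 := by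
  rw [← tsum_convPow μ.tsum_coe n]
  refine ENNReal.tsum_le_tsum fun z => ?_
  split_ifs <;> simp

lemma tailMass_one (μ : PMF (Site d)) (R : ℝ) : tailMass μ 1 R = ∑' z, bigLaw μ R z := by
  refine tsum_congr fun z => ?_
  rw [convPow_one, bigLaw]
  by_cases h : euclNorm z ≤ R
  · rw [if_pos h, if_neg (not_lt.2 h)]
  · rw [if_neg h, if_pos (not_le.1 h)]

/-- A sum larger than `R` has a first term or a remainder larger than `R / 2`. -/
lemma tailMass_succ_le (μ : PMF (Site d)) (n : ℕ) (R : ℝ) :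
    tailMass μ (n + 1) R ≤ tailMass μ 1 (R / 2) + tailMass μ n (R / 2) := by
  have hshift (g : Site d → ℝ≥0∞) (w : Site d) : ∑' z, g (z - w) = ∑' z, g z :=
    (Equiv.subRight w).tsum_eq g
  have h1 : ∑' z, ∑' w, (if R / 2 < euclNorm w then μ w else 0) * convPow μ n (z - w) =
      tailMass μ 1 (R / 2) := by
    rw [ENNReal.tsum_comm]
    simp_rw [ENNReal.tsum_mul_left]
    refine tsum_congr fun w => ?_
    rw [hshift (convPow μ n) w, tsum_convPow μ.tsum_coe, mul_one, convPow_one]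
  have h2 : ∑' z, ∑' w, μ w * (if R / 2 < euclNorm (z - w) then convPow μ n (z - w) else 0) =
      tailMass μ n (R / 2) := by
    rw [ENNReal.tsum_comm]
    simp_rw [ENNReal.tsum_mul_left]
    simp_rw [hshift fun z => if R / 2 < euclNorm z then convPow μ n z else 0]
    rw [ENNReal.tsum_mul_right, μ.tsum_coe, one_mul, tailMass]
  rw [← h1, ← h2, ← ENNReal.tsum_add, tailMass]
  refine ENNReal.tsum_le_tsum fun z => ?_
  rw [← ENNReal.tsum_add]
  split_ifs with hz
  · rw [convPow, latticeConv]
    refine ENNReal.tsum_le_tsum fun w => ?_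
    by_cases hw : R / 2 < euclNorm w
    · rw [if_pos hw]
      exact le_self_add
    · have : R / 2 < euclNorm (z - w) := by
        have := euclNorm_le_add z w
        linarith
      rw [if_pos this]
      exact le_add_self
  · exact zero_le

/-- The tail condition on the jump law passes to its convolution powers. -/
lemma WeakLd.exists_tailMass_le {μ : PMF (Site d)} (hw : WeakLd μ) (n : ℕ) :
    ∃ C : ℝ≥0∞, C ≠ ∞ ∧ ∀ R : ℝ, 0 ≤ R → ENNReal.ofReal (R ^ d) * tailMass μ n R ≤ C := by
  have hone : ∃ C : ℝ≥0∞, C ≠ ∞ ∧ ∀ R : ℝ, 0 ≤ R → ENNReal.ofReal (R ^ d) * tailMass μ 1 R ≤ C := by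
    obtain ⟨C, hC, h⟩ := hw.exists_tsum_bigLaw_le
    refine ⟨ENNReal.ofReal C + 1, by finiteness, fun R hR => ?_⟩
    rcases le_total 1 R with h1 | h1
    · refine le_trans ?_ le_self_add
      rw [tailMass_one]
      refine (mul_le_mul_right (h R h1) _).trans (le_of_eq ?_)
      rw [← ENNReal.ofReal_mul (by positivity)]
      congr 1
      field_simp
    · refine le_trans ?_ le_add_self
      refine mul_le_one' ?_ (tailMass_le_one μ 1 R)
      exact ENNReal.ofReal_le_one.2 (pow_le_one₀ hR h1)
  induction n with
  | zero =>
    refine ⟨0, by simp, fun R hR => ?_⟩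
    have : tailMass μ 0 R = 0 := by
      refine ENNReal.tsum_eq_zero.2 fun z => ?_
      split_ifs with hz
      · rw [convPow, Pi.single_apply, if_neg]
        rintro rfl
        rw [euclNorm_zero] at hz
        exact absurd hR (not_le.2 hz)
      · rfl
    simp [this]
  | succ n ih =>
    obtain ⟨C₁, hC₁, h₁⟩ := hone
    obtain ⟨C, hC, h⟩ := ih
    refine ⟨ENNReal.ofReal (2 ^ d) * (C₁ + C), by finiteness, fun R hR => ?_⟩
    have hR2 : ENNReal.ofReal (R ^ d) = ENNReal.ofReal (2 ^ d) * ENNReal.ofReal ((R / 2) ^ d) := by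
      rw [← ENNReal.ofReal_mul (by positivity), ← mul_pow]
      congr 2
      ring
    calc _ ≤ ENNReal.ofReal (R ^ d) * (tailMass μ 1 (R / 2) + tailMass μ n (R / 2)) :=
          mul_le_mul_right (tailMass_succ_le μ n R) _
      _ ≤ _ := by
          rw [hR2, mul_assoc, mul_add]
          exact mul_le_mul_right (add_le_add (h₁ _ (by positivity)) (h _ (by positivity))) _

/-- At a fixed time the walk started from `y` is unlikely to be closer to `x` than half the norm
of `x`. -/
lemma WeakLd.tendsto_jweight_mul_near {μ : PMF (Site d)} (hd : 3 ≤ d) (hw : WeakLd μ) (m : ℕ)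
    (y : Site d) :
    Tendsto (fun x => jweight μ x * ∑' z, if 2 * euclNorm (z - x) < euclNorm x then
      convPow μ m (y - z) else 0) (atInfinity d) (𝓝 0) := by
  obtain ⟨C, hC, h⟩ := hw.exists_tailMass_le m
  obtain ⟨C₁, hC₁, hJ⟩ := exists_jnorm_le μ
  have hlim : Tendsto (fun x => ENNReal.ofReal ((4 ^ d * C₁ ^ (d - 2)) * (euclNorm x ^ 2)⁻¹) * C)
      (atInfinity d) (𝓝 0) := by
    have h1 : Tendsto (fun x : Site d => (4 ^ d * C₁ ^ (d - 2)) * (euclNorm x ^ 2)⁻¹)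
        (atInfinity d) (𝓝 (4 ^ d * C₁ ^ (d - 2) * 0)) :=
      (tendsto_inv_atTop_zero.comp ((tendsto_pow_atTop two_ne_zero).comp
        tendsto_euclNorm)).const_mul _
    rw [mul_zero] at h1
    have h2 := ENNReal.Tendsto.mul_const (ENNReal.tendsto_ofReal h1) (Or.inr hC)
    rwa [ENNReal.ofReal_zero, zero_mul] at h2
  refine tendsto_of_tendsto_of_tendsto_of_le_of_le' tendsto_const_nhds hlim
    (Eventually.of_forall fun _ => zero_le) ?_
  filter_upwards [tendsto_euclNorm.eventually_ge_atTop (4 * euclNorm y),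
    tendsto_euclNorm.eventually_gt_atTop 0] with x hx hx0
  have h1 : ∑' z, (if 2 * euclNorm (z - x) < euclNorm x then convPow μ m (y - z) else 0) ≤
      tailMass μ m (euclNorm x / 4) := by
    rw [tailMass, ← (Equiv.subLeft y).tsum_eq
      fun z => if euclNorm x / 4 < euclNorm z then convPow μ m z else 0]
    refine ENNReal.tsum_le_tsum fun z => ?_
    simp only [Equiv.subLeft_apply]
    split_ifs with h1 h2
    · exact le_rfl
    · exfalso
      have h3 := euclNorm_le_add x z
      have h4 := euclNorm_le_add z y
      rw [euclNorm_sub_comm] at h3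
      rw [euclNorm_sub_comm] at h4
      linarith
    · exact zero_le
    · exact le_rfl
  have h2 : jweight μ x ≤ ENNReal.ofReal ((4 ^ d * C₁ ^ (d - 2)) * (euclNorm x ^ 2)⁻¹) *
      ENNReal.ofReal ((euclNorm x / 4) ^ d) := by
    rw [jweight, ← ENNReal.ofReal_mul (by positivity)]
    refine ENNReal.ofReal_le_ofReal ((pow_le_pow_left₀ (jnorm_nonneg μ x) (hJ x) _).trans
      (le_of_eq ?_))
    have hrd : euclNorm x ^ d = euclNorm x ^ (d - 2) * euclNorm x ^ 2 := by
      rw [← pow_add]; congr 1; omega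
    rw [mul_pow, div_pow, hrd]
    field_simp
  calc _ ≤ _ := mul_le_mul' h2 h1
    _ ≤ _ := by rw [mul_assoc]; exact mul_le_mul_right (h _ (by positivity)) _

lemma WeakLd.tendsto_jweight_mul_convPow {μ : PMF (Site d)} (hd : 3 ≤ d) (hw : WeakLd μ) (m : ℕ)
    (y : Site d) : Tendsto (fun x => jweight μ x * convPow μ m (y - x)) (atInfinity d) (𝓝 0) := by
  refine tendsto_of_tendsto_of_tendsto_of_le_of_le' tendsto_const_nhds
    (hw.tendsto_jweight_mul_near hd m y) (Eventually.of_forall fun _ => zero_le) ?_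
  filter_upwards [tendsto_euclNorm.eventually_gt_atTop 0] with x hx0
  refine mul_le_mul_right (le_trans ?_ (ENNReal.le_tsum x)) _
  rw [sub_self, euclNorm_zero, mul_zero, if_pos hx0]

/-! ### The convolution of the Green function with itself -/

lemma mul_le_mul_sq_add (a b : ℝ≥0∞) {t : ℝ≥0∞} (ht : t ≠ 0) (ht' : t ≠ ∞) :
    a * b ≤ t * a ^ 2 + t⁻¹ * b ^ 2 := by
  rcases le_total (t * a) b with h | h
  · refine le_trans ?_ le_add_self
    have : a ≤ t⁻¹ * b := by
      rw [← ENNReal.mul_le_iff_le_inv ht ht']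
      exact h
    rw [sq, ← mul_assoc]
    exact mul_le_mul_left this b
  · refine le_trans ?_ le_self_add
    rw [sq, mul_comm a b, ← mul_assoc]
    exact mul_le_mul_left h a

lemma IsJumpLaw.tendsto_green_zero (hd : 5 ≤ d) {μ : PMF (Site d)} (hμ : IsJumpLaw μ)
    (hw : WeakLd μ) (z : Site d) : Tendsto (fun x => green μ (z - x)) (atInfinity d) (𝓝 0) := by
  have h1 := hμ.tendsto_jweight_mul_green hd hw z
  have hJ := hμ.tendsto_jnorm (by omega)
  have h2 : Tendsto (fun x => (jweight μ x)⁻¹) (atInfinity d) (𝓝 0) := by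
    refine tendsto_inv_iff.1 ?_
    simp only [inv_inv, ENNReal.inv_zero]
    exact ENNReal.tendsto_ofReal_nhds_top.2 ((tendsto_pow_atTop (by omega)).comp hJ)
  have h3 := ENNReal.Tendsto.mul h2 (Or.inr ENNReal.ofReal_ne_top) h1 (Or.inr ENNReal.zero_ne_top)
  rw [zero_mul] at h3
  refine h3.congr' ?_
  filter_upwards [hJ.eventually_gt_atTop 0] with x hx
  rw [← mul_assoc, ENNReal.inv_mul_cancel, one_mul]
  · simpa [jweight] using pow_pos hx (d - 2)
  · exact jweight_ne_top μ x

/-- The convolution of two square summable functions vanishes at infinity. -/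
lemma IsJumpLaw.tendsto_green_conv_green (hd : 5 ≤ d) {μ : PMF (Site d)} (hμ : IsJumpLaw μ)
    (hw : WeakLd μ) (y : Site d) :
    Tendsto (fun x => ∑' z, green μ (y - z) * green μ (z - x)) (atInfinity d) (𝓝 0) := by
  obtain ⟨A, hA⟩ : ∃ A, A = ∑' z, green μ z ^ 2 := ⟨_, rfl⟩
  have hA' : A ≠ ∞ := hA ▸ (hμ.tsum_green_sq_lt_top hd).ne
  have hAy : ∑' z, green μ (y - z) ^ 2 = A :=
    ((Equiv.subLeft y).tsum_eq fun z => green μ z ^ 2).trans hA.symm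
  have hAx (x : Site d) : ∑' z, green μ (z - x) ^ 2 = A :=
    ((Equiv.subRight x).tsum_eq fun z => green μ z ^ 2).trans hA.symm
  rw [ENNReal.tendsto_nhds_zero]
  intro ε hε
  rcases eq_or_ne ε ∞ with rfl | hε'
  · exact Eventually.of_forall fun _ => le_top
  have hε3 : 0 < ε / 3 := ENNReal.div_pos hε.ne' (by simp)
  -- outside a finite set `s` use `a b ≤ t a² + b² / t`: `t` is chosen first, to make the second
  -- term small, and `s` next, to make the first one small; on `s` use pointwise convergence
  obtain ⟨t, ht, ht', htA⟩ : ∃ t : ℝ≥0∞, t ≠ 0 ∧ t ≠ ∞ ∧ t⁻¹ * A ≤ ε / 3 := by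
    refine ⟨(A + 1) / (ε / 3), ?_, ?_, ?_⟩
    · exact (ENNReal.div_pos (by simp) (ENNReal.div_lt_top hε' (by simp)).ne).ne'
    · exact (ENNReal.div_lt_top (by finiteness) hε3.ne').ne
    · rw [ENNReal.inv_div (Or.inl (ENNReal.div_lt_top hε' (by simp)).ne) (Or.inl hε3.ne')]
      calc ε / 3 / (A + 1) * A ≤ ε / 3 / (A + 1) * (A + 1) := by gcongr; exact le_self_add
        _ = ε / 3 := ENNReal.div_mul_cancel (by simp) (by finiteness)
  have htail := ENNReal.tendsto_tsum_compl_atTop_zero (f := fun z => green μ (y - z) ^ 2)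
    (by rw [hAy]; exact hA')
  obtain ⟨s, hs⟩ := (htail.eventually_le_const (u := ε / 3 / t)
    (ENNReal.div_pos hε3.ne' ht')).exists
  have hfin : Tendsto (fun x => ∑ z ∈ s, green μ (y - z) * green μ (z - x)) (atInfinity d)
      (𝓝 (∑ z ∈ s, green μ (y - z) * 0)) :=
    tendsto_finsetSum _ fun z _ => ENNReal.Tendsto.const_mul (hμ.tendsto_green_zero hd hw z)
      (Or.inr (hμ.green_lt_top hd _).ne)
  simp only [mul_zero, Finset.sum_const_zero] at hfin
  filter_upwards [hfin.eventually_le_const hε3] with x hx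
  have hsplit : ∑' z, green μ (y - z) * green μ (z - x) =
      ∑ z ∈ s, green μ (y - z) * green μ (z - x) +
        ∑' z : {z // z ∉ s}, green μ (y - z) * green μ (z - x) :=
    (ENNReal.sum_add_tsum_compl s fun z => green μ (y - z) * green μ (z - x)).symm
  have h2 : ∑' z : {z // z ∉ s}, green μ (y - z) * green μ (z - x) ≤
      t * (ε / 3 / t) + t⁻¹ * A := by
    calc _ ≤ ∑' z : {z // z ∉ s}, (t * green μ (y - z) ^ 2 + t⁻¹ * green μ (z - x) ^ 2) :=
          ENNReal.tsum_le_tsum fun z => mul_le_mul_sq_add _ _ ht ht'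
      _ = t * ∑' z : {z // z ∉ s}, green μ (y - z) ^ 2 +
          t⁻¹ * ∑' z : {z // z ∉ s}, green μ (z - x) ^ 2 := by
          rw [ENNReal.tsum_add, ENNReal.tsum_mul_left, ENNReal.tsum_mul_left]
      _ ≤ _ := by
          refine add_le_add (mul_le_mul_right hs t) (mul_le_mul_right ?_ t⁻¹)
          rw [← hAx x]
          exact ENNReal.tsum_comp_le_tsum_of_injective Subtype.val_injective
            fun z => green μ (z - x) ^ 2
  calc _ = _ := hsplit
    _ ≤ ε / 3 + (t * (ε / 3 / t) + t⁻¹ * A) := add_le_add hx h2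
    _ ≤ ε / 3 + (ε / 3 + ε / 3) := add_le_add le_rfl (add_le_add ENNReal.mul_div_le htA)
    _ = ε := by rw [← add_assoc, ENNReal.add_thirds]

/-! ### Asymptotics of sums along the spine -/

instance : (atInfinity d).IsCountablyGenerated := by unfold atInfinity; infer_instance

/-- Summation over the time at which the spine is at `x`, given its first `m` steps. -/
lemma tsum_lintegral_ite_spinePos (p : PMF ℕ) (hp : offspringMean p = 1) (μ : PMF (Site d))
    {f : Spine d → ℝ≥0∞} (hf : Measurable f) {m : ℕ} (hfm : ∀ k, m ≤ k → ∀ b, f (dropStep k b) = f b)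
    (y x : Site d) :
    ∑' r, ∫⁻ b, (if spinePos y b (m + r) = x then f b else 0) ∂(spineLaw p hp μ) =
      ∫⁻ b, f b * green μ (spinePos y b m - x) ∂(spineLaw p hp μ) := by
  simp_rw [lintegral_ite_spinePos p hp μ hf hfm y x]
  have hm (r : ℕ) : Measurable fun b : Spine d => f b * convPow μ r (spinePos y b m - x) :=
    hf.mul ((Measurable.of_discrete (f := convPow μ r)).comp (by fun_prop))
  rw [← lintegral_tsum fun r => (hm r).aemeasurable]
  simp_rw [ENNReal.tsum_mul_left]
  rfl

/-- The expected number of pairs formed of a visit to `K` attached to the spine after step `m`, and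
of a later time at which the spine is at `x`. -/
def spineError (p : PMF ℕ) (μ : PMF (Site d)) (K : Finset (Site d)) (y : Site d) (m : ℕ)
    (x : Site d) : ℝ≥0∞ :=
  ∑' k, ∑' z, convPow μ (m + k + 1) (y - z) * (meanStepVisits p μ K z * green μ (z - x))

/-- Each visit attached to the spine after step `m` is counted with the later passages of the spine
at `x`, whose mean number is a Green function. -/
lemma tsum_lintegral_stepVisits (p : PMF ℕ) (hp : offspringMean p = 1) (μ : PMF (Site d))
    (K : Finset (Site d)) (y x : Site d) (m : ℕ) :
    ∑' r, ∫⁻ b, (if spinePos y b (m + r) = x then ∑ k ∈ Finset.range r, stepVisits K y (m + k) b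
      else 0) ∂(spineLaw p hp μ) = spineError p μ K y m x := by
  have hm (r k : ℕ) : Measurable fun b : Spine d =>
      if spinePos y b (m + r) = x then stepVisits K y (m + k) b else 0 :=
    Measurable.ite (measurableSet_eq_fun (by fun_prop) (by fun_prop)) (by fun_prop)
      measurable_const
  calc _ = ∑' r, ∑ k ∈ Finset.range r, ∫⁻ b, (if spinePos y b (m + r) = x then
        stepVisits K y (m + k) b else 0) ∂(spineLaw p hp μ) := by
        refine tsum_congr fun r => ?_
        rw [← lintegral_finsetSum _ fun k _ => hm r k]
        refine lintegral_congr fun b => ?_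
        split_ifs <;> simp
    _ = _ := by
        rw [tsum_sum_range fun r k => ∫⁻ b, (if spinePos y b (m + r) = x then
          stepVisits K y (m + k) b else 0) ∂(spineLaw p hp μ), ENNReal.tsum_prod', spineError]
        refine tsum_congr fun k => ?_
        rw [← lintegral_stepVisits_mul p hp μ K (fun z => green μ (z - x)) y (m + k),
          ← tsum_lintegral_ite_spinePos p hp μ (measurable_stepVisits K y (m + k)) (m := m + k + 1)
            (fun n hn b => stepVisits_dropStep K y hn b)]
        refine tsum_congr fun j => ?_
        rw [show m + (k + j + 1) = m + k + 1 + j by ring]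

/-- Splitting according to whether the spine is, at time `m`, closer to `x` than half the norm of
`x`. -/
lemma lintegral_mul_jweight (p : PMF ℕ) (hp : offspringMean p = 1) (μ : PMF (Site d))
    {f : Spine d → ℝ≥0∞} (hf : Measurable f) (y x : Site d) (m : ℕ) :
    jweight μ x * ∫⁻ b, f b * green μ (spinePos y b m - x) ∂(spineLaw p hp μ) =
      ∫⁻ b, f b * (if 2 * euclNorm (spinePos y b m - x) < euclNorm x then 0 else
          jweight μ x * green μ (spinePos y b m - x)) ∂(spineLaw p hp μ) +
        ∫⁻ b, f b * (if 2 * euclNorm (spinePos y b m - x) < euclNorm x then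
          jweight μ x * green μ (spinePos y b m - x) else 0) ∂(spineLaw p hp μ) := by
  have h1 : Measurable fun z : Site d => if 2 * euclNorm (z - x) < euclNorm x then 0 else
      jweight μ x * green μ (z - x) := .of_discrete
  have h2 : Measurable fun b : Spine d => f b *
      (if 2 * euclNorm (spinePos y b m - x) < euclNorm x then 0 else
          jweight μ x * green μ (spinePos y b m - x)) :=
    hf.mul (h1.comp (measurable_spinePos y m))
  have h3 : Measurable fun b : Spine d => f b * green μ (spinePos y b m - x) :=
    hf.mul ((Measurable.of_discrete (f := fun z => green μ (z - x))).comp (measurable_spinePos y m))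
  rw [← lintegral_add_left h2, ← lintegral_const_mul _ h3]
  refine lintegral_congr fun b => ?_
  split_ifs <;> ring

/-- A function of the first `m` steps of the spine is asymptotically independent of a later visit of
the spine to a distant point. -/
lemma IsJumpLaw.tendsto_jweight_mul_lintegral (hd : 5 ≤ d) (p : PMF ℕ) (hp : offspringMean p = 1)
    {μ : PMF (Site d)} (hμ : IsJumpLaw μ) (hw : WeakLd μ) {f : Spine d → ℝ≥0∞} (hf : Measurable f)
    {M : ℝ≥0∞} (hM : M ≠ ∞) (hfM : ∀ b, f b ≤ M) (y : Site d) (m : ℕ) :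
    Tendsto (fun x => jweight μ x * ∫⁻ b, f b * green μ (spinePos y b m - x) ∂(spineLaw p hp μ))
      (atInfinity d) (𝓝 (ENNReal.ofReal (greenConst μ) * ∫⁻ b, f b ∂(spineLaw p hp μ))) := by
  obtain ⟨C, hC, hCg⟩ := hμ.exists_jweight_mul_green_le hd hw
  simp_rw [lintegral_mul_jweight p hp μ hf]
  rw [← add_zero (ENNReal.ofReal (greenConst μ) * _)]
  refine Tendsto.add ?_ ?_
  · rw [mul_comm, ← lintegral_mul_const _ hf]
    -- spine far from `x` at time `m`: the rescaled Green function is bounded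
    refine tendsto_lintegral_filter_of_dominated_convergence (fun _ => M * C) ?_ ?_ ?_ ?_
    · refine Eventually.of_forall fun x => hf.mul ?_
      exact (Measurable.of_discrete (f := fun z => if 2 * euclNorm (z - x) < euclNorm x then 0 else
        jweight μ x * green μ (z - x))).comp (measurable_spinePos y m)
    · refine Eventually.of_forall fun x => Eventually.of_forall fun b => mul_le_mul' (hfM b) ?_
      split_ifs with h
      · exact zero_le
      · exact hCg _ _ (by linarith [euclNorm_nonneg (spinePos y b m - x)])
    · simpa using ENNReal.mul_ne_top hM hC
    · refine Eventually.of_forall fun b => ENNReal.Tendsto.const_mul ?_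
        (Or.inr ((hfM b).trans_lt hM.lt_top).ne)
      refine (hμ.tendsto_jweight_mul_green hd hw (spinePos y b m)).congr' ?_
      filter_upwards [tendsto_euclNorm.eventually_ge_atTop (2 * euclNorm (spinePos y b m))] with x hx
      rw [if_neg]
      have := euclNorm_le_add x (spinePos y b m)
      rw [euclNorm_sub_comm] at this
      linarith
  -- spine close to `x` at time `m`: the Green function is bounded, and this event is unlikely
  · have h1 := ENNReal.Tendsto.const_mul (hw.tendsto_jweight_mul_near (by omega) m y)
      (Or.inr (ENNReal.mul_ne_top hM (ENNReal.add_lt_top.2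
        ⟨ENNReal.one_lt_top, hμ.tsum_green_sq_lt_top hd⟩).ne))
    rw [mul_zero] at h1
    refine tendsto_of_tendsto_of_tendsto_of_le_of_le tendsto_const_nhds h1
      (fun _ => zero_le) fun x => ?_
    have h2 := lintegral_comp_spinePos p hp μ
      (fun z => if 2 * euclNorm (z - x) < euclNorm x then 1 else 0) y m
    simp only [mul_ite, mul_one, mul_zero] at h2
    have h3 : Measurable fun b : Spine d =>
        if 2 * euclNorm (spinePos y b m - x) < euclNorm x then (1 : ℝ≥0∞) else 0 :=
      (Measurable.of_discrete (f := fun z : Site d => if 2 * euclNorm (z - x) < euclNorm x then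
        (1 : ℝ≥0∞) else 0)).comp (measurable_spinePos y m)
    calc _ ≤ ∫⁻ b, M * (1 + ∑' z, green μ z ^ 2) * jweight μ x *
          (if 2 * euclNorm (spinePos y b m - x) < euclNorm x then 1 else 0) ∂(spineLaw p hp μ) := by
          refine lintegral_mono fun b => ?_
          dsimp only
          split_ifs
          · rw [mul_one, mul_assoc, mul_comm (1 + _)]
            exact mul_le_mul' (hfM b) (mul_le_mul_right (green_le_one_add μ _) _)
          · simp
      _ = _ := by rw [lintegral_const_mul _ h3, h2, mul_assoc]

lemma IsJumpLaw.tendsto_tsum_meanStepVisits (hd : 5 ≤ d) (p : PMF ℕ) (hp : offspringMean p = 1)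
    (hvar : offspringVariance p < ∞) {μ : PMF (Site d)} (hμ : IsJumpLaw μ) (hw : WeakLd μ)
    (K : Finset (Site d)) :
    Tendsto (fun x => ∑' z, meanStepVisits p μ K z * green μ (z - x)) (atInfinity d) (𝓝 0) := by
  have h1 : Tendsto (fun x => (1 + 2 * offspringVariance p) *
      ∑ y ∈ K, ∑' z, green μ (y - z) * green μ (z - x)) (atInfinity d)
      (𝓝 ((1 + 2 * offspringVariance p) * ∑ y ∈ K, 0)) :=
    ENNReal.Tendsto.const_mul (tendsto_finsetSum _ fun y _ => hμ.tendsto_green_conv_green hd hw y)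
      (Or.inr (ENNReal.add_lt_top.2 ⟨ENNReal.one_lt_top, ENNReal.mul_lt_top (by simp) hvar⟩).ne)
  rw [Finset.sum_const_zero, mul_zero] at h1
  refine tendsto_of_tendsto_of_tendsto_of_le_of_le tendsto_const_nhds h1
    (fun _ => zero_le) fun x => ?_
  dsimp only
  rw [← Summable.tsum_finsetSum fun _ _ => ENNReal.summable, ← ENNReal.tsum_mul_left]
  refine ENNReal.tsum_le_tsum fun z => ?_
  rw [← Finset.sum_mul, ← mul_assoc]
  exact mul_le_mul_left (meanStepVisits_le p hp μ K z) _

/-- Late visits attached to the spine are negligible, uniformly in the distance of `x`. When the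
visit is attached far from `x`, the Green function from there to `x` is of order `|x|^(2-d)`;
when it is attached near `x`, the Green function from `y` is of this order, and the mean number of
visits is small. -/
lemma IsJumpLaw.exists_jweight_mul_spineError_le (hd : 5 ≤ d) (p : PMF ℕ)
    (hp : offspringMean p = 1) (hvar : offspringVariance p < ∞) {μ : PMF (Site d)}
    (hμ : IsJumpLaw μ) (hw : WeakLd μ) (K : Finset (Site d)) (y : Site d) :
    ∃ e : ℕ → ℝ≥0∞, Tendsto e atTop (𝓝 0) ∧
      ∀ m, ∀ᶠ x in atInfinity d, jweight μ x * spineError p μ K y m x ≤ e m := by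
  obtain ⟨C, hC, hCg⟩ := hμ.exists_jweight_mul_green_le hd hw
  set U : ℕ → ℝ≥0∞ := fun m => ∑' k, ∑' z, convPow μ (k + m + 1) (y - z) * meanStepVisits p μ K z
    with hU
  have hU0 : Tendsto U atTop (𝓝 0) := by
    refine ENNReal.tendsto_sum_nat_add
      (fun k => ∑' z, convPow μ (k + 1) (y - z) * meanStepVisits p μ K z) (ne_of_lt ?_)
    refine lt_of_le_of_lt ?_ (tsum_green_mul_meanStepVisits_lt_top hd p hp hvar μ hμ K y)
    rw [ENNReal.tsum_comm]
    refine ENNReal.tsum_le_tsum fun z => ?_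
    rw [ENNReal.tsum_mul_right]
    refine mul_le_mul_left ?_ _
    simp_rw [add_comm _ 1]
    exact tsum_convPow_add_le_green μ 1 _
  refine ⟨fun m => C * U m + (m : ℝ≥0∞)⁻¹, ?_, fun m => ?_⟩
  · have h1 := (ENNReal.Tendsto.const_mul hU0 (Or.inr hC)).add ENNReal.tendsto_inv_nat_nhds_zero
    rwa [mul_zero, add_zero] at h1
  · have h1 := ENNReal.Tendsto.const_mul (hμ.tendsto_tsum_meanStepVisits hd p hp hvar hw K)
      (Or.inr hC)
    rw [mul_zero] at h1
    filter_upwards [h1.eventually_le_const (u := (m : ℝ≥0∞)⁻¹) (by simp),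
      tendsto_euclNorm.eventually_ge_atTop (4 * euclNorm y)] with x hx hxy
    refine le_trans ?_ (add_le_add le_rfl hx)
    simp only [spineError, hU]
    rw [ENNReal.tsum_comm, ENNReal.tsum_comm (f := fun k z =>
      convPow μ (k + m + 1) (y - z) * meanStepVisits p μ K z), ← ENNReal.tsum_mul_left,
      ← ENNReal.tsum_mul_left, ← ENNReal.tsum_mul_left, ← ENNReal.tsum_add]
    refine ENNReal.tsum_le_tsum fun z => ?_
    rw [ENNReal.tsum_mul_right, ENNReal.tsum_mul_right]
    have hcomm : ∑' k, convPow μ (k + m + 1) (y - z) = ∑' k, convPow μ (m + k + 1) (y - z) :=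
      tsum_congr fun k => by rw [add_comm k m]
    rw [hcomm]
    set c := ∑' k, convPow μ (m + k + 1) (y - z) with hc
    by_cases hz : 2 * euclNorm (z - x) < euclNorm x
    · refine le_trans ?_ le_add_self
      have hcg : c ≤ green μ (y - z) := by
        rw [hc]
        simp_rw [add_right_comm m _ 1]
        exact tsum_convPow_add_le_green μ (m + 1) _
      have h3 := euclNorm_le_add x z
      have h4 := euclNorm_le_add z y
      rw [euclNorm_sub_comm] at h3 h4
      calc jweight μ x * (c * (meanStepVisits p μ K z * green μ (z - x)))
          = jweight μ x * c * (meanStepVisits p μ K z * green μ (z - x)) := by ring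
        _ ≤ C * (meanStepVisits p μ K z * green μ (z - x)) := by
          refine mul_le_mul_left ((mul_le_mul_right hcg _).trans (hCg _ _ ?_)) _
          linarith
    · refine le_trans ?_ le_self_add
      calc jweight μ x * (c * (meanStepVisits p μ K z * green μ (z - x)))
          = jweight μ x * green μ (z - x) * (c * meanStepVisits p μ K z) := by ring
        _ ≤ _ := by
          refine mul_le_mul_left (hCg _ _ ?_) _
          linarith [euclNorm_nonneg (z - x)]

lemma atInfinity_neBot (hd : 1 ≤ d) : (atInfinity d).NeBot := by
  refine comap_neBot_iff.2 fun t ht => ?_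
  obtain ⟨R, hR⟩ := mem_atTop_sets.1 ht
  obtain ⟨n, hn⟩ := exists_nat_ge R
  refine ⟨Pi.single ⟨0, hd⟩ (n : ℤ), hR _ (hn.trans ?_)⟩
  have h := Finset.single_le_sum
    (f := fun i => (((Pi.single ⟨0, hd⟩ (n : ℤ) : Site d) i : ℤ) : ℝ) ^ 2)
    (fun _ _ => sq_nonneg _) (Finset.mem_univ (⟨0, hd⟩ : Fin d))
  refine Real.le_sqrt_of_sq_le ?_
  simpa using h

/-- Convergence of `F` to the limit of `a`, when `F` is at distance at most `e m` of `a m` near the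
filter. -/
lemma tendsto_of_forall_eventually_le {α : Type*} {l : Filter α} [l.NeBot] {F : α → ℝ≥0∞}
    {a e : ℕ → ℝ≥0∞} {L : ℝ≥0∞} (hL : L ≠ ∞) (ha : Tendsto a atTop (𝓝 L))
    (he : Tendsto e atTop (𝓝 0)) (h1 : ∀ m, ∀ᶠ x in l, F x ≤ a m + e m)
    (h2 : ∀ m, ∀ᶠ x in l, a m ≤ F x + e m) : Tendsto F l (𝓝 L) := by
  refine tendsto_of_le_liminf_of_limsup_le ?_ ?_
  · have h3 := ENNReal.Tendsto.sub ha he (Or.inl hL)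
    rw [tsub_zero] at h3
    refine le_of_tendsto' h3 fun m => le_liminf_of_le (by isBoundedDefault) ?_
    filter_upwards [h2 m] with x hx
    exact tsub_le_iff_right.2 hx
  · have h3 := ha.add he
    rw [add_zero] at h3
    exact ge_of_tendsto' h3 fun m => limsup_le_of_le (by isBoundedDefault) (h1 m)

/-- If `g` is bounded and changes only at steps with visits, its variation is bounded by the number
of visits. -/
lemma le_add_of_stepVisits {K : Finset (Site d)} {y : Site d} {g : ℕ → Spine d → ℝ≥0∞} {M : ℝ≥0∞}
    (hgM : ∀ n b, g n b ≤ M) (hstep : ∀ n b, stepVisits K y n b = 0 → g (n + 1) b = g n b)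
    (m r : ℕ) (b : Spine d) :
    g (m + r) b ≤ g m b + M * ∑ k ∈ Finset.range r, stepVisits K y (m + k) b ∧
      g m b ≤ g (m + r) b + M * ∑ k ∈ Finset.range r, stepVisits K y (m + k) b := by
  by_cases h : ∀ k ∈ Finset.range r, stepVisits K y (m + k) b = 0
  · have heq : ∀ r' ≤ r, g (m + r') b = g m b := fun r' => by
      induction r' with
      | zero => exact fun _ => rfl
      | succ k ih =>
        intro hk
        rw [← add_assoc, hstep _ _ (h k (Finset.mem_range.2 hk)), ih (by omega)]
    rw [heq r le_rfl]
    exact ⟨le_self_add, le_self_add⟩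
  · push Not at h
    obtain ⟨k, hk, hk0⟩ := h
    have h1 : M ≤ M * ∑ k ∈ Finset.range r, stepVisits K y (m + k) b :=
      le_mul_of_one_le_right' ((one_le_stepVisits hk0).trans (Finset.single_le_sum
        (f := fun k => stepVisits K y (m + k) b) (fun _ _ => zero_le) hk))
    exact ⟨((hgM _ b).trans h1).trans le_add_self, ((hgM _ b).trans h1).trans le_add_self⟩

/-- The sum over `n` of the means of `g n` on the event that the spine is at `x` at time `n` is
asymptotic to the Green function of `x` times the mean of the limit of `g n`. -/
lemma IsJumpLaw.tendsto_jweight_mul_tsum (hd : 5 ≤ d) (p : PMF ℕ) (hp : offspringMean p = 1)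
    (hvar : offspringVariance p < ∞) {μ : PMF (Site d)} (hμ : IsJumpLaw μ) (hw : WeakLd μ)
    {K : Finset (Site d)} {y : Site d} {g : ℕ → Spine d → ℝ≥0∞}
    {G : Spine d → ℝ≥0∞} {M : ℝ≥0∞} (hM : M ≠ ∞) (hg : ∀ n, Measurable (g n))
    (hgd : ∀ n k, n ≤ k → ∀ b, g n (dropStep k b) = g n b) (hgM : ∀ n b, g n b ≤ M)
    (hstep : ∀ n b, stepVisits K y n b = 0 → g (n + 1) b = g n b)
    (hlim : ∀ᵐ b ∂(spineLaw p hp μ), Tendsto (fun n => g n b) atTop (𝓝 (G b))) :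
    Tendsto (fun x => jweight μ x * ∑' n, ∫⁻ b, (if spinePos y b n = x then g n b else 0)
        ∂(spineLaw p hp μ)) (atInfinity d)
      (𝓝 (ENNReal.ofReal (greenConst μ) * ∫⁻ b, G b ∂(spineLaw p hp μ))) := by
  have := atInfinity_neBot (d := d) (by omega)
  obtain ⟨e, he, hee⟩ := hμ.exists_jweight_mul_spineError_le hd p hp hvar hw K y
  have hint : Tendsto (fun m => ∫⁻ b, g m b ∂(spineLaw p hp μ)) atTop
      (𝓝 (∫⁻ b, G b ∂(spineLaw p hp μ))) :=
    tendsto_lintegral_of_dominated_convergence (fun _ => M) hg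
      (fun n => Eventually.of_forall fun b => hgM n b) (by simpa using hM) hlim
  have hGM : ∫⁻ b, G b ∂(spineLaw p hp μ) ≠ ∞ := by
    refine ne_of_lt (lt_of_le_of_lt (le_of_tendsto' hint fun m => ?_) hM.lt_top)
    calc _ ≤ ∫⁻ _, M ∂(spineLaw p hp μ) := lintegral_mono (hgM m)
      _ = M := by simp
  have hind (n : ℕ) (x : Site d) {f : Spine d → ℝ≥0∞} (hf : Measurable f) :
      Measurable fun b : Spine d => if spinePos y b n = x then f b else 0 :=
    Measurable.ite (measurableSet_eq_fun (by fun_prop) (by fun_prop)) hf measurable_const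
  have hsv (m r : ℕ) : Measurable fun b : Spine d =>
      M * ∑ k ∈ Finset.range r, stepVisits K y (m + k) b := by fun_prop
  have herr (m : ℕ) (x : Site d) : ∑' r, ∫⁻ b, (if spinePos y b (m + r) = x then
      M * ∑ k ∈ Finset.range r, stepVisits K y (m + k) b else 0) ∂(spineLaw p hp μ) =
      M * spineError p μ K y m x := by
    rw [← tsum_lintegral_stepVisits p hp μ, ← ENNReal.tsum_mul_left]
    refine tsum_congr fun r => ?_
    rw [← lintegral_const_mul _ (hind (m + r) x (by fun_prop))]
    simp_rw [mul_ite, mul_zero]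
  have hinv := ENNReal.tendsto_inv_nat_nhds_zero
  have he' : Tendsto (fun m : ℕ => (m : ℝ≥0∞)⁻¹ + (m : ℝ≥0∞)⁻¹ + M * e m) atTop (𝓝 0) := by
    have h1 := (hinv.add hinv).add (ENNReal.Tendsto.const_mul he (Or.inr hM))
    rwa [mul_zero, add_zero, add_zero] at h1
  set P := spineLaw p hp μ
  set I : ℕ → Site d → ℝ≥0∞ := fun n x => ∫⁻ b, (if spinePos y b n = x then g n b else 0) ∂P with hI
  have hsplit (m : ℕ) (x : Site d) :
      ∑' n, I n x = ∑ n ∈ Finset.range m, I n x + ∑' r, I (m + r) x := by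
    rw [← Summable.sum_add_tsum_nat_add' (k := m) ENNReal.summable]
    simp_rw [add_comm m]
  -- the times `n < m` do not contribute, as the walk is unlikely to reach `x` by then
  have hhead (m : ℕ) : ∀ᶠ x in atInfinity d,
      jweight μ x * ∑ n ∈ Finset.range m, I n x ≤ (m : ℝ≥0∞)⁻¹ := by
    have h1 : Tendsto (fun x => ∑ n ∈ Finset.range m, M * (jweight μ x * convPow μ n (y - x)))
        (atInfinity d) (𝓝 (∑ n ∈ Finset.range m, M * 0)) :=
      tendsto_finsetSum _ fun n _ => ENNReal.Tendsto.const_mul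
        (hw.tendsto_jweight_mul_convPow (by omega) n y) (Or.inr hM)
    simp only [mul_zero, Finset.sum_const_zero] at h1
    filter_upwards [h1.eventually_le_const (u := (m : ℝ≥0∞)⁻¹) (by simp)] with x hx
    refine le_trans ?_ hx
    rw [Finset.mul_sum]
    refine Finset.sum_le_sum fun n _ => ?_
    rw [mul_left_comm]
    refine mul_le_mul_right ?_ _
    have h2 := lintegral_ite_spinePos p hp μ (f := fun _ => M) measurable_const (m := 0)
      (fun _ _ _ => rfl) y x n
    simp only [zero_add, spinePos_zero, lintegral_const, measure_univ, mul_one] at h2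
    rw [← h2]
    refine lintegral_mono fun b => ?_
    dsimp only
    split_ifs
    · exact hgM n b
    · exact le_rfl
  -- at the times `n ≥ m`, replacing `g n` by `g m` costs at most the late visits
  have hcomp (m : ℕ) (x : Site d) :
      ∑' r, I (m + r) x ≤ ∫⁻ b, g m b * green μ (spinePos y b m - x) ∂P +
          M * spineError p μ K y m x ∧
        ∫⁻ b, g m b * green μ (spinePos y b m - x) ∂P ≤ ∑' r, I (m + r) x +
          M * spineError p μ K y m x := by
    rw [← herr, ← tsum_lintegral_ite_spinePos p hp μ (hg m) (hgd m), ← ENNReal.tsum_add,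
      ← ENNReal.tsum_add]
    refine ⟨ENNReal.tsum_le_tsum fun r => ?_, ENNReal.tsum_le_tsum fun r => ?_⟩
    · rw [← lintegral_add_left (hind _ _ (hg m))]
      refine lintegral_mono fun b => ?_
      dsimp only
      split_ifs
      · exact (le_add_of_stepVisits hgM hstep m r b).1
      · exact zero_le
    · rw [← lintegral_add_left (hind _ _ (hg (m + r)))]
      refine lintegral_mono fun b => ?_
      dsimp only
      split_ifs
      · exact (le_add_of_stepVisits hgM hstep m r b).2
      · exact zero_le
  have hmain (m : ℕ) := hμ.tendsto_jweight_mul_lintegral hd p hp hw (hg m) hM (hgM m) y m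
  have hfin (m : ℕ) : ENNReal.ofReal (greenConst μ) * ∫⁻ b, g m b ∂P ≠ ∞ := by
    refine ENNReal.mul_ne_top ENNReal.ofReal_ne_top (ne_of_lt (lt_of_le_of_lt ?_ hM.lt_top))
    calc _ ≤ ∫⁻ _, M ∂P := lintegral_mono (hgM m)
      _ = M := by simp [P]
  refine tendsto_of_forall_eventually_le (ENNReal.mul_ne_top ENNReal.ofReal_ne_top hGM)
    (ENNReal.Tendsto.const_mul hint (Or.inr ENNReal.ofReal_ne_top)) he' (fun m => ?_) fun m => ?_
  · filter_upwards [hhead m, hee m, (hmain m).eventually_le_const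
      (ENNReal.lt_add_right (hfin m) (ENNReal.inv_ne_zero.2 (ENNReal.natCast_ne_top m)))]
      with x h1 h2 h3
    calc jweight μ x * ∑' n, I n x
        ≤ jweight μ x * (∑ n ∈ Finset.range m, I n x +
          (∫⁻ b, g m b * green μ (spinePos y b m - x) ∂P + M * spineError p μ K y m x)) := by
          rw [hsplit m x]
          exact mul_le_mul_right (add_le_add le_rfl (hcomp m x).1) _
      _ = jweight μ x * ∑ n ∈ Finset.range m, I n x +
          (jweight μ x * ∫⁻ b, g m b * green μ (spinePos y b m - x) ∂P +
            M * (jweight μ x * spineError p μ K y m x)) := by ring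
      _ ≤ (m : ℝ≥0∞)⁻¹ + ((ENNReal.ofReal (greenConst μ) * ∫⁻ b, g m b ∂P + (m : ℝ≥0∞)⁻¹) +
            M * e m) := add_le_add h1 (add_le_add h3 (mul_le_mul_right h2 _))
      _ = _ := by ring
  · have h3' := ((hmain m).add_const (m : ℝ≥0∞)⁻¹).eventually_const_lt
      (ENNReal.lt_add_right (hfin m) (ENNReal.inv_ne_zero.2 (ENNReal.natCast_ne_top m)))
    filter_upwards [hee m, h3'] with x h2 h3
    calc _ ≤ _ := h3.le
      _ ≤ jweight μ x * (∑' n, I n x + M * spineError p μ K y m x) + (m : ℝ≥0∞)⁻¹ := by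
          refine add_le_add (mul_le_mul_right ((hcomp m x).2.trans (add_le_add ?_ le_rfl)) _) le_rfl
          rw [hsplit m x]
          exact le_add_self
      _ = jweight μ x * ∑' n, I n x + ((m : ℝ≥0∞)⁻¹ +
            M * (jweight μ x * spineError p μ K y m x)) := by ring
      _ ≤ jweight μ x * ∑' n, I n x + ((m : ℝ≥0∞)⁻¹ + (m : ℝ≥0∞)⁻¹ + M * e m) :=
          add_le_add le_rfl (add_le_add le_self_add (mul_le_mul_right h2 _))

/-! ### Limits of the weights along the spine -/

lemma stepPioneers_le_stepOcc (K : Finset (Site d)) (z : Site d) (s : Step d) :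
    stepPioneers K z s ≤ stepOcc K z s :=
  Finset.sum_le_sum fun _ _ => numPioneers_le_occ _ _ _

lemma stepVisits_eq_zero_iff {K : Finset (Site d)} {y : Site d} {n : ℕ} {b : Spine d} :
    stepVisits K y n b = 0 ↔
      spinePos y b (n + 1) ∉ K ∧ stepOcc K (spinePos y b (n + 1)) (b.1 n) = 0 := by
  rw [stepVisits, add_eq_zero]
  simp

lemma stepPioneers_eq_zero_of_stepVisits {K : Finset (Site d)} {y : Site d} {n : ℕ} {b : Spine d}
    (h : stepVisits K y n b = 0) : stepPioneers K (spinePos y b (n + 1)) (b.1 n) = 0 :=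
  le_antisymm ((stepPioneers_le_stepOcc _ _ _).trans (stepVisits_eq_zero_iff.1 h).2.le) zero_le

lemma numPioneers_eq_zero_of_stepVisits {K : Finset (Site d)} {y : Site d} {n : ℕ} {b : Spine d}
    (h : stepVisits K y n b = 0) {j : ℕ} (hj : j < leftSib b n) :
    numPioneers K (sibPos y b n j) (sibEnv b n j) = 0 := by
  have h1 := stepPioneers_eq_zero_of_stepVisits h
  rw [stepPioneers, Finset.sum_eq_zero_iff] at h1
  exact h1 j (Finset.mem_range.2 (lt_of_lt_of_le hj (Nat.le_add_right _ _)))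

lemma pathWeight_le_one {κ : ℝ≥0∞ → ℝ≥0∞} (hκ : ∀ r, κ r ≤ 1) (K : Finset (Site d)) (y : Site d)
    (n : ℕ) (b : Spine d) : pathWeight κ K y n b ≤ 1 := by
  refine Finset.prod_le_one' fun k _ => ?_
  split_ifs
  · exact zero_le
  · exact Finset.prod_le_one' fun j _ => hκ _

lemma pathWeight_succ_of_stepVisits {κ : ℝ≥0∞ → ℝ≥0∞} (hκ0 : κ 0 = 1) {K : Finset (Site d)}
    {y : Site d} {n : ℕ} {b : Spine d} (h : stepVisits K y n b = 0) :
    pathWeight κ K y (n + 1) b = pathWeight κ K y n b := by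
  have h2 : stepWeight κ K (spinePos y b (n + 1)) (b.1 n) = 1 := Finset.prod_eq_one fun j hj => by
    have h3 := numPioneers_eq_zero_of_stepVisits h (Finset.mem_range.1 hj)
    rw [sibPos, sibEnv] at h3
    rw [h3, hκ0]
  rw [pathWeight, Finset.prod_range_succ, ← pathWeight, if_neg (stepVisits_eq_zero_iff.1 h).1, h2,
    mul_one]

lemma pathTerm_succ_of_stepVisits {κ : ℝ≥0∞ → ℝ≥0∞} (hκ0 : κ 0 = 1) (Φ : ℝ≥0∞ × ℝ≥0∞ → ℝ≥0∞)
    {K : Finset (Site d)} {y : Site d} {n : ℕ} {b : Spine d} (h : stepVisits K y n b = 0)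
    (s t : ℝ≥0∞) : pathTerm κ Φ K y (n + 1) s t b = pathTerm κ Φ K y n s t b := by
  rw [pathTerm, pathWeight_succ_of_stepVisits hκ0 h, Finset.sum_range_succ, Finset.sum_range_succ,
    stepPioneers_eq_zero_of_stepVisits h, (stepVisits_eq_zero_iff.1 h).2, add_zero, add_zero,
    pathTerm]

/-- Asymptotics of the mean of a function of the numbers of pioneers and of visits, weighted by the
total weight of the pioneers. -/
lemma IsJumpLaw.tendsto_jweight_mul_lintegral_genWeight (hd : 5 ≤ d) (p : PMF ℕ)
    (hp : offspringMean p = 1) (hvar : offspringVariance p < ∞) {μ : PMF (Site d)}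
    (hμ : IsJumpLaw μ) (hw : WeakLd μ) {K : Finset (Site d)} {κ : ℝ≥0∞ → ℝ≥0∞}
    (hκ : Measurable κ) (hκ0 : κ 0 = 1) (hκ1 : ∀ r, κ r ≤ 1) {Φ : ℝ≥0∞ × ℝ≥0∞ → ℝ≥0∞}
    (hΦ : Measurable Φ) {M : ℝ≥0∞} (hM : M ≠ ∞) (hΦM : ∀ q, Φ q ≤ M)
    {G : Site d → Spine d → ℝ≥0∞}
    (hlim : ∀ y ∈ K, ∀ᵐ b ∂(spineLaw p hp μ),
      Tendsto (fun n => pathTerm κ Φ K y n 0 0 b) atTop (𝓝 (G y b))) :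
    Tendsto (fun x => jweight μ x * ∫⁻ ω, (∑' n, genWeight κ K n x ω) *
        Φ (numPioneers K x ω, occ K x ω) ∂(envLaw p μ)) (atInfinity d)
      (𝓝 (ENNReal.ofReal (greenConst μ) * ∑ y ∈ K, ∫⁻ b, G y b ∂(spineLaw p hp μ))) := by
  have h1 (x : Site d) : ∫⁻ ω, (∑' n, genWeight κ K n x ω) *
      Φ (numPioneers K x ω, occ K x ω) ∂(envLaw p μ) =
      ∑ y ∈ K, ∑' n, ∫⁻ q, (if spinePos y q n = x then pathTerm κ Φ K y n 0 0 q else 0)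
        ∂(spineLaw p hp μ) := by
    have hm (n : ℕ) : Measurable fun ω => genWeight κ K n x ω *
        Φ (numPioneers K x ω, occ K x ω) :=
      (measurable_genWeight hκ K n x).mul
        (hΦ.comp ((measurable_numPioneers K x).prodMk (measurable_occ K x)))
    simp_rw [← ENNReal.tsum_mul_right]
    rw [lintegral_tsum fun n => (hm n).aemeasurable,
      ← Summable.tsum_finsetSum fun _ _ => ENNReal.summable]
    refine tsum_congr fun n => ?_
    rw [← many_to_one p hp μ hκ hΦ]
    simp only [zero_add]
  simp_rw [h1, Finset.mul_sum]
  refine tendsto_finsetSum _ fun y hy => ?_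
  refine hμ.tendsto_jweight_mul_tsum hd p hp hvar hw hM (fun n => measurable_pathTerm hκ hΦ K y n 0 0)
    (fun n k hnk b => pathTerm_dropStep κ Φ K y hnk 0 0 b) (fun n b => ?_)
    (fun n b h => pathTerm_succ_of_stepVisits hκ0 Φ h 0 0) (hlim y hy)
  exact (mul_le_mul' (pathWeight_le_one hκ1 K y n b) (hΦM _)).trans_eq (one_mul M)

/-- The event whose probability is `escapeProb`. -/
def escapeEvent (K : Finset (Site d)) (y : Site d) : Set (Spine d) :=
  {b | b ∈ neverReturns K y ∧
    ∀ k : ℕ, ∀ j < leftSib b k, occ K (sibPos y b k j) (sibEnv b k j) = 0}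

/-- With `κ` the indicator of `0`, the weight of the first `n` steps of the spine is eventually the
indicator of the escape event. -/
lemma ae_tendsto_pathTerm_zeroInd (hd : 5 ≤ d) (p : PMF ℕ) (hp : offspringMean p = 1)
    (hvar : offspringVariance p < ∞) {μ : PMF (Site d)} (hμ : IsJumpLaw μ) (K : Finset (Site d))
    (y : Site d) : ∀ᵐ b ∂(spineLaw p hp μ),
      Tendsto (fun n => pathTerm zeroInd (fun _ => 1) K y n 0 0 b) atTop
        (𝓝 ((escapeEvent K y).indicator 1 b)) := by
  filter_upwards [ae_tsum_stepVisits_lt_top hd p hp hvar μ hμ K y] with b hb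
  obtain ⟨m, hm⟩ := exists_stepVisits_eq_zero hb
  refine tendsto_const_nhds.congr' ?_
  filter_upwards [eventually_ge_atTop m] with n hn
  rw [pathTerm, mul_one]
  by_cases hE : b ∈ escapeEvent K y
  · rw [Set.indicator_of_mem hE, Pi.one_apply]
    refine (Finset.prod_eq_one fun k _ => ?_).symm
    rw [if_neg (hE.1 (k + 1) (by omega))]
    refine Finset.prod_eq_one fun j hj => ?_
    have := hE.2 k j (Finset.mem_range.1 hj)
    rw [← numPioneers_eq_zero_iff] at this
    rw [sibPos, sibEnv] at this
    rw [this, zeroInd, if_pos rfl]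
  · rw [Set.indicator_of_notMem hE]
    by_contra h0
    refine hE ⟨fun k hk hkK => ?_, fun k j hj => ?_⟩
    · obtain ⟨k, rfl⟩ := Nat.exists_eq_add_of_le' hk
      rcases lt_or_ge k n with hkn | hkn
      · have := Finset.prod_ne_zero_iff.1 (Ne.symm h0) k (Finset.mem_range.2 hkn)
        exact this (if_pos hkK)
      · exact (stepVisits_eq_zero_iff.1 (hm k (hn.trans hkn))).1 hkK
    · rw [← numPioneers_eq_zero_iff]
      rcases lt_or_ge k n with hkn | hkn
      · have h1 := Finset.prod_ne_zero_iff.1 (Ne.symm h0) k (Finset.mem_range.2 hkn)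
        split_ifs at h1 with h2
        · exact absurd rfl h1
        · have h3 := Finset.prod_ne_zero_iff.1 h1 j (Finset.mem_range.2 hj)
          by_contra h4
          exact h3 (if_neg h4)
      · exact numPioneers_eq_zero_of_stepVisits (hm k (hn.trans hkn)) hj

/-- With `κ = 1`, the term of the first `n` steps of the spine is eventually given by the total
numbers of pioneers and of visits, on the event that the spine does not return to `K`. -/
lemma ae_tendsto_pathTerm_one (hd : 5 ≤ d) (p : PMF ℕ) (hp : offspringMean p = 1)
    (hvar : offspringVariance p < ∞) {μ : PMF (Site d)} (hμ : IsJumpLaw μ) (K : Finset (Site d))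
    (y : Site d) (Φ : ℝ≥0∞ × ℝ≥0∞ → ℝ≥0∞) : ∀ᵐ b ∂(spineLaw p hp μ),
      Tendsto (fun n => pathTerm (fun _ => 1) Φ K y n 0 0 b) atTop
        (𝓝 ((neverReturns K y).indicator
          (fun b => Φ (1 + sibPioneers K y b, occ K y b.2 + sibOcc K y b)) b)) := by
  filter_upwards [ae_tsum_stepVisits_lt_top hd p hp hvar μ hμ K y] with b hb
  obtain ⟨m, hm⟩ := exists_stepVisits_eq_zero hb
  refine tendsto_const_nhds.congr' ?_
  filter_upwards [eventually_ge_atTop m] with n hn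
  have h1 : ∑ k ∈ Finset.range n, stepPioneers K (spinePos y b (k + 1)) (b.1 k) =
      sibPioneers K y b := by
    rw [sibPioneers_eq, tsum_eq_sum fun k hk => ?_]
    exact stepPioneers_eq_zero_of_stepVisits (hm k (hn.trans (by simpa using hk)))
  have h2 : ∑ k ∈ Finset.range n, stepOcc K (spinePos y b (k + 1)) (b.1 k) = sibOcc K y b := by
    rw [sibOcc_eq, tsum_eq_sum fun k hk => ?_]
    exact (stepVisits_eq_zero_iff.1 (hm k (hn.trans (by simpa using hk)))).2
  rw [pathTerm, h1, h2, zero_add, zero_add]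
  by_cases hE : b ∈ neverReturns K y
  · rw [Set.indicator_of_mem hE, pathWeight, Finset.prod_eq_one, one_mul]
    intro k _
    rw [if_neg (hE (k + 1) (by omega)), stepWeight, Finset.prod_const_one]
  · rw [Set.indicator_of_notMem hE, eq_comm, mul_eq_zero]
    left
    obtain ⟨k, hk, hkK⟩ : ∃ k, 1 ≤ k ∧ spinePos y b k ∈ K := by
      by_contra! h
      exact hE h
    obtain ⟨k, rfl⟩ := Nat.exists_eq_add_of_le' hk
    refine Finset.prod_eq_zero (i := k) ?_ (if_pos hkK)
    by_contra hkn
    exact (stepVisits_eq_zero_iff.1 (hm k (hn.trans (by simpa using hkn)))).1 hkK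

lemma measurableSet_neverReturns (K : Finset (Site d)) (y : Site d) :
    MeasurableSet (neverReturns K y) := by
  have h : neverReturns K y = ⋂ n : ℕ, ⋂ _ : 1 ≤ n, {b | spinePos y b n ∈ K}ᶜ := by
    ext b
    simp [neverReturns]
  rw [h]
  exact MeasurableSet.iInter fun n => MeasurableSet.iInter fun _ =>
    (measurable_spinePos y n (MeasurableSet.of_discrete (s := (K : Set (Site d))))).compl

lemma measurable_sibPioneers (K : Finset (Site d)) (y : Site d) :
    Measurable (sibPioneers K y) := by
  have h : sibPioneers K y = fun b => ∑' k, stepPioneers K (spinePos y b (k + 1)) (b.1 k) := rfl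
  rw [h]
  exact Measurable.tsum fun k => by fun_prop

lemma measurable_sibOcc (K : Finset (Site d)) (y : Site d) : Measurable (sibOcc K y) := by
  have h : sibOcc K y = fun b => ∑' k, stepOcc K (spinePos y b (k + 1)) (b.1 k) := rfl
  rw [h]
  exact Measurable.tsum fun k => by fun_prop

lemma measurable_spineWeight (K : Finset (Site d)) (y : Site d) :
    Measurable (spineWeight K y) :=
  Measurable.indicator (((measurable_sibPioneers K y).const_add 1).inv)
    (measurableSet_neverReturns K y)

lemma measurable_spinePair (K : Finset (Site d)) (y : Site d) : Measurable (spinePair K y) :=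
  (((measurable_sibPioneers K y).const_add 1).ennreal_toReal).prodMk
    ((((measurable_occ K y).comp measurable_snd).add (measurable_sibOcc K y)).ennreal_toReal)

lemma measurableSet_escapeEvent (K : Finset (Site d)) (y : Site d) :
    MeasurableSet (escapeEvent K y) := by
  have h : escapeEvent K y = neverReturns K y ∩ ⋂ k : ℕ, ⋂ j : ℕ,
      ({b | j < leftSib b k}ᶜ ∪ {b | occ K (sibPos y b k j) (sibEnv b k j) = 0}) := by
    ext b
    simp only [escapeEvent, Set.mem_inter_iff, Set.mem_iInter, Set.mem_union, Set.mem_compl_iff]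
    refine and_congr Iff.rfl (forall_congr' fun k => forall_congr' fun j => ?_)
    exact imp_iff_not_or
  rw [h]
  refine (measurableSet_neverReturns K y).inter (MeasurableSet.iInter fun k =>
    MeasurableSet.iInter fun j => MeasurableSet.union ?_ ?_)
  · have h1 : Measurable fun b : Spine d => leftSib b k := by unfold leftSib; fun_prop
    exact (measurableSet_lt measurable_const h1).compl
  · have h1 : Measurable fun b : Spine d => occ K (sibPos y b k j) (sibEnv b k j) := by
      unfold sibPos sibEnv; fun_prop
    exact h1 (measurableSet_singleton 0)

/-! ### The hitting probability and the law of the counts -/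

/-- The event that `K` is visited. -/
def hitEvent (K : Finset (Site d)) (x : Site d) : Set (Env d) := {ω | 1 ≤ occ K x ω}

lemma measurableSet_hitEvent (K : Finset (Site d)) (x : Site d) :
    MeasurableSet (hitEvent K x) := measurableSet_le measurable_const (measurable_occ K x)

lemma mem_hitEvent_iff {K : Finset (Site d)} {x : Site d} {ω : Env d} :
    ω ∈ hitEvent K x ↔ numPioneers K x ω ≠ 0 := by
  rw [Ne, numPioneers_eq_zero_iff]
  refine ⟨fun h h0 => ?_, one_le_occ⟩
  change 1 ≤ occ K x ω at h
  rw [h0] at h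
  exact absurd h (by simp)

lemma ae_numPioneers_lt_top (hd : 5 ≤ d) (p : PMF ℕ) (hp : offspringMean p = 1) (μ : PMF (Site d))
    (hμ : IsJumpLaw μ) (K : Finset (Site d)) (x : Site d) :
    ∀ᵐ ω ∂(envLaw p μ), numPioneers K x ω < ∞ := by
  filter_upwards [ae_occ_lt_top hd p hp μ hμ K x] with ω h
  exact (numPioneers_le_occ K x ω).trans_lt h

/-- The probability that `K` is visited, seen from the leftmost pioneer. -/
lemma IsJumpLaw.tendsto_jweight_mul_hit (hd : 5 ≤ d) (p : PMF ℕ)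
    (hp : offspringMean p = 1) (hvar : offspringVariance p < ∞) {μ : PMF (Site d)}
    (hμ : IsJumpLaw μ) (hw : WeakLd μ) (K : Finset (Site d)) :
    Tendsto (fun x => jweight μ x * envLaw p μ (hitEvent K x)) (atInfinity d)
      (𝓝 (ENNReal.ofReal (greenConst μ) * ENNReal.ofReal (branchingCap p hp μ K))) := by
  have h := hμ.tendsto_jweight_mul_lintegral_genWeight hd p hp hvar hw (K := K) measurable_zeroInd
    (if_pos rfl) zeroInd_le_one (Φ := fun _ => 1) measurable_const ENNReal.one_ne_top (fun _ => le_rfl)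
    (fun y _ => ae_tendsto_pathTerm_zeroInd hd p hp hvar hμ K y)
  have h1 : ENNReal.ofReal (branchingCap p hp μ K) =
      ∑ y ∈ K, ∫⁻ b, (escapeEvent K y).indicator 1 b ∂(spineLaw p hp μ) := by
    have h2 : ∀ y ∈ K, 0 ≤ escapeProb p hp μ K y := fun _ _ => measureReal_nonneg
    rw [branchingCap, ENNReal.ofReal_sum_of_nonneg h2]
    refine Finset.sum_congr rfl fun y _ => ?_
    rw [lintegral_indicator_one (measurableSet_escapeEvent K y), escapeProb, ofReal_measureReal]
    rfl
  rw [h1]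
  refine h.congr fun x => ?_
  congr 1
  rw [← lintegral_indicator_one (measurableSet_hitEvent K x)]
  refine lintegral_congr_ae ?_
  filter_upwards [ae_numPioneers_lt_top hd p hp μ hμ K x] with ω hω
  rw [tsum_genWeight_zeroInd hω, mul_one]
  by_cases h0 : numPioneers K x ω = 0
  · rw [if_pos h0, Set.indicator_of_notMem]
    rwa [mem_hitEvent_iff, not_not]
  · rw [if_neg h0, Set.indicator_of_mem (mem_hitEvent_iff.2 h0), Pi.one_apply]

/-- The law of the counts on the event that `K` is visited, seen from all the pioneers. -/
lemma IsJumpLaw.tendsto_jweight_mul_setLIntegral (hd : 5 ≤ d) (p : PMF ℕ)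
    (hp : offspringMean p = 1) (hvar : offspringVariance p < ∞) {μ : PMF (Site d)}
    (hμ : IsJumpLaw μ) (hw : WeakLd μ) (K : Finset (Site d)) {F : ℝ × ℝ → ℝ≥0∞}
    (hF : Measurable F) {M : ℝ≥0∞} (hM : M ≠ ∞) (hFM : ∀ q, F q ≤ M) :
    Tendsto (fun x => jweight μ x * ∫⁻ ω in hitEvent K x,
        F ((numPioneers K x ω).toReal, (occ K x ω).toReal) ∂(envLaw p μ)) (atInfinity d)
      (𝓝 (ENNReal.ofReal (greenConst μ) *
        ∑ y ∈ K, ∫⁻ b, spineWeight K y b * F (spinePair K y b) ∂(spineLaw p hp μ))) := by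
  -- the weight `1 / L_K` compensates for the number of pioneers; the maximum only serves to keep
  -- `Φ` bounded, as `L_K ≥ 1` wherever it is used
  let Φ : ℝ≥0∞ × ℝ≥0∞ → ℝ≥0∞ := fun q => (max q.1 1)⁻¹ * F (q.1.toReal, q.2.toReal)
  have hΦ : Measurable Φ := by
    refine Measurable.mul (by fun_prop) (hF.comp ?_)
    fun_prop
  have hΦM : ∀ q, Φ q ≤ M := fun q =>
    (mul_le_mul' (ENNReal.inv_le_one.2 (le_max_right _ _)) (hFM _)).trans_eq (one_mul M)
  have h := hμ.tendsto_jweight_mul_lintegral_genWeight hd p hp hvar hw (K := K) (κ := fun _ => 1)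
    measurable_const rfl (fun _ => le_rfl) hΦ hM hΦM
    (fun y _ => ae_tendsto_pathTerm_one hd p hp hvar hμ K y Φ)
  have h1 (y : Site d) : ∫⁻ b, (neverReturns K y).indicator
      (fun b => Φ (1 + sibPioneers K y b, occ K y b.2 + sibOcc K y b)) b ∂(spineLaw p hp μ) =
      ∫⁻ b, spineWeight K y b * F (spinePair K y b) ∂(spineLaw p hp μ) := by
    refine lintegral_congr fun b => ?_
    rw [spineWeight]
    by_cases hb : b ∈ neverReturns K y
    · rw [Set.indicator_of_mem hb, Set.indicator_of_mem hb]
      simp only [Φ]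
      rw [max_eq_left le_self_add]
      rfl
    · rw [Set.indicator_of_notMem hb, Set.indicator_of_notMem hb, zero_mul]
  simp_rw [h1] at h
  refine h.congr fun x => ?_
  congr 1
  rw [← lintegral_indicator (measurableSet_hitEvent K x)]
  refine lintegral_congr_ae ?_
  filter_upwards [ae_numPioneers_lt_top hd p hp μ hμ K x] with ω hω
  rw [tsum_genWeight_one]
  by_cases h0 : numPioneers K x ω = 0
  · rw [h0, zero_mul, Set.indicator_of_notMem]
    rwa [mem_hitEvent_iff, not_not]
  · rw [Set.indicator_of_mem (mem_hitEvent_iff.2 h0)]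
    simp only [Φ]
    rw [max_eq_left (one_le_numPioneers h0), ← mul_assoc, ENNReal.mul_inv_cancel h0 hω.ne, one_mul]

/-- The two expressions of the branching capacity are limits of the same rescaled probability, seen
from the leftmost pioneer and from all the pioneers. -/
lemma IsJumpLaw.ofReal_branchingCap (hd : 5 ≤ d) (p : PMF ℕ)
    (hp : offspringMean p = 1) (hvar : offspringVariance p < ∞) {μ : PMF (Site d)}
    (hμ : IsJumpLaw μ) (hw : WeakLd μ) (K : Finset (Site d)) :
    ENNReal.ofReal (branchingCap p hp μ K) = spineMass p hp μ K := by
  have := atInfinity_neBot (d := d) (by omega)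
  have h1 := hμ.tendsto_jweight_mul_hit hd p hp hvar hw K
  have h2 := hμ.tendsto_jweight_mul_setLIntegral hd p hp hvar hw K (F := fun _ => 1)
    measurable_const ENNReal.one_ne_top fun _ => le_rfl
  simp only [lintegral_const, Measure.restrict_apply MeasurableSet.univ, Set.univ_inter, one_mul,
    mul_one] at h2
  have h3 := tendsto_nhds_unique h1 h2
  exact (ENNReal.mul_right_inj (by simpa using greenConst_pos (by omega) hμ)
    ENNReal.ofReal_ne_top).1 h3

lemma spineWeight_le_one (K : Finset (Site d)) (y : Site d) (b : Spine d) :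
    spineWeight K y b ≤ 1 := by
  refine Set.indicator_le' (fun b _ => ENNReal.inv_le_one.2 le_self_add) (fun _ _ => zero_le) b

lemma spineMass_lt_top (p : PMF ℕ) (hp : offspringMean p = 1) (μ : PMF (Site d))
    (K : Finset (Site d)) : spineMass p hp μ K < ∞ := by
  refine ENNReal.sum_lt_top.2 fun y _ => ?_
  calc _ ≤ ∫⁻ _, 1 ∂(spineLaw p hp μ) := lintegral_mono (spineWeight_le_one K y)
    _ < ∞ := by simp

lemma lintegral_limitLaw (p : PMF ℕ) (hp : offspringMean p = 1) (μ : PMF (Site d))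
    (K : Finset (Site d)) {F : ℝ × ℝ → ℝ≥0∞} (hF : Measurable F) :
    ∫⁻ q, F q ∂(limitLaw p hp μ K) = (spineMass p hp μ K)⁻¹ *
      ∑ y ∈ K, ∫⁻ b, spineWeight K y b * F (spinePair K y b) ∂(spineLaw p hp μ) := by
  rw [limitLaw, lintegral_smul_measure, lintegral_finsetSum_measure, smul_eq_mul]
  congr 1
  refine Finset.sum_congr rfl fun y _ => ?_
  have hm : Measurable fun b => F (spinePair K y b) := hF.comp (measurable_spinePair K y)
  rw [lintegral_map hF (measurable_spinePair K y),
    lintegral_withDensity_eq_lintegral_mul _ (measurable_spineWeight K y) hm]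
  rfl

lemma isProbabilityMeasure_limitLaw {p : PMF ℕ} {hp : offspringMean p = 1} {μ : PMF (Site d)}
    {K : Finset (Site d)} (h : spineMass p hp μ K ≠ 0) :
    IsProbabilityMeasure (limitLaw p hp μ K) := by
  refine ⟨?_⟩
  have h1 := lintegral_limitLaw p hp μ K (F := fun _ => 1) measurable_const
  simp only [lintegral_const, one_mul, mul_one] at h1
  rw [h1]
  exact ENNReal.inv_mul_cancel h (spineMass_lt_top p hp μ K).ne

lemma integral_eq_lintegral_sub {Ω : Type*} [MeasurableSpace Ω] (ν : Measure Ω)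
    [IsProbabilityMeasure ν] (f : BoundedContinuousFunction (ℝ × ℝ) ℝ) {X : Ω → ℝ × ℝ}
    (hX : Measurable X) :
    ∫ ω, f (X ω) ∂ν = (∫⁻ ω, ENNReal.ofReal (f (X ω) + ‖f‖) ∂ν).toReal - ‖f‖ := by
  have hint : Integrable (fun ω => f (X ω)) ν :=
    Integrable.of_bound (f.continuous.measurable.comp hX).aestronglyMeasurable ‖f‖
      (Eventually.of_forall fun ω => f.norm_coe_le_norm _)
  have h0 : ∀ ω, 0 ≤ f (X ω) + ‖f‖ := fun ω => by
    have := neg_le_of_abs_le (f.norm_coe_le_norm (X ω))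
    linarith
  rw [← integral_eq_lintegral_of_nonneg_ae (Eventually.of_forall h0)
    (hint.add (integrable_const _)).aestronglyMeasurable, integral_add hint (integrable_const _)]
  simp

/-- Convergence in law of the counts, given that `K` is visited. -/
lemma IsJumpLaw.tendsto_integral_cond (hd : 5 ≤ d) (p : PMF ℕ)
    (hp : offspringMean p = 1) (hvar : offspringVariance p < ∞) {μ : PMF (Site d)}
    (hμ : IsJumpLaw μ) (hw : WeakLd μ) (K : Finset (Site d)) (h0 : spineMass p hp μ K ≠ 0)
    (f : BoundedContinuousFunction (ℝ × ℝ) ℝ) :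
    Tendsto (fun x => ∫ ω, f ((numPioneers K x ω).toReal, (occ K x ω).toReal)
        ∂((envLaw p μ)[|hitEvent K x]))
      (atInfinity d) (𝓝 (∫ q, f q ∂(limitLaw p hp μ K))) := by
  have := isProbabilityMeasure_limitLaw h0
  set F : ℝ × ℝ → ℝ≥0∞ := fun q => ENNReal.ofReal (f q + ‖f‖) with hFdef
  have hF : Measurable F := (f.continuous.measurable.add_const _).ennreal_ofReal
  have hFM : ∀ q, F q ≤ ENNReal.ofReal (‖f‖ + ‖f‖) := fun q =>
    ENNReal.ofReal_le_ofReal (by linarith [le_of_abs_le (f.norm_coe_le_norm q)])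
  have h1 := hμ.tendsto_jweight_mul_hit hd p hp hvar hw K
  rw [hμ.ofReal_branchingCap hd p hp hvar hw K] at h1
  have h2 := hμ.tendsto_jweight_mul_setLIntegral hd p hp hvar hw K hF ENNReal.ofReal_ne_top hFM
  set c := ENNReal.ofReal (greenConst μ) with hc
  have hc0 : c ≠ 0 := by simpa [hc] using greenConst_pos (by omega) hμ
  have hcm : c * spineMass p hp μ K ≠ 0 := mul_ne_zero hc0 h0
  have hpos := h1.eventually_const_lt (pos_iff_ne_zero.2 hcm)
  have hlimF : ∫⁻ q, F q ∂(limitLaw p hp μ K) ≠ ∞ := by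
    refine ne_of_lt (lt_of_le_of_lt (lintegral_mono hFM) ?_)
    simp
  have h3 : Tendsto (fun x => ∫⁻ ω, F ((numPioneers K x ω).toReal, (occ K x ω).toReal)
      ∂((envLaw p μ)[|hitEvent K x])) (atInfinity d) (𝓝 (∫⁻ q, F q ∂(limitLaw p hp μ K))) := by
    have h4 := ENNReal.Tendsto.mul (tendsto_inv_iff.2 h1) (Or.inl (ENNReal.inv_ne_zero.2
      (ENNReal.mul_ne_top ENNReal.ofReal_ne_top (spineMass_lt_top p hp μ K).ne))) h2
      (Or.inr (ENNReal.inv_ne_top.2 hcm))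
    have h5 : (c * spineMass p hp μ K)⁻¹ * (c * ∑ y ∈ K, ∫⁻ b, spineWeight K y b *
        F (spinePair K y b) ∂(spineLaw p hp μ)) = ∫⁻ q, F q ∂(limitLaw p hp μ K) := by
      rw [lintegral_limitLaw p hp μ K hF, ENNReal.mul_inv (Or.inl hc0)
        (Or.inl ENNReal.ofReal_ne_top), mul_mul_mul_comm, ENNReal.inv_mul_cancel hc0 ENNReal.ofReal_ne_top, one_mul]
    rw [h5] at h4
    refine h4.congr' ?_
    filter_upwards [hpos] with x hx
    have hj0 : jweight μ x ≠ 0 := left_ne_zero_of_mul hx.ne'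
    rw [ProbabilityTheory.cond, lintegral_smul_measure, smul_eq_mul,
      ENNReal.mul_inv (Or.inl hj0) (Or.inl (jweight_ne_top μ x)), mul_mul_mul_comm,
      ENNReal.inv_mul_cancel hj0 (jweight_ne_top μ x), one_mul]
  have hX (x : Site d) : Measurable fun ω => ((numPioneers K x ω).toReal, (occ K x ω).toReal) :=
    (measurable_numPioneers K x).ennreal_toReal.prodMk (measurable_occ K x).ennreal_toReal
  have hlim := integral_eq_lintegral_sub (limitLaw p hp μ K) f measurable_id
  simp only [id] at hlim
  rw [hlim]
  refine (((ENNReal.tendsto_toReal hlimF).comp h3).sub_const ‖f‖).congr' ?_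
  filter_upwards [hpos] with x hx
  have := cond_isProbabilityMeasure (μ := envLaw p μ) (right_ne_zero_of_mul hx.ne')
  exact (integral_eq_lintegral_sub _ f (hX x)).symm

/-! ### Positivity -/

/-- The event that the spine started from `z` avoids `K` from time `n` on. -/
def avoidsFrom (K : Finset (Site d)) (n : ℕ) (z : Site d) : Set (Spine d) :=
  {b | ∀ k, n ≤ k → spinePos z b k ∉ K}

lemma measurableSet_avoidsFrom {α : Type*} [MeasurableSpace α] (K : Finset (Site d)) (n : ℕ)
    {f : α → Site d} (hf : Measurable f) {g : α → Spine d} (hg : Measurable g) :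
    MeasurableSet {a | g a ∈ avoidsFrom K n (f a)} := by
  have h : {a | g a ∈ avoidsFrom K n (f a)} =
      ⋂ k : ℕ, ⋂ _ : n ≤ k, {a | spinePos (f a) (g a) k ∈ K}ᶜ := by
    ext a
    simp [avoidsFrom]
  rw [h]
  refine MeasurableSet.iInter fun k => MeasurableSet.iInter fun _ => MeasurableSet.compl ?_
  have h1 : Measurable fun a => spinePos (f a) (g a) k := by unfold spinePos; fun_prop
  exact h1 (MeasurableSet.of_discrete (s := (K : Set (Site d))))

lemma spinePos_succ' (z : Site d) (b : Spine d) (k : ℕ) :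
    spinePos z b (k + 1) = spinePos (z + (b.1 0).1) (dropStep 0 b) k := by
  rw [spinePos, spinePos, Finset.sum_range_succ', add_assoc, add_comm (b.1 0).1]
  rfl

/-- The Markov property at time `1`. -/
lemma spineLaw_avoidsFrom_succ (p : PMF ℕ) (hp : offspringMean p = 1) (μ : PMF (Site d))
    (K : Finset (Site d)) (n : ℕ) (z : Site d) : spineLaw p hp μ (avoidsFrom K (n + 1) z) =
      ∫⁻ s, spineLaw p hp μ (avoidsFrom K n (z + s.1)) ∂(stepLaw p hp μ) := by
  classical
  have hms : MeasurableSet {q : Step d × Spine d | q.2 ∈ avoidsFrom K n (z + q.1.1)} :=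
    measurableSet_avoidsFrom K n (by fun_prop) (by fun_prop)
  have hF : Measurable ({q : Step d × Spine d | q.2 ∈ avoidsFrom K n (z + q.1.1)}.indicator
      (1 : Step d × Spine d → ℝ≥0∞)) := measurable_one.indicator hms
  have hm (m : ℕ) (w : Site d) : MeasurableSet (avoidsFrom K m w) :=
    measurableSet_avoidsFrom K m measurable_const measurable_id
  rw [← lintegral_indicator_one (hm _ _)]
  simp_rw [← fun w => lintegral_indicator_one (μ := spineLaw p hp μ) (hm n w)]
  refine (lintegral_congr fun b => ?_).trans (lintegral_spineLaw p hp μ 0 hF)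
  have hiff : b ∈ avoidsFrom K (n + 1) z ↔ dropStep 0 b ∈ avoidsFrom K n (z + (b.1 0).1) := by
    constructor
    · intro h k hk
      rw [← spinePos_succ']
      exact h (k + 1) (by omega)
    · intro h k hk
      obtain ⟨k, rfl⟩ := Nat.exists_eq_add_of_le' (show 1 ≤ k by omega)
      rw [spinePos_succ']
      exact h k (by omega)
  simp only [Set.indicator_apply]
  exact if_congr hiff rfl rfl

/-- The spine escapes from `K` from at least one of the points of `K`: otherwise it would return to
`K` again and again, and it visits `K` finitely often. -/
lemma IsJumpLaw.exists_spineLaw_neverReturns_ne_zero (hd : 5 ≤ d) (p : PMF ℕ)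
    (hp : offspringMean p = 1) (hvar : offspringVariance p < ∞) {μ : PMF (Site d)}
    (hμ : IsJumpLaw μ) {K : Finset (Site d)} (hK : K.Nonempty) :
    ∃ y ∈ K, spineLaw p hp μ (neverReturns K y) ≠ 0 := by
  by_contra! h
  -- were the conclusion false, avoiding `K` from time `1` on and from time `0` on would be equally
  -- likely; by the Markov property, so would be avoiding `K` from time `n` on
  have hbase (z : Site d) :
      spineLaw p hp μ (avoidsFrom K 1 z) = spineLaw p hp μ (avoidsFrom K 0 z) := by
    by_cases hz : z ∈ K
    · have h0 : avoidsFrom K 0 z = ∅ := by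
        refine Set.eq_empty_of_forall_notMem fun b hb => hb 0 le_rfl ?_
        rwa [spinePos_zero]
      rw [h0, measure_empty]
      exact h z hz
    · congr 1
      ext b
      refine ⟨fun hb k _ => ?_, fun hb k _ => hb k (Nat.zero_le k)⟩
      rcases k with _ | k
      · rwa [spinePos_zero]
      · exact hb (k + 1) (by omega)
  have hconst (n : ℕ) (z : Site d) :
      spineLaw p hp μ (avoidsFrom K n z) = spineLaw p hp μ (avoidsFrom K 0 z) := by
    induction n generalizing z with
    | zero => rfl
    | succ n ih =>
      rw [spineLaw_avoidsFrom_succ, ← hbase z, spineLaw_avoidsFrom_succ]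
      simp_rw [ih]
  obtain ⟨y, hy⟩ := hK
  have h0 (n : ℕ) : spineLaw p hp μ (avoidsFrom K n y) = 0 := by
    rw [hconst, ← hbase]
    exact h y hy
  have h1 : spineLaw p hp μ (⋃ n, avoidsFrom K n y) = 0 := measure_iUnion_null h0
  have h2 : ∀ᵐ b ∂(spineLaw p hp μ), b ∈ ⋃ n, avoidsFrom K n y := by
    filter_upwards [ae_tsum_stepVisits_lt_top hd p hp hvar μ hμ K y] with b hb
    obtain ⟨m, hm⟩ := exists_stepVisits_eq_zero hb
    refine Set.mem_iUnion.2 ⟨m + 1, fun k hk => ?_⟩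
    obtain ⟨k, rfl⟩ := Nat.exists_eq_add_of_le' (show 1 ≤ k by omega)
    exact (stepVisits_eq_zero_iff.1 (hm k (by omega))).1
  have h3 := (prob_compl_eq_zero_iff₀ (μ := spineLaw p hp μ)
    (NullMeasurableSet.of_null h1)).1 h2
  rw [h1] at h3
  exact zero_ne_one h3

lemma IsJumpLaw.spineMass_ne_zero (hd : 5 ≤ d) (p : PMF ℕ)
    (hp : offspringMean p = 1) (hvar : offspringVariance p < ∞) {μ : PMF (Site d)}
    (hμ : IsJumpLaw μ) {K : Finset (Site d)} (hK : K.Nonempty) : spineMass p hp μ K ≠ 0 := by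
  obtain ⟨y, hy, h⟩ := hμ.exists_spineLaw_neverReturns_ne_zero hd p hp hvar hK
  intro h0
  rw [spineMass, Finset.sum_eq_zero_iff] at h0
  have h1 := (lintegral_eq_zero_iff (measurable_spineWeight K y)).1 (h0 y hy)
  refine h (measure_eq_zero_iff_ae_notMem.2 ?_)
  filter_upwards [h1, ae_tsum_stepVisits_lt_top hd p hp hvar μ hμ K y] with b hb hfin hbn
  have hs : sibPioneers K y b < ∞ :=
    ((sibPioneers_le_sibOcc K y b).trans (sibOcc_le_tsum_stepVisits K y b)).trans_lt hfin
  rw [spineWeight, Set.indicator_of_mem hbn, Pi.zero_apply, ENNReal.inv_eq_zero] at hb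
  exact (ENNReal.add_lt_top.2 ⟨ENNReal.one_lt_top, hs⟩).ne hb

lemma pmf_zero_ne_zero {p : PMF ℕ} (hp1 : p 1 < 1) (hp : offspringMean p = 1) : p 0 ≠ 0 := by
  intro h0
  obtain ⟨k, hk, hk0⟩ : ∃ k, 2 ≤ k ∧ p k ≠ 0 := by
    by_contra! h
    have h1 := p.tsum_coe
    rw [tsum_eq_single 1 fun k hk => ?_] at h1
    · exact hp1.ne h1
    · rcases k with _ | _ | k
      · exact h0
      · exact absurd rfl hk
      · exact h _ (by omega)
  -- `p 0 = 0` and `p k ≠ 0` with `k ≥ 2` give a mean larger than `1`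
  have h1 : ∑' k, p k < ∑' k : ℕ, (k : ℝ≥0∞) * p k := by
    refine ENNReal.tsum_lt_tsum (i := k) (by rw [p.tsum_coe]; simp) (fun j => ?_) ?_
    · rcases j with _ | j
      · simp [h0]
      · exact le_mul_of_one_le_left' (by exact_mod_cast Nat.succ_pos j)
    · calc p k = 1 * p k := (one_mul _).symm
        _ < k * p k := (ENNReal.mul_lt_mul_iff_left hk0 (p.apply_ne_top k)).2
          (by exact_mod_cast (show 1 < k by omega))
  rw [p.tsum_coe, ← offspringMean, hp] at h1
  exact lt_irrefl _ h1

lemma convPow_mul_le (f : Site d → ℝ≥0∞) (m n : ℕ) (x y : Site d) :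
    convPow f m x * convPow f n (y - x) ≤ convPow f (m + n) y := by
  rw [convPow_add]
  exact ENNReal.le_tsum (f := fun z => convPow f m z * convPow f n (y - z)) x

/-- The walk visits every point at a positive time, with positive probability. -/
lemma IsJumpLaw.exists_convPow_ne_zero (hd : 5 ≤ d) {μ : PMF (Site d)} (hμ : IsJumpLaw μ)
    (hw : WeakLd μ) (u : Site d) : ∃ n, 1 ≤ n ∧ convPow μ n u ≠ 0 := by
  have := atInfinity_neBot (d := d) (by omega)
  have hpos (z : Site d) : ∀ᶠ x in atInfinity d, green μ (z - x) ≠ 0 := by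
    filter_upwards [(hμ.tendsto_jweight_mul_green hd hw z).eventually_const_lt
      (ENNReal.ofReal_pos.2 (greenConst_pos (by omega) hμ))] with x hx
    exact right_ne_zero_of_mul hx.ne'
  have hex {x : Site d} (h : green μ x ≠ 0) : ∃ n, convPow μ n x ≠ 0 := by
    by_contra! h'
    exact h (ENNReal.tsum_eq_zero.2 h')
  -- go through a distant point `x`, which is reached from `0` and from which `u` is reached, as the
  -- Green function is positive far away
  have h2 : ∀ᶠ x in atInfinity d, green μ (0 - (0 - x)) ≠ 0 :=
    (tendsto_sub_atInfinity 0).eventually (hpos 0)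
  obtain ⟨x, hx0, hx1, hx2⟩ := (eventually_ne_zero.and ((hpos u).and h2)).exists
  rw [zero_sub, zero_sub, neg_neg] at hx2
  obtain ⟨n, hn⟩ := hex hx2
  obtain ⟨m, hm⟩ := hex hx1
  have hn1 : 1 ≤ n := by
    rcases n with _ | n
    · exact absurd (by rw [convPow, Pi.single_apply, if_neg hx0]) hn
    · omega
  refine ⟨n + m, by omega, fun h => ?_⟩
  have := convPow_mul_le (μ : Site d → ℝ≥0∞) n m x u
  rw [h, nonpos_iff_eq_zero, mul_eq_zero] at this
  exact this.elim hn hm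

lemma IsJumpLaw.one_lt_green_zero (hd : 5 ≤ d) {μ : PMF (Site d)} (hμ : IsJumpLaw μ)
    (hw : WeakLd μ) : 1 < green μ 0 := by
  obtain ⟨n, hn, h⟩ := hμ.exists_convPow_ne_zero hd hw 0
  obtain ⟨n, rfl⟩ := Nat.exists_eq_add_of_le' hn
  have h1 : green μ 0 = 1 + ∑' k, convPow μ (k + 1) 0 := by
    rw [green, tsum_eq_zero_add' ENNReal.summable]
    simp [convPow]
  rw [h1]
  refine ENNReal.lt_add_right ENNReal.one_ne_top fun h0 => h ?_
  exact ENNReal.tsum_eq_zero.1 h0 n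

lemma envLaw_root_eq (p : PMF ℕ) (μ : PMF (Site d)) (k : ℕ) :
    envLaw p μ {ω | (ω []).1 = k} = p k := by
  have h := Measure.infinitePi_map_eval (fun _ : List ℕ => p.toMeasure.prod μ.toMeasure) []
  have hs : MeasurableSet ({k} ×ˢ Set.univ : Set (ℕ × Site d)) := .of_discrete
  have h2 : (envLaw p μ).map (fun ω => ω []) ({k} ×ˢ Set.univ) = p k := by
    rw [envLaw, h, Measure.prod_prod, measure_univ, mul_one,
      p.toMeasure_apply_singleton _ (measurableSet_singleton k)]
  rw [← h2, Measure.map_apply (by fun_prop) hs]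
  congr 1
  ext ω
  simp

/-- The counts of `K` take positive values with positive probability. -/
lemma IsJumpLaw.envLaw_numPioneers_ne_zero (hd : 5 ≤ d) (p : PMF ℕ) (hp : offspringMean p = 1)
    {μ : PMF (Site d)} (hμ : IsJumpLaw μ) (hw : WeakLd μ) {K : Finset (Site d)} (hK : K.Nonempty)
    (x : Site d) : ¬ ∀ᵐ ω ∂(envLaw p μ), numPioneers K x ω = 0 := by
  intro h
  have h1 : ∫⁻ ω, occ K x ω ∂(envLaw p μ) = 0 := by
    rw [lintegral_eq_zero_iff (measurable_occ K x)]
    filter_upwards [h] with ω hω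
    exact (numPioneers_eq_zero_iff K x ω).1 hω
  rw [lintegral_occ p hp, Finset.sum_eq_zero_iff] at h1
  obtain ⟨y, hy⟩ := hK
  obtain ⟨n, -, hn⟩ := hμ.exists_convPow_ne_zero hd hw (y - x)
  exact hn (le_antisymm ((convPow_le_green _ n _).trans (h1 y hy).le) zero_le)

/-- From outside `K`, the root may have no children. -/
lemma envLaw_numPioneers_eq_zero {p : PMF ℕ} (hp1 : p 1 < 1) (hp : offspringMean p = 1)
    (μ : PMF (Site d)) {K : Finset (Site d)} {x : Site d} (hx : x ∉ K) :
    ¬ ∀ᵐ ω ∂(envLaw p μ), numPioneers K x ω ≠ 0 := by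
  intro h
  refine pmf_zero_ne_zero hp1 hp ?_
  rw [← envLaw_root_eq p μ 0]
  refine measure_eq_zero_iff_ae_notMem.2 ?_
  filter_upwards [h] with ω hω h0
  refine hω ?_
  rw [numPioneers_of_notMem hx, show (ω []).1 = 0 from h0, Finset.range_zero, Finset.sum_empty]

/-- The occupation time of `K`, started from a point of `K`, is not constant: it is equal to `1`
with positive probability, and its mean is larger than `1`. -/
lemma IsJumpLaw.not_ae_occ_eq (hd : 5 ≤ d) {p : PMF ℕ} (hp1 : p 1 < 1) (hp : offspringMean p = 1)
    {μ : PMF (Site d)} (hμ : IsJumpLaw μ) (hw : WeakLd μ) {K : Finset (Site d)} {y : Site d}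
    (hy : y ∈ K) (r : ℝ) : ¬ ∀ᵐ ω ∂(envLaw p μ), (occ K y ω).toReal = r := by
  intro h
  have hr : r = 1 := by
    by_contra hr
    refine pmf_zero_ne_zero hp1 hp ?_
    rw [← envLaw_root_eq p μ 0]
    refine measure_eq_zero_iff_ae_notMem.2 ?_
    filter_upwards [h] with ω hω h0
    rw [occ_eq_add, if_pos hy, show (ω []).1 = 0 from h0, Finset.range_zero, Finset.sum_empty,
      add_zero, ENNReal.toReal_one] at hω
    exact hr hω.symm
  have h1 : ∫⁻ ω, occ K y ω ∂(envLaw p μ) = 1 := by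
    rw [lintegral_congr_ae (g := fun _ => 1)]
    · simp
    · filter_upwards [h, ae_occ_lt_top hd p hp μ hμ K y] with ω h2 h3
      rw [← ENNReal.ofReal_toReal h3.ne, h2, hr, ENNReal.ofReal_one]
  rw [lintegral_occ p hp] at h1
  have h2 := Finset.single_le_sum (f := fun y' => green μ (y' - y)) (fun _ _ => zero_le) hy
  rw [h1, sub_self] at h2
  exact absurd (hμ.one_lt_green_zero hd hw) (not_lt.2 h2)

/-! ### Non-degeneracy of the limit law -/

/-- The sequence obtained by inserting `c` at place `k` into the sequence `s`. -/
def insertAt {E : Type*} (k : ℕ) (c : E) (s : ℕ → E) (n : ℕ) : E :=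
  if n = k then c else s (if n < k then n else n - 1)

@[fun_prop]
lemma measurable_insertAt {E α : Type*} [MeasurableSpace E] [MeasurableSpace α] (k : ℕ) {f : α → E}
    {g : α → ℕ → E} (hf : Measurable f) (hg : Measurable g) :
    Measurable fun a => insertAt k (f a) (g a) := by
  refine measurable_pi_lambda _ fun n => ?_
  unfold insertAt
  split_ifs <;> fun_prop

lemma insertAt_skipIdx {E : Type*} (k : ℕ) (c : E) (v : ℕ → E) :
    insertAt k c (fun n => v (skipIdx k n)) = Function.update v k c := by
  funext n
  unfold insertAt skipIdx
  rcases lt_trichotomy n k with h | h | h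
  · simp [h.ne, h]
  · simp [h]
  · have h1 : ¬ n < k := by omega
    have h2 : ¬ n - 1 < k := by omega
    simp [h.ne', h1, h2, Nat.sub_add_cancel (show 1 ≤ n by omega)]

/-- Resampling one term of an i.i.d. sequence preserves its law. -/
lemma measurePreserving_update {E A : Type*} [MeasurableSpace E] [MeasurableSpace A]
    {Q : Measure E} [IsProbabilityMeasure Q] {ν : Measure A} [IsProbabilityMeasure ν]
    {m : E × A → E} (hm : MeasurePreserving m (Q.prod ν) Q) (k : ℕ) :
    MeasurePreserving (fun r : (ℕ → E) × A => Function.update r.1 k (m (r.1 k, r.2)))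
      ((Measure.infinitePi fun _ : ℕ => Q).prod ν) (Measure.infinitePi fun _ : ℕ => Q) := by
  have hmm : Measurable m := hm.measurable
  have hT : Measurable fun r : (ℕ → E) × A => Function.update r.1 k (m (r.1 k, r.2)) := by
    simp_rw [← insertAt_skipIdx]
    fun_prop
  refine ⟨hT, Measure.ext_of_lintegral _ fun F hF => ?_⟩
  have h1 : Measurable fun q : (E × (ℕ → E)) × A => F (insertAt k (m (q.1.1, q.2)) q.1.2) := by
    fun_prop
  have h2 : Measurable fun q : E × (ℕ → E) => F (insertAt k q.1 q.2) := by fun_prop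
  have h3 (c : E) : Measurable fun q : (ℕ → E) × A => F (insertAt k (m (c, q.2)) q.1) := by
    fun_prop
  have h4 : Measurable fun c => ∫⁻ s, F (insertAt k c s) ∂(Measure.infinitePi fun _ : ℕ => Q) :=
    h2.lintegral_prod_right'
  have h5 : Measurable fun r : (ℕ → E) × A => F (Function.update r.1 k (m (r.1 k, r.2))) :=
    hF.comp hT
  have h6 : Measurable fun q : E × A =>
      ∫⁻ s, F (insertAt k (m q) s) ∂(Measure.infinitePi fun _ : ℕ => Q) := h4.comp hmm
  rw [lintegral_map hF hT, lintegral_prod _ h5.aemeasurable]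
  calc ∫⁻ v, ∫⁻ a, F (Function.update v k (m (v k, a))) ∂ν ∂(Measure.infinitePi fun _ : ℕ => Q)
      = ∫⁻ c, ∫⁻ s, ∫⁻ a, F (insertAt k (m (c, a)) s) ∂ν ∂(Measure.infinitePi fun _ : ℕ => Q) ∂Q := by
        rw [← lintegral_split Q (skipIdx_injective k) (skipIdx_ne k)
          (F := fun q => ∫⁻ a, F (insertAt k (m (q.1, a)) q.2) ∂ν) h1.lintegral_prod_right']
        simp_rw [insertAt_skipIdx]
    _ = ∫⁻ c, ∫⁻ a, ∫⁻ s, F (insertAt k (m (c, a)) s) ∂(Measure.infinitePi fun _ : ℕ => Q) ∂ν ∂Q :=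
        lintegral_congr fun c => lintegral_lintegral_swap (h3 c).aemeasurable
    _ = ∫⁻ c, ∫⁻ s, F (insertAt k c s) ∂(Measure.infinitePi fun _ : ℕ => Q) ∂Q := by
        rw [← hm.lintegral_comp h4, lintegral_prod _ h6.aemeasurable]
    _ = ∫⁻ v, F v ∂(Measure.infinitePi fun _ : ℕ => Q) := by
        rw [← lintegral_split Q (skipIdx_injective k) (skipIdx_ne k) h2]
        simp_rw [insertAt_skipIdx, Function.update_eq_self]

/-- The step `s` in which the branching random walk issued from the first sibling is replaced. -/
def resampleStep (r : Step d × Env d) : Step d :=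
  (r.1.1, r.1.2.1, Function.update r.1.2.2 0 ((r.1.2.2 0).1, r.2))

lemma measurePreserving_resampleStep (p : PMF ℕ) (hp : offspringMean p = 1) (μ : PMF (Site d)) :
    MeasurePreserving resampleStep ((stepLaw p hp μ).prod (envLaw p μ)) (stepLaw p hp μ) := by
  have h0 : MeasurePreserving (fun r : (Site d × Env d) × Env d => (r.1.1, r.2))
      ((μ.toMeasure.prod (envLaw p μ)).prod (envLaw p μ)) (μ.toMeasure.prod (envLaw p μ)) :=
    measurePreserving_fst.prod (MeasurePreserving.id _)
  have h1 := measurePreserving_update h0 0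
  have h2 := ((MeasurePreserving.id (siblingLaw p hp).toMeasure).prod h1).comp
    (measurePreserving_prodAssoc _ _ _)
  exact ((MeasurePreserving.id (μ.map fun x => -x).toMeasure).prod h2).comp
    (measurePreserving_prodAssoc _ _ _)

/-- The spine in which the branching random walk issued from the first sibling at step `k + 1` is
replaced by `e`. -/
def resample (k : ℕ) (v : ℕ → Step d) (e : Env d) : ℕ → Step d :=
  Function.update v k (resampleStep (v k, e))

/-- An almost sure property of the spine remains true after the branching random walk issued from a
first sibling is replaced by an independent one. -/
lemma ae_resample {p : PMF ℕ} {hp : offspringMean p = 1} {μ : PMF (Site d)}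
    {P : (ℕ → Step d) → Prop} (h : ∀ᵐ v ∂(Measure.infinitePi fun _ : ℕ => stepLaw p hp μ), P v)
    (k : ℕ) : ∀ᵐ v ∂(Measure.infinitePi fun _ : ℕ => stepLaw p hp μ),
      ∀ᵐ e ∂(envLaw p μ), P (resample k v e) :=
  Measure.ae_ae_of_ae_prod
    ((measurePreserving_update (measurePreserving_resampleStep p hp μ) k).quasiMeasurePreserving.ae h)

lemma resample_of_ne {k n : ℕ} (h : n ≠ k) (v : ℕ → Step d) (e : Env d) :
    resample k v e n = v n := Function.update_of_ne h _ _

lemma spinePos_resample (y : Site d) (k : ℕ) (v : ℕ → Step d) (e e₀ : Env d) (n : ℕ) :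
    spinePos y (resample k v e, e₀) n = spinePos y (v, e₀) n := by
  unfold spinePos
  congr 1
  refine Finset.sum_congr rfl fun i _ => ?_
  rcases eq_or_ne i k with rfl | h
  · simp [resample, resampleStep]
  · simp [resample_of_ne h]

/-- The pioneers in the branching random walk issued from the first sibling at step `k + 1` can be
separated from all the others. -/
lemma exists_sibPioneers_resample (K : Finset (Site d)) (y : Site d) (k : ℕ) (v : ℕ → Step d)
    (e₀ : Env d) (h : numSib (v, e₀) k ≠ 0) : ∃ R : ℝ≥0∞, ∀ e,
      sibPioneers K y (resample k v e, e₀) = R + numPioneers K (sibPos y (v, e₀) k 0) e := by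
  classical
  obtain ⟨n, hn⟩ := Nat.exists_eq_succ_of_ne_zero h
  rw [numSib] at hn
  refine ⟨∑ j ∈ Finset.range n, numPioneers K (spinePos y (v, e₀) (k + 1) + ((v k).2.2 (j + 1)).1)
      ((v k).2.2 (j + 1)).2 + ∑' i, if i = k then 0 else
        stepPioneers K (spinePos y (v, e₀) (i + 1)) (v i), fun e => ?_⟩
  rw [sibPioneers_eq, ENNReal.tsum_eq_add_tsum_ite k]
  simp_rw [spinePos_resample]
  have h1 : stepPioneers K (spinePos y (v, e₀) (k + 1)) (resample k v e k) =
      ∑ j ∈ Finset.range n, numPioneers K (spinePos y (v, e₀) (k + 1) + ((v k).2.2 (j + 1)).1)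
        ((v k).2.2 (j + 1)).2 + numPioneers K (sibPos y (v, e₀) k 0) e := by
    rw [resample, Function.update_self, resampleStep, stepPioneers]
    simp only
    rw [hn, Finset.sum_range_succ']
    simp [sibPos]
  rw [h1, add_right_comm]
  congr 2
  refine tsum_congr fun i => ?_
  split_ifs with hi
  · rfl
  · rw [resample_of_ne hi]

/-- If the number of pioneers issued from the siblings is constant when the spine does not return
to `K`, then the first siblings are all in `K`. -/
lemma IsJumpLaw.ae_numSib_eq_zero_or_sibPos_mem (hd : 5 ≤ d) {p : PMF ℕ} (hp1 : p 1 < 1)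
    (hp : offspringMean p = 1) (hvar : offspringVariance p < ∞) {μ : PMF (Site d)}
    (hμ : IsJumpLaw μ) (hw : WeakLd μ) {K : Finset (Site d)} (hK : K.Nonempty) {y : Site d} {r : ℝ}
    (h : ∀ᵐ b ∂(spineLaw p hp μ), b ∈ neverReturns K y → (sibPioneers K y b).toReal = r) (k : ℕ) :
    ∀ᵐ b ∂(spineLaw p hp μ), b ∈ neverReturns K y → numSib b k = 0 ∨ sibPos y b k 0 ∈ K := by
  set e₀ : Env d := fun _ => 0
  have h1 : ∀ᵐ v ∂(Measure.infinitePi fun _ : ℕ => stepLaw p hp μ),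
      ((v, e₀) ∈ neverReturns K y → (sibPioneers K y (v, e₀)).toReal = r) ∧
        sibPioneers K y (v, e₀) < ∞ := by
    filter_upwards [Measure.ae_ae_of_ae_prod h, Measure.ae_ae_of_ae_prod
      (ae_tsum_stepVisits_lt_top hd p hp hvar μ hμ K y)] with v hv hfin
    obtain ⟨e, he, he'⟩ := (hv.and hfin).exists
    exact ⟨he, ((sibPioneers_le_sibOcc K y (v, e)).trans
      (sibOcc_le_tsum_stepVisits K y (v, e))).trans_lt he'⟩
  refine Measure.quasiMeasurePreserving_fst.ae (p := fun v => (v, e₀) ∈ neverReturns K y →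
    numSib (v, e₀) k = 0 ∨ sibPos y (v, e₀) k 0 ∈ K) ?_
  filter_upwards [ae_resample h1 k] with v hv hnever
  by_contra! hcon
  -- `R` is fixed, and the independent number of pioneers is `0` as well as not `0` with positive
  -- probability
  obtain ⟨R, hR⟩ := exists_sibPioneers_resample K y k v e₀ hcon.1
  have hv' : ∀ᵐ e ∂(envLaw p μ), (R + numPioneers K (sibPos y (v, e₀) k 0) e).toReal = r ∧
      R + numPioneers K (sibPos y (v, e₀) k 0) e < ∞ := by
    filter_upwards [hv] with e he
    rw [hR] at he
    refine ⟨he.1 fun n hn => ?_, he.2⟩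
    rw [spinePos_resample]
    exact hnever n hn
  have hRr : R.toReal = r := by
    by_contra hne
    refine envLaw_numPioneers_eq_zero hp1 hp μ hcon.2 ?_
    filter_upwards [hv'] with e he h0
    rw [h0, add_zero] at he
    exact hne he.1
  refine hμ.envLaw_numPioneers_ne_zero hd p hp hw hK (sibPos y (v, e₀) k 0) ?_
  filter_upwards [hv'] with e he
  obtain ⟨h2, h3⟩ := ENNReal.add_lt_top.1 he.2
  have h4 := he.1
  rw [ENNReal.toReal_add h2.ne h3.ne, hRr, add_eq_left] at h4
  exact ((ENNReal.toReal_eq_zero_iff _).1 h4).resolve_right h3.ne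

lemma stepLaw_numSib_eq_zero (p : PMF ℕ) (hp : offspringMean p = 1) (μ : PMF (Site d)) :
    stepLaw p hp μ {s | s.2.1.1 + s.2.1.2 = 0} = p 1 := by
  have h : {s : Step d | s.2.1.1 + s.2.1.2 = 0} = Set.univ ×ˢ ({(0, 0)} ×ˢ Set.univ) := by
    ext ⟨x, ⟨i, j⟩, e⟩
    simp
  rw [h, stepLaw, Measure.prod_prod, Measure.prod_prod, measure_univ, measure_univ, one_mul,
    mul_one, PMF.toMeasure_apply_singleton _ _ (measurableSet_singleton _)]
  rfl

/-- Infinitely many vertices of the spine have siblings. -/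
lemma ae_exists_numSib_ne_zero {p : PMF ℕ} (hp1 : p 1 < 1) (hp : offspringMean p = 1)
    (μ : PMF (Site d)) : ∀ᵐ b ∂(spineLaw p hp μ), ∀ m, ∃ k, m ≤ k ∧ numSib b k ≠ 0 := by
  refine ae_all_iff.2 fun m => ?_
  refine Measure.quasiMeasurePreserving_fst.ae
    (p := fun v : ℕ → Step d => ∃ k, m ≤ k ∧ (v k).2.1.1 + (v k).2.1.2 ≠ 0) ?_
  have hle (N : ℕ) : (Measure.infinitePi fun _ : ℕ => stepLaw p hp μ)
      {v | ¬ ∃ k, m ≤ k ∧ (v k).2.1.1 + (v k).2.1.2 ≠ 0} ≤ p 1 ^ N := by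
    have hs : MeasurableSet {s : Step d | s.2.1.1 + s.2.1.2 = 0} :=
      (measurableSet_singleton 0).preimage (by fun_prop)
    have hpi := Measure.infinitePi_pi (fun _ : ℕ => stepLaw p hp μ) (s := Finset.Ico m (m + N))
      (t := fun _ => {s : Step d | s.2.1.1 + s.2.1.2 = 0}) fun _ _ => hs
    rw [Finset.prod_const, stepLaw_numSib_eq_zero, Nat.card_Ico, Nat.add_sub_cancel_left] at hpi
    rw [← hpi]
    refine measure_mono fun v hv k hk => ?_
    simp only [Set.mem_ofPred_eq, not_exists, not_and, not_not] at hv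
    exact hv k (Finset.mem_Ico.1 hk).1
  exact le_antisymm (ge_of_tendsto' (ENNReal.tendsto_pow_atTop_nhds_zero_of_lt_one hp1) hle) zero_le

/-- The number of pioneers issued from the siblings is not constant on the event that the spine
does not return to `K`: otherwise the first siblings are all in `K`, and then infinitely many steps
of the spine lead to visits to `K`. -/
lemma IsJumpLaw.not_ae_sibPioneers_eq (hd : 5 ≤ d) {p : PMF ℕ} (hp1 : p 1 < 1)
    (hp : offspringMean p = 1) (hvar : offspringVariance p < ∞) {μ : PMF (Site d)}
    (hμ : IsJumpLaw μ) (hw : WeakLd μ) {K : Finset (Site d)} (hK : K.Nonempty) {y : Site d}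
    (hy : spineLaw p hp μ (neverReturns K y) ≠ 0) (r : ℝ) :
    ¬ ∀ᵐ b ∂(spineLaw p hp μ), b ∈ neverReturns K y → (sibPioneers K y b).toReal = r := by
  intro h
  refine hy (measure_eq_zero_iff_ae_notMem.2 ?_)
  filter_upwards [ae_all_iff.2 fun k =>
      hμ.ae_numSib_eq_zero_or_sibPos_mem hd hp1 hp hvar hw hK h k,
    ae_exists_numSib_ne_zero hp1 hp μ, ae_tsum_stepVisits_lt_top hd p hp hvar μ hμ K y]
    with b h1 h2 h3 hb
  obtain ⟨m, hm⟩ := exists_stepVisits_eq_zero h3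
  obtain ⟨k, hk, hk0⟩ := h2 m
  have hmem := (h1 k hb).resolve_left hk0
  have h4 := (stepVisits_eq_zero_iff.1 (hm k hk)).2
  rw [stepOcc, Finset.sum_eq_zero_iff] at h4
  have h5 := h4 0 (Finset.mem_range.2 (Nat.pos_of_ne_zero hk0))
  rw [sibPos] at hmem
  rw [occ_eq_add, if_pos hmem] at h5
  simp at h5

/-- The limit law is not carried by a line. -/
lemma IsJumpLaw.not_ae_limitLaw_eq (hd : 5 ≤ d) {p : PMF ℕ} (hp1 : p 1 < 1)
    (hp : offspringMean p = 1) (hvar : offspringVariance p < ∞) {μ : PMF (Site d)}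
    (hμ : IsJumpLaw μ) (hw : WeakLd μ) {K : Finset (Site d)} (hK : K.Nonempty) {a b c : ℝ}
    (hab : (a, b) ≠ (0, 0)) : ¬ ∀ᵐ q ∂(limitLaw p hp μ K), a * q.1 + b * q.2 = c := by
  intro h
  obtain ⟨y, hyK, hy⟩ := hμ.exists_spineLaw_neverReturns_ne_zero hd p hp hvar hK
  have hline : MeasurableSet {q : ℝ × ℝ | ¬ a * q.1 + b * q.2 = c} :=
    (measurableSet_eq_fun (by fun_prop) (by fun_prop)).compl
  have hF : Measurable ({q : ℝ × ℝ | ¬ a * q.1 + b * q.2 = c}.indicator (1 : ℝ × ℝ → ℝ≥0∞)) :=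
    measurable_one.indicator hline
  have h0 : limitLaw p hp μ K {q : ℝ × ℝ | ¬ a * q.1 + b * q.2 = c} = 0 := h
  rw [← lintegral_indicator_one hline, lintegral_limitLaw p hp μ K hF, mul_eq_zero,
    ENNReal.inv_eq_zero, or_iff_right (spineMass_lt_top p hp μ K).ne, Finset.sum_eq_zero_iff] at h0
  have h1 := (lintegral_eq_zero_iff ((measurable_spineWeight K y).mul
    (hF.comp (measurable_spinePair K y)))).1 (h0 y hyK)
  have h2 : ∀ᵐ v ∂(spineLaw p hp μ), v ∈ neverReturns K y →
      sibPioneers K y v < ∞ ∧ sibOcc K y v < ∞ ∧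
        a * (1 + sibPioneers K y v).toReal + b * (occ K y v.2 + sibOcc K y v).toReal = c := by
    filter_upwards [h1, ae_tsum_stepVisits_lt_top hd p hp hvar μ hμ K y] with v hv hfin hnever
    have hocc := (sibOcc_le_tsum_stepVisits K y v).trans_lt hfin
    have hs := (sibPioneers_le_sibOcc K y v).trans_lt hocc
    refine ⟨hs, hocc, ?_⟩
    rw [Pi.mul_apply, Pi.zero_apply, mul_eq_zero, spineWeight, Set.indicator_of_mem hnever,
      ENNReal.inv_eq_zero, or_iff_right (ENNReal.add_lt_top.2 ⟨ENNReal.one_lt_top, hs⟩).ne,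
      Function.comp, Set.indicator_apply_eq_zero] at hv
    by_contra hne
    exact one_ne_zero (hv hne)
  rcases eq_or_ne b 0 with rfl | hb
  -- the number of pioneers would be constant when the spine does not return to `K`
  · have ha : a ≠ 0 := fun ha => hab (by rw [ha])
    refine hμ.not_ae_sibPioneers_eq hd hp1 hp hvar hw hK hy (c / a - 1) ?_
    filter_upwards [h2] with v hv hnever
    obtain ⟨h3, -, h4⟩ := hv hnever
    rw [zero_mul, add_zero, ENNReal.toReal_add ENNReal.one_ne_top h3.ne, ENNReal.toReal_one] at h4
    field_simp
    linarith
  · refine hy (measure_eq_zero_iff_ae_notMem.2 ?_)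
    set e₀ : Env d := fun _ => 0
    refine Measure.quasiMeasurePreserving_fst.ae (p := fun v => (v, e₀) ∉ neverReturns K y) ?_
    filter_upwards [Measure.ae_ae_of_ae_prod h2] with v hv hnever
    -- for a fixed spine, the equation of the line determines the independent term `Z_K(y)`
    refine hμ.not_ae_occ_eq hd hp1 hp hw hyK ((c - a * (1 + sibPioneers K y (v, e₀)).toReal) / b -
      (sibOcc K y (v, e₀)).toReal) ?_
    filter_upwards [hv, ae_occ_lt_top hd p hp μ hμ K y] with e he hfin
    obtain ⟨-, h3, h4⟩ := he hnever
    rw [ENNReal.toReal_add hfin.ne h3.ne] at h4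
    change a * (1 + sibPioneers K y (v, e₀)).toReal +
      b * ((occ K y e).toReal + (sibOcc K y (v, e₀)).toReal) = c at h4
    field_simp
    linarith

end CBRW

end

theorem theorem2 {d : ℕ} (hd : 5 ≤ d)
    (p : PMF ℕ) (hp1 : p 1 < 1) (hmean : CBRW.offspringMean p = 1)
    (hvar_pos : 0 < CBRW.offspringVariance p) (hvar_fin : CBRW.offspringVariance p < ∞)
    (μ : PMF (CBRW.Site d)) (hμ : CBRW.IsJumpLaw μ) (hweak : CBRW.WeakLd μ)
    (K : Finset (CBRW.Site d)) (hK : K.Nonempty) :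
    -- all the counts are almost surely finite
    (∀ x, ∀ᵐ ω ∂(CBRW.envLaw p μ), CBRW.numPioneers K x ω < ∞ ∧ CBRW.occ K x ω < ∞) ∧
    (∀ y ∈ K, ∀ᵐ b ∂(CBRW.spineLaw p hmean μ),
      CBRW.sibPioneers K y b < ∞ ∧ CBRW.sibOcc K y b < ∞) ∧
    -- asymptotics of the hitting probability, and the branching capacity through the spine
    0 < CBRW.branchingCap p hmean μ K ∧
    Tendsto (fun x => CBRW.jnorm μ x ^ (d - 2) *
        (CBRW.envLaw p μ).real {ω | 1 ≤ CBRW.occ K x ω})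
      (CBRW.atInfinity d) (𝓝 (CBRW.greenConst μ * CBRW.branchingCap p hmean μ K)) ∧
    ENNReal.ofReal (CBRW.branchingCap p hmean μ K) = CBRW.spineMass p hmean μ K ∧
    -- joint convergence in law of `(L_K, Z_𝕋(K))` under `P_x(· | Z_𝕋(K) ≥ 1)`
    IsProbabilityMeasure (CBRW.limitLaw p hmean μ K) ∧
    (∀ f : BoundedContinuousFunction (ℝ × ℝ) ℝ,
      Tendsto (fun x => ∫ ω, f ((CBRW.numPioneers K x ω).toReal, (CBRW.occ K x ω).toReal)
          ∂((CBRW.envLaw p μ)[|{ω | 1 ≤ CBRW.occ K x ω}]))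
        (CBRW.atInfinity d) (𝓝 (∫ q, f q ∂(CBRW.limitLaw p hmean μ K)))) ∧
    -- the limit is non-degenerate: it is not carried by a point or a line
    (∀ a b c : ℝ, (a, b) ≠ (0, 0) →
      ¬ ∀ᵐ q ∂(CBRW.limitLaw p hmean μ K), a * q.1 + b * q.2 = c) := by
  have hmass : CBRW.spineMass p hmean μ K ≠ 0 :=
    hμ.spineMass_ne_zero hd p hmean hvar_fin hK
  have := CBRW.isProbabilityMeasure_limitLaw hmass
  have hcap := hμ.ofReal_branchingCap hd p hmean hvar_fin hweak K
  have hpos : 0 < CBRW.branchingCap p hmean μ K := by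
    rw [← ENNReal.ofReal_pos, hcap]
    exact pos_iff_ne_zero.2 hmass
  refine ⟨fun x => ?_, fun y _ => ?_, hpos, ?_, hcap, this, fun f => ?_, ?_⟩
  · filter_upwards [CBRW.ae_occ_lt_top hd p hmean μ hμ K x] with ω h
    exact ⟨(CBRW.numPioneers_le_occ K x ω).trans_lt h, h⟩
  · filter_upwards [CBRW.ae_tsum_stepVisits_lt_top hd p hmean hvar_fin μ hμ K y] with b hb
    have h := (CBRW.sibOcc_le_tsum_stepVisits K y b).trans_lt hb
    exact ⟨(CBRW.sibPioneers_le_sibOcc K y b).trans_lt h, h⟩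
  · have h := hμ.tendsto_jweight_mul_hit hd p hmean hvar_fin hweak K
    rw [← ENNReal.ofReal_mul (CBRW.greenConst_pos (by omega) hμ).le] at h
    have h1 := (ENNReal.tendsto_toReal ENNReal.ofReal_ne_top).comp h
    rw [ENNReal.toReal_ofReal (mul_pos (CBRW.greenConst_pos (by omega) hμ) hpos).le] at h1
    refine h1.congr fun x => ?_
    rw [Function.comp, ENNReal.toReal_mul, CBRW.jweight,
      ENNReal.toReal_ofReal (pow_nonneg (CBRW.jnorm_nonneg μ x) _)]
    rfl
  · exact hμ.tendsto_integral_cond hd p hmean hvar_fin hweak K hmass f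
  · exact fun a b c hab => hμ.not_ae_limitLaw_eq hd hp1 hmean hvar_fin hweak hK hab
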